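/- Let $\mathbb{T}=\mathbb{R}/2\pi\mathbb{Z}$ with normalized Lebesgue measure, $\hat f(k)=\frac1{2\pi}\int_0^{2\pi}f(x)e^{-ikx}\,dx$, and let $\mathcal H$ be the Hilbert transform, $\widehat{\mathcal H f}(k)=-i\,\mathrm{sgn}(k)\hat f(k)$. For $T\in(0,1]$, a smooth solution of the Benjamin–Ono equation on $[0,T]$ is a real-valued function $u\in C^\infty([0,T]\times\mathbb{T})$ with $\int_{\mathbb{T}}u(0,x)\,dx=0$ and $$\partial_t u+\mathcal H\partial_{xx}u=u\,\partial_x u .$$ For $N\in\{1,2,4,8,\dots\}$ let $P_N$ be the Fourier projection onto the frequencies $N\le|k|<2N$ if $N\ge2$, and onto $|k|<2$ if $N=1$. For an interval $I=[a,b)$, a $U^2(I)$-atom is a step function $\sum_{k=1}^K\phi_{k-1}\chi_{[t_{k-1},t_k)}$ with $a=t_0<\dots<t_K=b$, $\phi_k\in L^2(\mathbb{T};\mathbb{C})$ and $\sum_{k}\|\phi_k\|_{L^2}^2=1$; put $$\|f\|_{U^2(I)}=\inf\Big\{\sum_{n}|\lambda_n| : f(t)=\sum_{n}\lambda_n a_n(t)\text{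 for } t\in I,\ a_n\ U^2(I)\text{-atoms}\Big\},\qquad \|f\|_{U^2_{BO}(I)}=\|e^{t\mathcal H\partial_{xx}}f\|_{U^2(I)} .$$ Here $e^{t\mathcal H\partial_{xx}}$ has the Fourier multiplier $e^{itk|k|}$, that is, it is the inverse of the free evolution. For $\sigma\ge 0$ define $$\|u\|_{F^\sigma(T)}^2=\sum_{N}N^{2\sigma}\sup_{I\subseteq[0,T],\ |I|=\min(N^{-1},T)}\|P_Nu\|_{U^2_{BO}(I)}^2,\qquad \|u\|_{E^\sigma(T)}^2=\sum_{N}N^{2\sigma}\sup_{t\in[0,T]}\|P_Nu(t)\|_{L^2}^2,$$ and $\|f\|_{H^\sigma}^2=\sum_{k\in\mathbb Z}(1+k^2)^{\sigma}|\hat f(k)|^2$. Let $s>1$. There is a constant $C=C(s)$ such that for every $T\in(0,1]$ the following holds. (a) Every smooth solution $u$ of the Benjamin–Ono equation on $[0,T]$ satisfies $$\|u\|_{E^s(T)}^2\le C\big(\|u(0)\|_{H^s}^2+\|u\|_{F^s(T)}^3\big).$$ (b) If $u_1,u_2$ are smooth solutions of the Benjamin–Ono equation on $[0,T]$ and $v=u_1-u_2$,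 then $$\|v\|_{E^0(T)}^2\le C\big(\|v(0)\|_{L^2}^2+\|v\|_{F^0(T)}^2(\|u_1\|_{F^s(T)}+\|u_2\|_{F^s(T)})\big)$$ and $$\|v\|_{E^s(T)}^2\le C\big(\|v(0)\|_{H^s}^2+\|v\|_{F^s(T)}^3+\|v\|_{F^s(T)}^2\|u_2\|_{F^s(T)}+\|v\|_{F^0(T)}\|v\|_{F^s(T)}\|u_2\|_{F^{2s}(T)}\big).$$ -/

import Mathlib

open MeasureTheory Set
open scoped ENNReal NNReal Real

noncomputable section

namespace BenjaminOno

instance factTwoPiPos : Fact (0 < 2 * π) := ⟨Real.two_pi_pos⟩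

/-- The torus `ℝ / 2πℤ`, so that the frequencies are the integers. -/
abbrev Torus : Type := AddCircle (2 * π)

/-- The Hilbert space `L²(𝕋; ℂ)`, with respect to the normalized Haar measure. -/
abbrev L2Torus : Type := Lp ℂ 2 (AddCircle.haarAddCircle (T := 2 * π))

/-- The Fourier coefficient `(2π)⁻¹ ∫ f(x) e^{-ikx} dx` of a real-valued function. -/
def fhat (f : Torus → ℝ) (k : ℤ) : ℂ := fourierCoeff (fun x => (f x : ℂ)) k

/-- The derivative of a function on the torus. -/
def dx (f : Torus → ℝ) (x : Torus) : ℝ := deriv (fun h : ℝ => f (x + (h : Torus))) 0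

/-- The Hilbert transform, with Fourier multiplier `-i sgn k`. It is applied to smooth functions
only, for which the series converges absolutely. -/
def hilbertTransform (f : Torus → ℝ) (x : Torus) : ℂ :=
  ∑' k : ℤ, (-Complex.I * ((Int.sign k : ℤ) : ℂ)) * fhat f k * fourier k x

/-- `u` is a smooth real-valued solution with vanishing mean of the Benjamin-Ono equation
`∂ₜ u + H ∂ₓₓ u = u ∂ₓ u` on `[0, T] × 𝕋`. As `u` is smooth up to `t = 0` and `t = T`, it
suffices to ask for the equation in the interior. -/
structure IsSmoothSolution (T : ℝ) (u : ℝ → Torus → ℝ) : Prop where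
  smooth : ContDiffOn ℝ ((⊤ : ℕ∞) : WithTop ℕ∞)
    (fun p : ℝ × ℝ => u p.1 (p.2 : Torus)) (Icc 0 T ×ˢ univ)
  equation : ∀ t ∈ Ioo 0 T, ∀ x : Torus,
    ((deriv (fun τ => u τ x) t : ℝ) : ℂ) + hilbertTransform (dx (dx (u t))) x
      = ((u t x * dx (u t) x : ℝ) : ℂ)
  mean_zero : ∫ x, u 0 x ∂AddCircle.haarAddCircle = 0

/-- The frequencies of the dyadic block `N = 2 ^ j`: those with `N ≤ |k| < 2N` if `j ≥ 1`,
and those with `|k| < 2` if `j = 0`. -/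
def block (j : ℕ) : Finset ℤ :=
  (Finset.Ioo (-2 ^ (j + 1)) (2 ^ (j + 1))).filter fun k => j = 0 ∨ 2 ^ j ≤ |k|

/-- The Littlewood-Paley projection `P_N f`, `N = 2 ^ j`, as an element of `L²(𝕋)`. -/
def projBlock (j : ℕ) (f : Torus → ℝ) : L2Torus :=
  ∑ k ∈ block j, fhat f k • fourierLp 2 k

/-- `e^{-itφ(∇/i)} P_N f` for `N = 2 ^ j` and the Benjamin-Ono dispersion relation
`φ(ξ) = -ξ|ξ|`; that is, `P_N f` transported back along the free evolution `e^{-tH∂ₓₓ}`. -/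
def profileBlock (j : ℕ) (t : ℝ) (f : Torus → ℝ) : L2Torus :=
  ∑ k ∈ block j,
    (Complex.exp (Complex.I * (t : ℂ) * ((k * |k| : ℤ) : ℂ)) * fhat f k) • fourierLp 2 k

/-- `f` is a `U²([a, b); H)`-atom: `f = ∑ φ_{k-1} χ_{[t_{k-1}, t_k)}` for a partition
`a = t_0 < ⋯ < t_K = b` and vectors with `∑ ‖φ_k‖² = 1`. -/
def IsU2Atom {H : Type*} [NormedAddCommGroup H] (a b : ℝ) (f : ℝ → H) : Prop :=
  ∃ (K : ℕ) (τ : Fin (K + 1) → ℝ) (φ : Fin K → H),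
    StrictMono τ ∧ τ 0 = a ∧ τ (Fin.last K) = b ∧ ∑ k, ‖φ k‖ ^ 2 = 1 ∧
      ∀ t, f t = ∑ k, (Ico (τ k.castSucc) (τ k.succ)).indicator (fun _ => φ k) t

/-- The `U²([a, b); H)`-norm: the infimum of `∑ |λ_n|` over all representations
`f = ∑ λ_n a_n` on `[a, b)` by atoms, with value `∞` if there is none. -/
def u2Norm {H : Type*} [NormedAddCommGroup H] [NormedSpace ℂ H] (a b : ℝ) (f : ℝ → H) : ℝ≥0∞ :=
  ⨅ (c : ℕ → ℂ) (A : ℕ → ℝ → H) (_ : ∀ n, IsU2Atom a b (A n))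
    (_ : ∀ t ∈ Ico a b, HasSum (fun n => c n • A n t) (f t)), ∑' n, ‖c n‖ₑ

/-- The length `min(N⁻¹, T)` of the time windows for the block `N = 2 ^ j` inside `[0, T]`. -/
def windowLength (T : ℝ) (j : ℕ) : ℝ := min ((2 : ℝ) ^ j)⁻¹ T

/-- The short-time norm `F^s(T)`. -/
def FNorm (s T : ℝ) (u : ℝ → Torus → ℝ) : ℝ≥0∞ :=
  (∑' j : ℕ, ((2 : ℝ≥0∞) ^ j) ^ (2 * s) *
    ⨆ (a : ℝ) (_ : 0 ≤ a) (_ : a + windowLength T j ≤ T),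
      u2Norm a (a + windowLength T j) (fun t => profileBlock j t (u t)) ^ 2) ^ (1 / 2 : ℝ)

/-- The energy norm `E^s(T)`. -/
def ENorm (s T : ℝ) (u : ℝ → Torus → ℝ) : ℝ≥0∞ :=
  (∑' j : ℕ, ((2 : ℝ≥0∞) ^ j) ^ (2 * s) *
    ⨆ t ∈ Icc 0 T, ‖projBlock j (u t)‖ₑ ^ 2) ^ (1 / 2 : ℝ)

/-- The Sobolev norm `H^s(𝕋)`. -/
def HNorm (s : ℝ) (f : Torus → ℝ) : ℝ≥0∞ :=
  (∑' k : ℤ, ENNReal.ofReal ((1 + (k : ℝ) ^ 2) ^ s) * ‖fhat f k‖ₑ ^ 2) ^ (1 / 2 : ℝ)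

/-- The norm of `L²(𝕋)`. -/
def L2Norm (f : Torus → ℝ) : ℝ≥0∞ := eLpNorm f 2 AddCircle.haarAddCircle

end BenjaminOno

end

namespace BenjaminOno

/-! ### Almost orthogonality of separated exponentials -/

/-! Everything reduces to an energy identity for `v` with `∂ₜ v + H ∂ₓₓ v = ½ ∂ₓ(v w)`. For a single
solution `w = v`; for a difference, `w = u₁ + u₂ = v + 2 u₂`. Weight `|v̂(k)|²` by an even cutoff
`tent j` to `|k| ~ 2 ^ j`. The dispersion is skew and drops out, so the energy changes by the time
integral of `∑ ψ(k₁) v̂(k₁) v̂(k₂) ŵ(k₃)` over `k₁ + k₂ + k₃ = 0`, with `ψ(k) = k · tent j k`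
(`energy_le`). As `ψ` is odd and Lipschitz uniformly in `j`, symmetrizing in `k₁, k₂` leaves a
symbol of size `|k₃|`. When `w = v`, symmetrizing in all three leaves one of size `min |kᵢ|`
(`tsum_mul_triInt_symm`, `tsum_mul_triInt_symm₃`, `abs_tentSymbol_add_le`).

It remains to see that the time integral of three dyadic pieces with a bounded symbol loses no
derivative (`enorm_sum_integral_le`). Let `N` be the highest frequency. Since `k₁ + k₂ + k₃ = 0`,
some pair has moduli differing by at least `N / 2`, so its group velocities differ by about `N`. At
fixed output frequency `ξ` the phase `k|k| + (ξ - k)|ξ - k|` then increases by at least `N` per unit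
of `k` (`phase_separated`), and `N`-separated exponentials are almost orthogonal on intervals of
length `1 / N` (`lintegral_norm_sq_separated_le`). This gives the product of two free waves an `L²`
bound with gain `N^{-1/2}`. The estimate passes to `U²` by the atomic structure
(`lintegral_sum_sq_le_u2Norm`). The third factor is taken in `L^∞ L²`, and Cauchy-Schwarz in time
over a window gains another `N^{-1/2}`. The total `1 / N` per window is balanced by the `O(N)`
windows that cover `[0, t₀]`.

Finally the dyadic sums converge (`tsum_admissible_third_le`, `tsum_admissible_bot_le`): the two
highest frequencies are comparable and are summed by Cauchy-Schwarz, and the lowest is summed with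
the factor `N^{-(s-1)}`, which is where `s > 1` is spent. If the factor carrying the derivative is
among the high ones, it has to absorb `s` extra derivatives; this produces the `F^{2s}` norm of
`u₂`. Part (a) is the second estimate of (b) with `u₂ = 0`. -/

lemma summable_one_div_one_add_sq : Summable (fun k : ℤ => 1 / (1 + (k : ℝ) ^ 2)) := by
  have h := Real.summable_one_div_int_pow (p := 2) |>.mpr (by norm_num)
  refine Summable.of_norm_bounded_eventually h ?_
  refine (Set.finite_singleton (0 : ℤ)).subset fun k hk => ?_
  by_contra hk0
  have hk0 : (k : ℝ) ≠ 0 := by exact_mod_cast hk0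
  refine hk ?_
  have : 0 < (k : ℝ) ^ 2 := by positivity
  change ‖1 / (1 + (k : ℝ) ^ 2)‖ ≤ 1 / (k : ℝ) ^ 2
  rw [Real.norm_of_nonneg (by positivity)]
  exact one_div_le_one_div_of_le this (by linarith)

/-- The sum of `1 / (1 + k²)` over the integers. -/
noncomputable def decaySum : ℝ := ∑' k : ℤ, 1 / (1 + (k : ℝ) ^ 2)

lemma decaySum_nonneg : 0 ≤ decaySum := tsum_nonneg fun _ => by positivity

lemma sum_shift_le_decaySum (S : Finset ℤ) (l : ℤ) :
    ∑ k ∈ S, 1 / (1 + ((k - l : ℤ) : ℝ) ^ 2) ≤ decaySum := by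
  have h : Summable (fun k : ℤ => 1 / (1 + ((k - l : ℤ) : ℝ) ^ 2)) :=
    (Equiv.subRight l).summable_iff.mpr summable_one_div_one_add_sq
  refine (h.sum_le_tsum S fun _ _ => by positivity).trans (le_of_eq ?_)
  exact (Equiv.subRight l).tsum_eq fun k : ℤ => 1 / (1 + (k : ℝ) ^ 2)

lemma exp_neg_sq_div_four_le (x : ℝ) : Real.exp (-(x ^ 2 / 4)) ≤ 4 * (1 / (1 + x ^ 2)) := by
  rw [Real.exp_neg, mul_one_div, inv_eq_one_div, div_le_div_iff₀ (Real.exp_pos _) (by positivity)]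
  nlinarith [Real.add_one_le_exp (x ^ 2 / 4), sq_nonneg x]

/-- The exponent is `-N² (t - α)² + iμt` multiplied out, so the centre `α` contributes only a phase
and the modulus is the Fourier transform of a Gaussian at `μ`. -/
lemma norm_integral_gaussian_mul_exp {N : ℝ} (hN : 0 < N) (α μ : ℝ) :
    ‖∫ t : ℝ, Complex.exp (-(N : ℂ) ^ 2 * (t : ℂ) ^ 2 + (2 * N ^ 2 * α + Complex.I * μ) * t
      + (-(N : ℂ) ^ 2 * α ^ 2))‖ = √π / N * Real.exp (-((μ / N) ^ 2 / 4)) := by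
  have hre : (-(N : ℂ) ^ 2).re < 0 := by
    have : (-(N : ℂ) ^ 2) = ((-N ^ 2 : ℝ) : ℂ) := by push_cast; ring
    rw [this, Complex.ofReal_re]; nlinarith [pow_pos hN 2]
  have hN' : (N : ℂ) ≠ 0 := by exact_mod_cast hN.ne'
  rw [integral_cexp_quadratic hre, norm_mul]
  congr 1
  · have h1 : ((π : ℂ) / - -(N : ℂ) ^ 2) = ((π / N ^ 2 : ℝ) : ℂ) := by push_cast; ring
    have h2 : (1 / 2 : ℂ) = ((1 / 2 : ℝ) : ℂ) := by push_cast; ring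
    rw [h1, h2, ← Complex.ofReal_cpow (by positivity), Complex.norm_real,
      Real.norm_of_nonneg (by positivity), ← Real.sqrt_eq_rpow, Real.sqrt_div Real.pi_pos.le,
      Real.sqrt_sq hN.le]
  · rw [Complex.norm_exp]
    congr 1
    have : (-(N : ℂ) ^ 2 * α ^ 2 - (2 * N ^ 2 * α + Complex.I * μ) ^ 2 / (4 * -(N : ℂ) ^ 2))
        = ((-((μ / N) ^ 2 / 4) : ℝ) : ℂ) + ((μ * α : ℝ) : ℂ) * Complex.I := by
      push_cast
      field_simp
      ring_nf
      simp only [Complex.I_sq]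
      ring
    rw [this, Complex.add_re, Complex.ofReal_re, Complex.re_ofReal_mul, Complex.I_re, mul_zero,
      add_zero]

lemma integrable_gaussian_mul_exp {N : ℝ} (hN : 0 < N) (α μ : ℝ) :
    Integrable fun t : ℝ => Complex.exp (-(N : ℂ) ^ 2 * (t : ℂ) ^ 2
      + (2 * N ^ 2 * α + Complex.I * μ) * t + (-(N : ℂ) ^ 2 * α ^ 2)) := by
  refine integrable_cexp_quadratic ?_ _ _
  have : ((N : ℂ) ^ 2) = ((N ^ 2 : ℝ) : ℂ) := by push_cast; ring
  rw [this, Complex.ofReal_re]; positivity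

lemma ofReal_gaussian_mul_norm_sq (S : Finset ℤ) (c : ℤ → ℂ) (lam : ℤ → ℝ) (N α t : ℝ) :
    ((Real.exp (-(N ^ 2 * (t - α) ^ 2)) *
      ‖∑ k ∈ S, c k * Complex.exp (Complex.I * t * lam k)‖ ^ 2 : ℝ) : ℂ)
    = ∑ k ∈ S, ∑ l ∈ S, (c k * (starRingEnd ℂ) (c l)) *
      Complex.exp (-(N : ℂ) ^ 2 * (t : ℂ) ^ 2 +
        (2 * N ^ 2 * α + Complex.I * (lam k - lam l : ℝ)) * t + (-(N : ℂ) ^ 2 * α ^ 2)) := by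
  rw [Complex.ofReal_mul, Complex.ofReal_pow, ← Complex.mul_conj', map_sum, Finset.sum_mul_sum,
    Finset.mul_sum]
  refine Finset.sum_congr rfl fun k _ => ?_
  rw [Finset.mul_sum]
  refine Finset.sum_congr rfl fun l _ => ?_
  rw [map_mul, ← Complex.exp_conj]
  simp only [map_mul, Complex.conj_I, Complex.conj_ofReal, Complex.ofReal_exp]
  have : Complex.exp ((-(N ^ 2 * (t - α) ^ 2) : ℝ)) *
      (c k * Complex.exp (Complex.I * t * lam k) *
        ((starRingEnd ℂ) (c l) * Complex.exp (-Complex.I * t * lam l)))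
      = (c k * (starRingEnd ℂ) (c l)) * (Complex.exp ((-(N ^ 2 * (t - α) ^ 2) : ℝ)) *
        Complex.exp (Complex.I * t * lam k) * Complex.exp (-Complex.I * t * lam l)) := by ring
  rw [this, ← Complex.exp_add, ← Complex.exp_add]
  congr 2
  push_cast
  ring

/-- Expanding the square gives a Hermitian form with kernel of size `exp(-((λₖ - λₗ)/N)²/4) / N`.
Separation bounds this by a multiple of `1 / (N (1 + (k - l)²))`, whose row sums are at most
`decaySum / N`, and Schur's test concludes. -/
lemma integral_gaussian_mul_norm_sq_le (S : Finset ℤ) (c : ℤ → ℂ) (lam : ℤ → ℝ) {N : ℝ}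
    (hN : 0 < N) (α : ℝ)
    (hsep : ∀ k ∈ S, ∀ l ∈ S, N * |((k - l : ℤ) : ℝ)| ≤ |lam k - lam l|) :
    ∫ t : ℝ, Real.exp (-(N ^ 2 * (t - α) ^ 2)) *
      ‖∑ k ∈ S, c k * Complex.exp (Complex.I * t * lam k)‖ ^ 2
    ≤ 4 * √π * decaySum / N * ∑ k ∈ S, ‖c k‖ ^ 2 := by
  have hcomp : ((∫ t : ℝ, Real.exp (-(N ^ 2 * (t - α) ^ 2)) *
      ‖∑ k ∈ S, c k * Complex.exp (Complex.I * t * lam k)‖ ^ 2 : ℝ) : ℂ)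
      = ∑ k ∈ S, ∑ l ∈ S, (c k * (starRingEnd ℂ) (c l)) *
      ∫ t : ℝ, Complex.exp (-(N : ℂ) ^ 2 * (t : ℂ) ^ 2 +
        (2 * N ^ 2 * α + Complex.I * (lam k - lam l : ℝ)) * t + (-(N : ℂ) ^ 2 * α ^ 2)) := by
    rw [← integral_complex_ofReal]
    simp_rw [ofReal_gaussian_mul_norm_sq]
    rw [integral_finsetSum _ fun k _ => integrable_finsetSum _ fun l _ =>
      (integrable_gaussian_mul_exp hN α _).const_mul _]
    refine Finset.sum_congr rfl fun k _ => ?_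
    rw [integral_finsetSum _ fun l _ => (integrable_gaussian_mul_exp hN α _).const_mul _]
    refine Finset.sum_congr rfl fun l _ => ?_
    rw [integral_const_mul]
  have hterm : ∀ k ∈ S, ∀ l ∈ S, ‖(c k * (starRingEnd ℂ) (c l)) *
      ∫ t : ℝ, Complex.exp (-(N : ℂ) ^ 2 * (t : ℂ) ^ 2 +
        (2 * N ^ 2 * α + Complex.I * (lam k - lam l : ℝ)) * t + (-(N : ℂ) ^ 2 * α ^ 2))‖
      ≤ (2 * √π / N) * (‖c k‖ ^ 2 * (1 / (1 + ((l - k : ℤ) : ℝ) ^ 2)))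
        + (2 * √π / N) * (‖c l‖ ^ 2 * (1 / (1 + ((k - l : ℤ) : ℝ) ^ 2))) := by
    intro k hk l hl
    rw [norm_mul, norm_mul, RCLike.norm_conj, norm_integral_gaussian_mul_exp hN]
    have h1 : Real.exp (-(((lam k - lam l) / N) ^ 2 / 4)) ≤
        4 * (1 / (1 + ((k - l : ℤ) : ℝ) ^ 2)) := by
      refine le_trans (Real.exp_le_exp.mpr ?_) (exp_neg_sq_div_four_le _)
      have : ((k - l : ℤ) : ℝ) ^ 2 ≤ ((lam k - lam l) / N) ^ 2 := by
        rw [sq_le_sq, abs_div, abs_of_pos hN, le_div_iff₀ hN, mul_comm]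
        exact hsep k hk l hl
      linarith
    have h2 : ((l - k : ℤ) : ℝ) ^ 2 = ((k - l : ℤ) : ℝ) ^ 2 := by push_cast; ring
    rw [h2]
    set g := 1 / (1 + ((k - l : ℤ) : ℝ) ^ 2)
    have hg : 0 ≤ g := by positivity
    have h3 : ‖c k‖ * ‖c l‖ ≤ (‖c k‖ ^ 2 + ‖c l‖ ^ 2) / 2 := by
      nlinarith [sq_nonneg (‖c k‖ - ‖c l‖)]
    calc ‖c k‖ * ‖c l‖ * (√π / N * Real.exp (-(((lam k - lam l) / N) ^ 2 / 4)))
        ≤ ((‖c k‖ ^ 2 + ‖c l‖ ^ 2) / 2) * (√π / N * (4 * g)) := by gcongr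
      _ = _ := by ring
  have hsum : ∀ k ∈ S, ∑ l ∈ S, (2 * √π / N) * (‖c k‖ ^ 2 * (1 / (1 + ((l - k : ℤ) : ℝ) ^ 2)))
      ≤ 2 * √π / N * decaySum * ‖c k‖ ^ 2 := by
    intro k _
    rw [← Finset.mul_sum, ← Finset.mul_sum, mul_assoc, mul_comm decaySum]
    gcongr
    exact sum_shift_le_decaySum S k
  have hnorm := congrArg norm hcomp
  rw [Complex.norm_real] at hnorm
  refine (le_abs_self _).trans (hnorm.le.trans ?_)
  calc _ ≤ ∑ k ∈ S, ∑ l ∈ S, ((2 * √π / N) * (‖c k‖ ^ 2 * (1 / (1 + ((l - k : ℤ) : ℝ) ^ 2)))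
        + (2 * √π / N) * (‖c l‖ ^ 2 * (1 / (1 + ((k - l : ℤ) : ℝ) ^ 2)))) :=
        (norm_sum_le _ _).trans (Finset.sum_le_sum fun k hk => (norm_sum_le _ _).trans
          (Finset.sum_le_sum fun l hl => hterm k hk l hl))
    _ = ∑ k ∈ S, ∑ l ∈ S, (2 * √π / N) * (‖c k‖ ^ 2 * (1 / (1 + ((l - k : ℤ) : ℝ) ^ 2)))
        + ∑ k ∈ S, ∑ l ∈ S, (2 * √π / N) * (‖c k‖ ^ 2 * (1 / (1 + ((l - k : ℤ) : ℝ) ^ 2))) := by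
        simp_rw [Finset.sum_add_distrib]
        congr 1
        exact Finset.sum_comm
    _ ≤ ∑ k ∈ S, 2 * √π / N * decaySum * ‖c k‖ ^ 2
        + ∑ k ∈ S, 2 * √π / N * decaySum * ‖c k‖ ^ 2 :=
        add_le_add (Finset.sum_le_sum hsum) (Finset.sum_le_sum hsum)
    _ = _ := by rw [← Finset.mul_sum]; ring

/-- The constant of the large sieve inequality for separated exponentials. -/
noncomputable def sieveConst : ℝ := Real.exp 1 * (4 * √π * decaySum)

lemma sieveConst_nonneg : 0 ≤ sieveConst := by
  have := decaySum_nonneg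
  unfold sieveConst; positivity

/-- Exponentials with `N`-separated frequencies are almost orthogonal on intervals of length
`1 / N`. -/
theorem lintegral_norm_sq_separated_le (S : Finset ℤ) (c : ℤ → ℂ) (lam : ℤ → ℝ) {N : ℝ}
    (hN : 0 < N) {α β : ℝ} (hαβ : β - α ≤ 1 / N)
    (hsep : ∀ k ∈ S, ∀ l ∈ S, N * |((k - l : ℤ) : ℝ)| ≤ |lam k - lam l|) :
    ∫⁻ t in Ioc α β, ‖∑ k ∈ S, c k * Complex.exp (Complex.I * t * lam k)‖ₑ ^ 2
      ≤ ENNReal.ofReal (sieveConst / N) * ∑ k ∈ S, ‖c k‖ₑ ^ 2 := by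
  set F : ℝ → ℝ := fun t => Real.exp (-(N ^ 2 * (t - α) ^ 2)) *
      ‖∑ k ∈ S, c k * Complex.exp (Complex.I * t * lam k)‖ ^ 2 with hF
  have hFint : Integrable F := by
    have h : Integrable (fun t => ((F t : ℝ) : ℂ)) := by
      simp_rw [hF, ofReal_gaussian_mul_norm_sq]
      exact integrable_finsetSum _ fun k _ => integrable_finsetSum _ fun l _ =>
        (integrable_gaussian_mul_exp hN α _).const_mul _
    simpa using h.re
  have hF0 : ∀ t, 0 ≤ F t := fun t => by positivity
  calc ∫⁻ t in Ioc α β, ‖∑ k ∈ S, c k * Complex.exp (Complex.I * t * lam k)‖ₑ ^ 2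
      ≤ ∫⁻ t in Ioc α β, ENNReal.ofReal (Real.exp 1) * ENNReal.ofReal (F t) := by
        refine setLIntegral_mono' measurableSet_Ioc fun t ht => ?_
        rw [← ofReal_norm, ← ENNReal.ofReal_pow (norm_nonneg _),
          ← ENNReal.ofReal_mul (Real.exp_pos _).le]
        refine ENNReal.ofReal_le_ofReal ?_
        rw [hF, ← mul_assoc, ← Real.exp_add]
        -- On an interval of length `1 / N` starting at `α` the Gaussian is at least `e⁻¹`; this is
        -- the factor `Real.exp 1` in `sieveConst`.
        refine le_mul_of_one_le_left (by positivity) (Real.one_le_exp ?_)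
        have h1 : N * (t - α) ≤ 1 := by
          have := ht.2
          calc N * (t - α) ≤ N * (1 / N) := by gcongr; linarith
            _ = 1 := by field_simp
        have h0 : 0 ≤ N * (t - α) := mul_nonneg hN.le (by linarith [ht.1])
        nlinarith
    _ ≤ ∫⁻ t, ENNReal.ofReal (Real.exp 1) * ENNReal.ofReal (F t) :=
        setLIntegral_le_lintegral _ _
    _ = ENNReal.ofReal (Real.exp 1) * ENNReal.ofReal (∫ t, F t) := by
        rw [lintegral_const_mul' _ _ ENNReal.ofReal_ne_top,
          ofReal_integral_eq_lintegral_ofReal hFint (Filter.Eventually.of_forall hF0)]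
    _ ≤ ENNReal.ofReal (Real.exp 1) *
        ENNReal.ofReal (4 * √π * decaySum / N * ∑ k ∈ S, ‖c k‖ ^ 2) := by
        gcongr
        exact integral_gaussian_mul_norm_sq_le S c lam hN α hsep
    _ = _ := by
        have := decaySum_nonneg
        rw [← ENNReal.ofReal_mul (Real.exp_pos _).le, ← mul_assoc,
          ENNReal.ofReal_mul (by positivity), ENNReal.ofReal_sum_of_nonneg fun _ _ => by positivity]
        congr 1
        · unfold sieveConst; congr 1; ring
        · refine Finset.sum_congr rfl fun k _ => ?_
          rw [← ofReal_norm, ENNReal.ofReal_pow (norm_nonneg _)]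

/-! ### Resonance function of the Benjamin-Ono dispersion relation -/

/-- The phase of a product of two free waves with frequencies `k` and `ξ - k`. -/
lemma phase_separated {ξ k l : ℤ} {N : ℝ} (hkl : k ≤ l)
    (hk : N / 2 ≤ ((|k| - |ξ - k| : ℤ) : ℝ)) (hl : N / 2 ≤ ((|l| - |ξ - l| : ℤ) : ℝ)) :
    N * ((l - k : ℤ) : ℝ) ≤
      ((l * |l| + (ξ - l) * |ξ - l| : ℤ) : ℝ) - ((k * |k| + (ξ - k) * |ξ - k| : ℤ) : ℝ) := by
  have hkl' : (k : ℝ) ≤ l := by exact_mod_cast hkl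
  -- The phase has derivative `2 (|x| - |ξ - x|)`. This is nondecreasing in `x` for `ξ ≥ 0` and
  -- nonincreasing for `ξ ≤ 0`, so its minimum on `[k, l]` sits at `k` in the first case and at `l`
  -- in the second.
  have key : (l - k) * (2 * min (|k| - |ξ - k|) (|l| - |ξ - l|)) ≤
      (l * |l| + (ξ - l) * |ξ - l|) - (k * |k| + (ξ - k) * |ξ - k|) := by
    rcases le_total 0 ξ with hξ | hξ
    · refine le_trans (mul_le_mul_of_nonneg_left
        (mul_le_mul_of_nonneg_left (min_le_left _ _) (by norm_num)) (by omega)) ?_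
      rcases abs_cases k with ⟨h1, h1'⟩ | ⟨h1, h1'⟩ <;>
      rcases abs_cases l with ⟨h2, h2'⟩ | ⟨h2, h2'⟩ <;>
      rcases abs_cases (ξ - k) with ⟨h3, h3'⟩ | ⟨h3, h3'⟩ <;>
      rcases abs_cases (ξ - l) with ⟨h4, h4'⟩ | ⟨h4, h4'⟩ <;>
      rw [h1, h2, h3, h4] <;> first | omega | nlinarith
    · refine le_trans (mul_le_mul_of_nonneg_left
        (mul_le_mul_of_nonneg_left (min_le_right _ _) (by norm_num)) (by omega)) ?_
      rcases abs_cases k with ⟨h1, h1'⟩ | ⟨h1, h1'⟩ <;>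
      rcases abs_cases l with ⟨h2, h2'⟩ | ⟨h2, h2'⟩ <;>
      rcases abs_cases (ξ - k) with ⟨h3, h3'⟩ | ⟨h3, h3'⟩ <;>
      rcases abs_cases (ξ - l) with ⟨h4, h4'⟩ | ⟨h4, h4'⟩ <;>
      rw [h1, h2, h3, h4] <;> first | omega | nlinarith
  have hmin : N ≤ ((2 * min (|k| - |ξ - k|) (|l| - |ξ - l|) : ℤ) : ℝ) := by
    rw [Int.cast_mul, Int.cast_min]
    have := le_min hk hl
    push_cast at this ⊢
    linarith
  have key' : (((l - k) * (2 * min (|k| - |ξ - k|) (|l| - |ξ - l|)) : ℤ) : ℝ) ≤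
      (((l * |l| + (ξ - l) * |ξ - l|) - (k * |k| + (ξ - k) * |ξ - k|) : ℤ) : ℝ) := by
    exact_mod_cast key
  rw [Int.cast_sub (_ + _), Int.cast_mul] at key'
  refine le_trans ?_ key'
  rw [mul_comm]
  have : (0 : ℝ) ≤ ((l - k : ℤ) : ℝ) := by push_cast; linarith
  gcongr

end BenjaminOno

namespace BenjaminOno

/-! ### The transfer principle for `U²` -/

lemma ennreal_tsum_mul_sq_le {ι : Type*} (f g : ι → ℝ≥0∞) :
    (∑' i, f i * g i) ^ 2 ≤ (∑' i, f i ^ 2) * ∑' i, g i ^ 2 := by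
  let _ : MeasurableSpace ι := ⊤
  have h := ENNReal.lintegral_mul_le_Lp_mul_Lq (Measure.count (α := ι))
    Real.HolderConjugate.two_two (f := f) (g := g)
    (measurable_from_top.aemeasurable) (measurable_from_top.aemeasurable)
  simp only [lintegral_count, Pi.mul_apply] at h
  calc (∑' i, f i * g i) ^ 2
      ≤ ((∑' i, f i ^ (2 : ℝ)) ^ (1 / 2 : ℝ) * (∑' i, g i ^ (2 : ℝ)) ^ (1 / 2 : ℝ)) ^ 2 := by
        gcongr
    _ = _ := by
        rw [mul_pow, ← ENNReal.rpow_natCast, ← ENNReal.rpow_natCast, ← ENNReal.rpow_mul,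
          ← ENNReal.rpow_mul]
        norm_num

lemma ennreal_sum_mul_sq_le {ι : Type*} (s : Finset ι) (f g : ι → ℝ≥0∞) :
    (∑ i ∈ s, f i * g i) ^ 2 ≤ (∑ i ∈ s, f i ^ 2) * ∑ i ∈ s, g i ^ 2 := by
  have h := ennreal_tsum_mul_sq_le (fun i : s => f i) (fun i : s => g i)
  simpa only [tsum_fintype, Finset.sum_coe_sort s fun i => f i * g i,
    Finset.sum_coe_sort s fun i => f i ^ 2, Finset.sum_coe_sort s fun i => g i ^ 2] using h

/-- Cauchy-Schwarz with the weight split evenly: a square of an absolutely convergent combination of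
atoms is controlled by squares of the single atoms. -/
lemma ennreal_tsum_mul_sq_le_weight {ι : Type*} (c x : ι → ℝ≥0∞) :
    (∑' i, c i * x i) ^ 2 ≤ (∑' i, c i) * ∑' i, c i * x i ^ 2 := by
  have hc : ∀ i, (c i ^ (1 / 2 : ℝ)) ^ 2 = c i := fun i => by
    rw [← ENNReal.rpow_natCast, ← ENNReal.rpow_mul]; norm_num
  have h := ennreal_tsum_mul_sq_le (fun i => c i ^ (1 / 2 : ℝ)) fun i => c i ^ (1 / 2 : ℝ) * x i
  simp_rw [mul_pow, ← mul_assoc, ← sq, hc] at h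
  exact h

/-- The infimum defining the `U²` norm need not be attained, so bounds are proved for every larger
`r` and passed to the limit. -/
lemma ennreal_le_mul_sq_of_forall_gt {x K u : ℝ≥0∞} (hK : K ≠ ⊤) (hu : u ≠ ⊤)
    (h : ∀ r, u < r → x ≤ K * r ^ 2) : x ≤ K * u ^ 2 := by
  have : (nhdsWithin u (Ioi u)).NeBot := nhdsGT_neBot_of_exists_gt ⟨⊤, hu.lt_top⟩
  have ht : Filter.Tendsto (fun r : ℝ≥0∞ => K * r ^ 2) (nhdsWithin u (Ioi u))
      (nhds (K * u ^ 2)) :=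
    ((ENNReal.continuous_const_mul hK).comp (ENNReal.continuous_pow 2)).continuousWithinAt.tendsto
  exact ge_of_tendsto ht (Filter.eventually_of_mem self_mem_nhdsWithin fun r hr => h r hr)

lemma ennreal_sq_le_sq_iff (x y : ℝ≥0∞) : x ^ 2 ≤ y ^ 2 ↔ x ≤ y :=
  ENNReal.pow_le_pow_left_iff two_ne_zero

section Transfer

variable {H : Type*} [NormedAddCommGroup H]

/-- The intervals of the partition are disjoint, so at each time at most one step is active. Later
estimates need only the list of values, not the jump times. -/
lemma IsU2Atom.exists_values {a b : ℝ} {f : ℝ → H} (hf : IsU2Atom a b f) :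
    ∃ (K : ℕ) (φ : Fin K → H), ∑ p, ‖φ p‖ₑ ^ 2 = 1 ∧ ∀ t, f t = 0 ∨ ∃ p, f t = φ p := by
  obtain ⟨K, τ, φ, hτ, -, -, hφ, hf⟩ := hf
  refine ⟨K, φ, ?_, fun t => ?_⟩
  · simp_rw [← ofReal_norm, ← ENNReal.ofReal_pow (norm_nonneg _)]
    rw [← ENNReal.ofReal_sum_of_nonneg fun _ _ => by positivity, hφ, ENNReal.ofReal_one]
  · by_cases h : ∃ p : Fin K, t ∈ Ico (τ p.castSucc) (τ p.succ)
    · obtain ⟨p, hp⟩ := h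
      refine Or.inr ⟨p, ?_⟩
      rw [hf, Finset.sum_eq_single p, indicator_of_mem hp]
      · intro q _ hqp
        refine indicator_of_notMem (fun hq => ?_) _
        rcases lt_or_gt_of_ne hqp with h | h
        · have : τ q.succ ≤ τ p.castSucc := hτ.monotone (Fin.succ_le_castSucc_iff.mpr h)
          exact absurd hq.2 (not_lt.mpr (this.trans hp.1))
        · have : τ p.succ ≤ τ q.castSucc := hτ.monotone (Fin.succ_le_castSucc_iff.mpr h)
          exact absurd hp.2 (not_lt.mpr (this.trans hq.1))
      · simp
    · refine Or.inl ?_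
      rw [hf]
      exact Finset.sum_eq_zero fun p _ => indicator_of_notMem (fun hp => h ⟨p, hp⟩) _

lemma IsU2Atom.enorm_le_one {a b : ℝ} {f : ℝ → H} (hf : IsU2Atom a b f) (t : ℝ) :
    ‖f t‖ₑ ≤ 1 := by
  obtain ⟨K, φ, hφ, h⟩ := hf.exists_values
  rcases h t with h | ⟨p, h⟩
  · simp [h]
  · have : ‖f t‖ₑ ^ 2 ≤ 1 ^ 2 := by
      rw [h, one_pow, ← hφ]
      exact Finset.single_le_sum (f := fun p => ‖φ p‖ₑ ^ 2) (fun _ _ => zero_le)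
        (Finset.mem_univ p)
    exact (ennreal_sq_le_sq_iff _ _).mp this

variable [NormedSpace ℂ H]

/-- Atoms are bounded by one pointwise, which is the embedding of `U²` into `L^∞`. It serves for the
factor that takes no part in the bilinear estimate. -/
lemma enorm_le_u2Norm {a b : ℝ} {f : ℝ → H} {t : ℝ} (ht : t ∈ Ico a b) :
    ‖f t‖ₑ ≤ u2Norm a b f := by
  refine le_iInf fun c => le_iInf fun A => le_iInf fun hA => le_iInf fun hf => ?_
  rw [← (hf t ht).tsum_eq]
  refine enorm_tsum_le_tsum_enorm.trans (ENNReal.tsum_le_tsum fun n => ?_)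
  rw [enorm_smul]
  exact mul_le_of_le_one_right' ((hA n).enorm_le_one t)

/-- An `L²` estimate for a family of functionals extends from constant vectors to functions in
`U²`. -/
theorem lintegral_sum_sq_le_u2Norm {ι : Type*} (Ξ : Finset ι) (Ψ : ℝ → ι → H →L[ℂ] ℂ)
    {K : ℝ≥0∞} (hKtop : K ≠ ⊤) {a b : ℝ} {J : Set ℝ} (hJm : MeasurableSet J) (hJ : J ⊆ Ico a b)
    (hΨ : ∀ φ i, AEMeasurable (fun t => Ψ t i φ) (volume.restrict J))
    (hK : ∀ φ, ∫⁻ t in J, ∑ i ∈ Ξ, ‖Ψ t i φ‖ₑ ^ 2 ≤ K * ‖φ‖ₑ ^ 2)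
    {f : ℝ → H} (hf : u2Norm a b f ≠ ⊤) :
    ∫⁻ t in J, ∑ i ∈ Ξ, ‖Ψ t i (f t)‖ₑ ^ 2 ≤ K * u2Norm a b f ^ 2 := by
  refine ennreal_le_mul_sq_of_forall_gt hKtop hf fun r hr => ?_
  simp only [u2Norm, iInf_lt_iff] at hr
  obtain ⟨c, A, hA, hsum, hr⟩ := hr
  refine le_trans ?_ (mul_le_mul_right (pow_le_pow_left₀ zero_le hr.le 2) K)
  choose P φ hφ hval using fun n => (hA n).exists_values
  have hmeas : ∀ n, AEMeasurable (fun t => ∑ p, ∑ i ∈ Ξ, ‖Ψ t i (φ n p)‖ₑ ^ 2)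
      (volume.restrict J) := fun n =>
    Finset.aemeasurable_fun_sum _ fun p _ => Finset.aemeasurable_fun_sum _ fun i _ =>
      (hΨ (φ n p) i).enorm.pow_const 2
  -- The active value of an atom at time `t` is one of its `φ n p`, so its square is at most the sum
  -- over all `p`. The hypothesis on constant vectors then applies to each value on all of `J`, and
  -- the total is harmless because the squared norms of the values add up to one. No measurability
  -- of the atoms is needed.
  have hpt : ∀ t ∈ J, ∑ i ∈ Ξ, ‖Ψ t i (f t)‖ₑ ^ 2 ≤
      (∑' n, ‖c n‖ₑ) * ∑' n, ‖c n‖ₑ * ∑ p, ∑ i ∈ Ξ, ‖Ψ t i (φ n p)‖ₑ ^ 2 := by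
    intro t ht
    have h1 : ∀ i, ‖Ψ t i (f t)‖ₑ ^ 2 ≤
        (∑' n, ‖c n‖ₑ) * ∑' n, ‖c n‖ₑ * ‖Ψ t i (A n t)‖ₑ ^ 2 := by
      intro i
      refine le_trans ?_ (ennreal_tsum_mul_sq_le_weight _ _)
      have h := (Ψ t i).hasSum (hsum t (hJ ht))
      gcongr
      rw [← h.tsum_eq]
      refine enorm_tsum_le_tsum_enorm.trans (le_of_eq ?_)
      simp only [map_smul, smul_eq_mul, enorm_mul]
    refine (Finset.sum_le_sum fun i _ => h1 i).trans ?_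
    rw [← Finset.mul_sum, ← Summable.tsum_finsetSum fun _ _ => ENNReal.summable]
    gcongr with n
    rw [← Finset.mul_sum]
    gcongr
    rcases hval n t with h | ⟨p, h⟩
    · simp [h]
    · rw [h]
      exact Finset.single_le_sum (f := fun p => ∑ i ∈ Ξ, ‖Ψ t i (φ n p)‖ₑ ^ 2)
        (fun _ _ => zero_le) (Finset.mem_univ p)
  calc ∫⁻ t in J, ∑ i ∈ Ξ, ‖Ψ t i (f t)‖ₑ ^ 2
      ≤ ∫⁻ t in J, (∑' n, ‖c n‖ₑ) * ∑' n, ‖c n‖ₑ * ∑ p, ∑ i ∈ Ξ, ‖Ψ t i (φ n p)‖ₑ ^ 2 :=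
        setLIntegral_mono' hJm hpt
    _ = (∑' n, ‖c n‖ₑ) * ∑' n, ‖c n‖ₑ * ∫⁻ t in J, ∑ p, ∑ i ∈ Ξ, ‖Ψ t i (φ n p)‖ₑ ^ 2 := by
        rw [lintegral_const_mul'' _ (AEMeasurable.tsum fun n => (hmeas n).const_mul _),
          lintegral_tsum fun n => (hmeas n).const_mul _]
        congr 2 with n
        rw [lintegral_const_mul'' _ (hmeas n)]
    _ ≤ (∑' n, ‖c n‖ₑ) * ∑' n, ‖c n‖ₑ * K := by
        gcongr with n
        rw [lintegral_finsetSum' _ fun p _ => Finset.aemeasurable_fun_sum _ fun i _ =>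
          (hΨ (φ n p) i).enorm.pow_const 2]
        refine (Finset.sum_le_sum fun p _ => hK (φ n p)).trans ?_
        rw [← Finset.mul_sum, hφ n, mul_one]
    _ = K * (∑' n, ‖c n‖ₑ) ^ 2 := by rw [ENNReal.tsum_mul_right]; ring

end Transfer

/-! ### The bilinear estimate -/

/-- The Fourier multiplier of the free Benjamin-Ono evolution. -/
noncomputable def wave (t : ℝ) (k : ℤ) : ℂ :=
  Complex.exp (-(Complex.I * (t : ℂ) * ((k * |k| : ℤ) : ℂ)))

lemma norm_wave (t : ℝ) (k : ℤ) : ‖wave t k‖ = 1 := by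
  rw [wave, Complex.norm_exp]
  simp

lemma enorm_wave (t : ℝ) (k : ℤ) : ‖wave t k‖ₑ = 1 := by
  rw [← ofReal_norm, norm_wave, ENNReal.ofReal_one]

lemma continuous_wave (k : ℤ) : Continuous fun t => wave t k := by
  unfold wave
  fun_prop

lemma ennreal_add_sq_le (x y : ℝ≥0∞) : (x + y) ^ 2 ≤ 2 * (x ^ 2 + y ^ 2) := by
  have h := ennreal_sum_mul_sq_le (Finset.univ : Finset (Fin 2)) (fun _ => 1) ![x, y]
  simpa [Fin.sum_univ_two, one_add_one_eq_two] using h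

/-- Separation needs a fixed sign of `|k| - |ξ - k|`, so `S` is split by that sign. The reflection
`k ↦ ξ - k` preserves the phase and exchanges the two signs; adding the two halves costs the factor
2. -/
lemma lintegral_norm_sq_waves_le (S : Finset ℤ) (c : ℤ → ℂ) (ξ : ℤ) {N : ℝ} (hN : 0 < N)
    {α β : ℝ} (hαβ : β - α ≤ 1 / N) (hS : ∀ k ∈ S, N / 2 ≤ |((|k| - |ξ - k| : ℤ) : ℝ)|) :
    ∫⁻ t in Ioo α β, ‖∑ k ∈ S, c k * (wave t k * wave t (ξ - k))‖ₑ ^ 2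
      ≤ ENNReal.ofReal (2 * sieveConst / N) * ∑ k ∈ S, ‖c k‖ₑ ^ 2 := by
  classical
  set lam : ℤ → ℝ := fun k => -((k * |k| + (ξ - k) * |ξ - k| : ℤ) : ℝ) with hlam
  have hw : ∀ (t : ℝ) (k : ℤ), wave t k * wave t (ξ - k) = Complex.exp (Complex.I * t * lam k) := by
    intro t k
    have hl : ((lam k : ℝ) : ℂ) = -((k * |k| : ℤ) : ℂ) - (((ξ - k) * |ξ - k| : ℤ) : ℂ) := by
      simp only [hlam]
      rw [Complex.ofReal_neg, Complex.ofReal_intCast, Int.cast_add]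
      ring
    rw [wave, wave, ← Complex.exp_add, hl]
    congr 1
    ring
  simp_rw [hw]
  set p : ℤ → Prop := fun k => N / 2 ≤ ((|k| - |ξ - k| : ℤ) : ℝ) with hp
  have hpos : ∀ k ∈ S.filter p, ∀ l ∈ S.filter p, N * |((k - l : ℤ) : ℝ)| ≤ |lam k - lam l| := by
    have aux : ∀ k ∈ S.filter p, ∀ l ∈ S.filter p, k ≤ l →
        N * |((k - l : ℤ) : ℝ)| ≤ |lam k - lam l| := by
      intro k hk l hl hkl
      have h := phase_separated (N := N) hkl (Finset.mem_filter.mp hk).2 (Finset.mem_filter.mp hl).2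
      have h' : |((k - l : ℤ) : ℝ)| = ((l - k : ℤ) : ℝ) := by
        have : (k : ℝ) ≤ l := by exact_mod_cast hkl
        rw [abs_of_nonpos (by push_cast; linarith)]; push_cast; ring
      rw [h']
      refine le_trans (h.trans_eq ?_) (le_abs_self _)
      rw [hlam]; ring
    intro k hk l hl
    rcases le_total k l with h | h
    · exact aux k hk l hl h
    · have := aux l hl k hk h
      rwa [abs_sub_comm (lam l), ← neg_sub k l, Int.cast_neg, abs_neg] at this
  have hneg : ∀ k ∈ S.filter (¬ p ·), ∀ l ∈ S.filter (¬ p ·),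
      N * |((k - l : ℤ) : ℝ)| ≤ |lam k - lam l| := by
    have hp' : ∀ k ∈ S.filter (¬ p ·), N / 2 ≤ ((|ξ - k| - |ξ - (ξ - k)| : ℤ) : ℝ) := by
      intro k hk
      obtain ⟨hkS, hkp⟩ := Finset.mem_filter.mp hk
      have := hS k hkS
      rcases le_abs.mp this with h | h
      · exact absurd h hkp
      · rw [sub_sub_cancel]; push_cast at h ⊢; linarith
    have aux : ∀ k ∈ S.filter (¬ p ·), ∀ l ∈ S.filter (¬ p ·), k ≤ l →
        N * |((k - l : ℤ) : ℝ)| ≤ |lam k - lam l| := by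
      intro k hk l hl hkl
      have h := phase_separated (N := N) (sub_le_sub_left hkl ξ) (hp' l hl) (hp' k hk)
      have h' : |((k - l : ℤ) : ℝ)| = ((ξ - k - (ξ - l) : ℤ) : ℝ) := by
        have : (k : ℝ) ≤ l := by exact_mod_cast hkl
        rw [abs_of_nonpos (by push_cast; linarith)]; push_cast; ring
      rw [h']
      refine le_trans (h.trans_eq ?_) (neg_le_abs _)
      rw [hlam]
      simp only [sub_sub_cancel]
      push_cast
      ring
    intro k hk l hl
    rcases le_total k l with h | h
    · exact aux k hk l hl h
    · have := aux l hl k hk h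
      rwa [abs_sub_comm (lam l), ← neg_sub k l, Int.cast_neg, abs_neg] at this
  have hcont : ∀ S' : Finset ℤ, Measurable fun t : ℝ =>
      ‖∑ k ∈ S', c k * Complex.exp (Complex.I * t * lam k)‖ₑ ^ 2 := fun S' => by
    have : Continuous fun t : ℝ => ∑ k ∈ S', c k * Complex.exp (Complex.I * t * lam k) := by
      fun_prop
    exact this.measurable.enorm.pow_const 2
  calc ∫⁻ t in Ioo α β, ‖∑ k ∈ S, c k * Complex.exp (Complex.I * t * lam k)‖ₑ ^ 2
      ≤ ∫⁻ t in Ioc α β, 2 * (‖∑ k ∈ S.filter p, c k * Complex.exp (Complex.I * t * lam k)‖ₑ ^ 2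
        + ‖∑ k ∈ S.filter (¬ p ·), c k * Complex.exp (Complex.I * t * lam k)‖ₑ ^ 2) := by
        refine (lintegral_mono_set Ioo_subset_Ioc_self).trans (lintegral_mono fun t => ?_)
        rw [← Finset.sum_filter_add_sum_filter_not S p]
        refine le_trans ?_ (ennreal_add_sq_le _ _)
        gcongr
        exact enorm_add_le _ _
    _ = 2 * ((∫⁻ t in Ioc α β,
          ‖∑ k ∈ S.filter p, c k * Complex.exp (Complex.I * t * lam k)‖ₑ ^ 2)
        + ∫⁻ t in Ioc α β,
          ‖∑ k ∈ S.filter (¬ p ·), c k * Complex.exp (Complex.I * t * lam k)‖ₑ ^ 2) := by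
        rw [lintegral_const_mul' _ _ (by norm_num), lintegral_add_left (hcont _)]
    _ ≤ 2 * (ENNReal.ofReal (sieveConst / N) * ∑ k ∈ S.filter p, ‖c k‖ₑ ^ 2
        + ENNReal.ofReal (sieveConst / N) * ∑ k ∈ S.filter (¬ p ·), ‖c k‖ₑ ^ 2) := by
        gcongr
        · exact lintegral_norm_sq_separated_le _ c lam hN hαβ hpos
        · exact lintegral_norm_sq_separated_le _ c lam hN hαβ hneg
    _ = _ := by
        rw [← mul_add, Finset.sum_filter_add_sum_filter_not, ← mul_assoc, mul_div_assoc 2,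
          ENNReal.ofReal_mul (by norm_num)]
        norm_num

/-- The `k`-th Fourier coefficient as a functional on `L²`. -/
noncomputable def coef (k : ℤ) : L2Torus →L[ℂ] ℂ := innerSL ℂ (fourierLp 2 k)

lemma sum_enorm_coef_sq_le (S : Finset ℤ) (φ : L2Torus) :
    ∑ k ∈ S, ‖coef k φ‖ₑ ^ 2 ≤ ‖φ‖ₑ ^ 2 := by
  have h := (orthonormal_fourier (T := 2 * π)).sum_inner_products_le (s := S) φ
  simp_rw [← ofReal_norm, ← ENNReal.ofReal_pow (norm_nonneg _)]
  rw [← ENNReal.ofReal_sum_of_nonneg fun _ _ => by positivity]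
  exact ENNReal.ofReal_le_ofReal h

lemma sum_enorm_coef_sub_sq_le (S : Finset ℤ) (l : ℤ) (φ : L2Torus) :
    ∑ k ∈ S, ‖coef (-k - l) φ‖ₑ ^ 2 ≤ ‖φ‖ₑ ^ 2 := by
  classical
  refine le_trans (le_of_eq ?_) (sum_enorm_coef_sq_le (S.image fun k => -k - l) φ)
  rw [Finset.sum_image]
  intro x _ y _ h
  simpa using h

/-- The part of a bilinear form with symbol `m` at the output frequency `-k₃`. -/
noncomputable def bilin (B₁ B₂ : Finset ℤ) (m : ℤ → ℤ → ℤ → ℂ) (t : ℝ) (k₃ : ℤ)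
    (φ ψ : L2Torus) : ℂ :=
  ∑ k₁ ∈ B₁, ∑ k₂ ∈ B₂, m k₁ k₂ k₃ * (wave t k₁ * wave t k₂) * (coef k₁ φ * coef k₂ ψ)

/-- For a fixed output frequency `-k₃` only `k₁` is free, and the sum is one of separated
exponentials. The resulting bound involves `|φ̂(k₁)|² |ψ̂(-k₃ - k₁)|²`, which on summing over `k₃`
and then `k₁` factors through Bessel's inequality. -/
lemma lintegral_bilin_le {B₁ B₂ B₃ : Finset ℤ} {m : ℤ → ℤ → ℤ → ℂ} {M : ℝ≥0∞} {N : ℝ} (hN : 0 < N)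
    (hm : ∀ k₁ k₂ k₃, ‖m k₁ k₂ k₃‖ₑ ≤ M)
    (hsupp : ∀ k₁ k₂ k₃, m k₁ k₂ k₃ ≠ 0 →
      k₁ + k₂ + k₃ = 0 ∧ N / 2 ≤ |((|k₁| - |k₂| : ℤ) : ℝ)|)
    {α β : ℝ} (hαβ : β - α ≤ 1 / N) (φ ψ : L2Torus) :
    ∫⁻ t in Ioo α β, ∑ k₃ ∈ B₃, ‖bilin B₁ B₂ m t k₃ φ ψ‖ₑ ^ 2 ≤
      ENNReal.ofReal (2 * sieveConst / N) * M ^ 2 * ‖φ‖ₑ ^ 2 * ‖ψ‖ₑ ^ 2 := by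
  classical
  -- Discarding the `k₁` with vanishing symbol makes transversality available on all of `S k₃`.
  set S : ℤ → Finset ℤ := fun k₃ => B₁.filter fun k₁ => -k₃ - k₁ ∈ B₂ ∧ m k₁ (-k₃ - k₁) k₃ ≠ 0
  set c : ℤ → ℤ → ℂ := fun k₃ k₁ => m k₁ (-k₃ - k₁) k₃ * (coef k₁ φ * coef (-k₃ - k₁) ψ)
  have hrw : ∀ t k₃, bilin B₁ B₂ m t k₃ φ ψ =
      ∑ k₁ ∈ S k₃, c k₃ k₁ * (wave t k₁ * wave t (-k₃ - k₁)) := by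
    intro t k₃
    rw [bilin, Finset.sum_filter]
    refine Finset.sum_congr rfl fun k₁ _ => ?_
    have h0 : ∀ k₂, k₂ ≠ -k₃ - k₁ → m k₁ k₂ k₃ = 0 := by
      intro k₂ hk
      by_contra h
      have := (hsupp _ _ _ h).1
      omega
    split_ifs with h
    · rw [Finset.sum_eq_single_of_mem _ h.1 fun k₂ _ hk => by rw [h0 k₂ hk]; ring]
      ring
    · refine Finset.sum_eq_zero fun k₂ hk₂ => ?_
      by_cases hk : k₂ = -k₃ - k₁
      · subst hk
        have : m k₁ (-k₃ - k₁) k₃ = 0 := by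
          by_contra h'
          exact h ⟨hk₂, h'⟩
        rw [this]; ring
      · rw [h0 k₂ hk]; ring
  have hmeas : ∀ k₃ ∈ B₃, Measurable fun t => ‖bilin B₁ B₂ m t k₃ φ ψ‖ₑ ^ 2 := by
    intro k₃ _
    have : Continuous fun t => bilin B₁ B₂ m t k₃ φ ψ := by
      unfold bilin
      have := continuous_wave
      fun_prop
    exact this.measurable.enorm.pow_const 2
  rw [lintegral_finsetSum _ hmeas]
  have hone : ∀ k₃ ∈ B₃, ∫⁻ t in Ioo α β, ‖bilin B₁ B₂ m t k₃ φ ψ‖ₑ ^ 2 ≤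
      ENNReal.ofReal (2 * sieveConst / N) *
        ∑ k₁ ∈ B₁, M ^ 2 * (‖coef k₁ φ‖ₑ ^ 2 * ‖coef (-k₃ - k₁) ψ‖ₑ ^ 2) := by
    intro k₃ _
    simp_rw [hrw]
    refine (lintegral_norm_sq_waves_le (S k₃) (c k₃) (-k₃) hN hαβ fun k hk =>
      (hsupp _ _ _ (Finset.mem_filter.mp hk).2.2).2).trans ?_
    gcongr
    refine (Finset.sum_le_sum_of_subset (Finset.filter_subset _ _)).trans
      (Finset.sum_le_sum fun k₁ _ => ?_)
    simp only [c, enorm_mul, mul_pow]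
    gcongr
    exact hm _ _ _
  refine (Finset.sum_le_sum hone).trans ?_
  rw [← Finset.mul_sum, Finset.sum_comm, mul_assoc, mul_assoc]
  gcongr
  calc ∑ k₁ ∈ B₁, ∑ k₃ ∈ B₃, M ^ 2 * (‖coef k₁ φ‖ₑ ^ 2 * ‖coef (-k₃ - k₁) ψ‖ₑ ^ 2)
      ≤ ∑ k₁ ∈ B₁, M ^ 2 * (‖coef k₁ φ‖ₑ ^ 2 * ‖ψ‖ₑ ^ 2) := by
        refine Finset.sum_le_sum fun k₁ _ => ?_
        rw [← Finset.mul_sum, ← Finset.mul_sum]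
        gcongr
        exact sum_enorm_coef_sub_sq_le B₃ k₁ ψ
    _ = M ^ 2 * ((∑ k₁ ∈ B₁, ‖coef k₁ φ‖ₑ ^ 2) * ‖ψ‖ₑ ^ 2) := by
        rw [← Finset.mul_sum, ← Finset.sum_mul]
    _ ≤ M ^ 2 * (‖φ‖ₑ ^ 2 * ‖ψ‖ₑ ^ 2) := by
        gcongr
        exact sum_enorm_coef_sq_le B₁ φ

/-- Transversality gains half a derivative in the `L²` norm of a product of two functions in
`U²`. -/
theorem lintegral_bilin_le_u2Norm {B₁ B₂ B₃ : Finset ℤ} {m : ℤ → ℤ → ℤ → ℂ} {M : ℝ≥0∞}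
    (hM : M ≠ ⊤) {N : ℝ} (hN : 0 < N) (hm : ∀ k₁ k₂ k₃, ‖m k₁ k₂ k₃‖ₑ ≤ M)
    (hsupp : ∀ k₁ k₂ k₃, m k₁ k₂ k₃ ≠ 0 →
      k₁ + k₂ + k₃ = 0 ∧ N / 2 ≤ |((|k₁| - |k₂| : ℤ) : ℝ)|)
    {α β : ℝ} (hαβ : β - α ≤ 1 / N) {f g : ℝ → L2Torus} {a₁ b₁ a₂ b₂ : ℝ}
    (hf : u2Norm a₁ b₁ f ≠ ⊤) (hg : u2Norm a₂ b₂ g ≠ ⊤)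
    (h₁ : Ioo α β ⊆ Ico a₁ b₁) (h₂ : Ioo α β ⊆ Ico a₂ b₂)
    (hgm : ∀ k, AEMeasurable (fun t => coef k (g t)) (volume.restrict (Ioo α β))) :
    ∫⁻ t in Ioo α β, ∑ k₃ ∈ B₃, ‖bilin B₁ B₂ m t k₃ (f t) (g t)‖ₑ ^ 2 ≤
      ENNReal.ofReal (2 * sieveConst / N) * M ^ 2 * u2Norm a₂ b₂ g ^ 2 * u2Norm a₁ b₁ f ^ 2 := by
  have hwm : ∀ k, AEMeasurable (fun t => wave t k) (volume.restrict (Ioo α β)) := fun k =>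
    (continuous_wave k).aemeasurable
  -- The transfer principle is used twice: here in the second argument with the first frozen, and
  -- afterwards in the first argument with `g t` absorbed into the functional. The second use is why
  -- the coefficients of `g` must be measurable.
  have hright : ∀ φ : L2Torus,
      ∫⁻ t in Ioo α β, ∑ k₃ ∈ B₃, ‖bilin B₁ B₂ m t k₃ φ (g t)‖ₑ ^ 2 ≤
      ENNReal.ofReal (2 * sieveConst / N) * M ^ 2 * ‖φ‖ₑ ^ 2 * u2Norm a₂ b₂ g ^ 2 := by
    intro φ
    set Ψ : ℝ → ℤ → L2Torus →L[ℂ] ℂ := fun t k₃ => ∑ k₁ ∈ B₁, ∑ k₂ ∈ B₂,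
      (m k₁ k₂ k₃ * (wave t k₁ * wave t k₂) * coef k₁ φ) • coef k₂
    have hΨ : ∀ t k₃ ψ, Ψ t k₃ ψ = bilin B₁ B₂ m t k₃ φ ψ := by
      intro t k₃ ψ
      simp only [Ψ, bilin, sum_apply, smul_apply,
        smul_eq_mul, mul_assoc]
    have h := lintegral_sum_sq_le_u2Norm B₃ Ψ (J := Ioo α β) (K := ENNReal.ofReal
      (2 * sieveConst / N) * M ^ 2 * ‖φ‖ₑ ^ 2) (by finiteness) measurableSet_Ioo h₂
      (fun ψ k₃ => ?_) (fun ψ => ?_) hg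
    · simpa only [hΨ] using h
    · simp_rw [hΨ, bilin]
      fun_prop
    · simp_rw [hΨ]
      exact lintegral_bilin_le hN hm hsupp hαβ φ ψ
  set Ψ : ℝ → ℤ → L2Torus →L[ℂ] ℂ := fun t k₃ => ∑ k₁ ∈ B₁, ∑ k₂ ∈ B₂,
    (m k₁ k₂ k₃ * (wave t k₁ * wave t k₂) * coef k₂ (g t)) • coef k₁
  have hΨ : ∀ t k₃ φ, Ψ t k₃ φ = bilin B₁ B₂ m t k₃ φ (g t) := by
    intro t k₃ φ
    simp only [Ψ, bilin, sum_apply, smul_apply,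
      smul_eq_mul]
    refine Finset.sum_congr rfl fun k₁ _ => Finset.sum_congr rfl fun k₂ _ => ?_
    ring
  have h := lintegral_sum_sq_le_u2Norm B₃ Ψ (J := Ioo α β) (K := ENNReal.ofReal
    (2 * sieveConst / N) * M ^ 2 * u2Norm a₂ b₂ g ^ 2) (by finiteness) measurableSet_Ioo h₁
    (fun φ k₃ => ?_) (fun φ => ?_) hf
  · simpa only [hΨ] using h
  · simp_rw [hΨ, bilin]
    fun_prop
  · simp_rw [hΨ]
    refine (hright φ).trans (le_of_eq ?_)
    ring

end BenjaminOno

namespace BenjaminOno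

/-! ### The trilinear estimate on a short time interval -/

/-- A trilinear form with symbol `m`, evaluated at the free evolutions of `φ`, `ψ`, `χ`. -/
noncomputable def trilin (B₁ B₂ B₃ : Finset ℤ) (m : ℤ → ℤ → ℤ → ℂ) (t : ℝ)
    (φ ψ χ : L2Torus) : ℂ :=
  ∑ k₁ ∈ B₁, ∑ k₂ ∈ B₂, ∑ k₃ ∈ B₃, m k₁ k₂ k₃ *
    ((wave t k₁ * coef k₁ φ) * (wave t k₂ * coef k₂ ψ) * (wave t k₃ * coef k₃ χ))

/-- Together with `trilin_rotate` this brings any transversal pair into the first two slots. -/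
lemma trilin_swap (B₁ B₂ B₃ : Finset ℤ) (m : ℤ → ℤ → ℤ → ℂ) (t : ℝ) (φ ψ χ : L2Torus) :
    trilin B₁ B₂ B₃ m t φ ψ χ = trilin B₁ B₃ B₂ (fun k₁ k₃ k₂ => m k₁ k₂ k₃) t φ χ ψ := by
  unfold trilin
  refine Finset.sum_congr rfl fun k₁ _ => ?_
  rw [Finset.sum_comm]
  refine Finset.sum_congr rfl fun k₃ _ => Finset.sum_congr rfl fun k₂ _ => ?_
  ring

lemma trilin_rotate (B₁ B₂ B₃ : Finset ℤ) (m : ℤ → ℤ → ℤ → ℂ) (t : ℝ) (φ ψ χ : L2Torus) :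
    trilin B₁ B₂ B₃ m t φ ψ χ = trilin B₂ B₃ B₁ (fun k₂ k₃ k₁ => m k₁ k₂ k₃) t ψ χ φ := by
  unfold trilin
  rw [Finset.sum_comm]
  refine Finset.sum_congr rfl fun k₂ _ => ?_
  rw [Finset.sum_comm]
  refine Finset.sum_congr rfl fun k₃ _ => Finset.sum_congr rfl fun k₁ _ => ?_
  ring

lemma trilin_eq_sum_bilin (B₁ B₂ B₃ : Finset ℤ) (m : ℤ → ℤ → ℤ → ℂ) (t : ℝ) (φ ψ χ : L2Torus) :
    trilin B₁ B₂ B₃ m t φ ψ χ =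
      ∑ k₃ ∈ B₃, (wave t k₃ * coef k₃ χ) * bilin B₁ B₂ m t k₃ φ ψ := by
  rw [trilin_rotate, trilin_rotate]
  unfold trilin bilin
  refine Finset.sum_congr rfl fun k₃ _ => ?_
  rw [Finset.mul_sum]
  refine Finset.sum_congr rfl fun k₁ _ => ?_
  rw [Finset.mul_sum]
  refine Finset.sum_congr rfl fun k₂ _ => ?_
  ring

lemma enorm_trilin_sq_le (B₁ B₂ B₃ : Finset ℤ) (m : ℤ → ℤ → ℤ → ℂ) (t : ℝ) (φ ψ χ : L2Torus) :
    ‖trilin B₁ B₂ B₃ m t φ ψ χ‖ₑ ^ 2 ≤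
      ‖χ‖ₑ ^ 2 * ∑ k₃ ∈ B₃, ‖bilin B₁ B₂ m t k₃ φ ψ‖ₑ ^ 2 := by
  rw [trilin_eq_sum_bilin]
  calc _ ≤ (∑ k₃ ∈ B₃, ‖coef k₃ χ‖ₑ * ‖bilin B₁ B₂ m t k₃ φ ψ‖ₑ) ^ 2 := by
        gcongr
        refine (enorm_sum_le _ _).trans (le_of_eq (Finset.sum_congr rfl fun k₃ _ => ?_))
        rw [enorm_mul, enorm_mul, enorm_wave, one_mul]
    _ ≤ _ := by
        refine (ennreal_sum_mul_sq_le _ _ _).trans ?_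
        gcongr
        exact sum_enorm_coef_sq_le B₃ χ

lemma lintegral_sq_le_mul_volume {J : Set ℝ} {F : ℝ → ℝ≥0∞}
    (hF : AEMeasurable F (volume.restrict J)) :
    (∫⁻ t in J, F t) ^ 2 ≤ (∫⁻ t in J, F t ^ 2) * volume J := by
  have h := ENNReal.lintegral_mul_le_Lp_mul_Lq (volume.restrict J)
    Real.HolderConjugate.two_two (f := F) (g := 1) hF aemeasurable_const
  simp only [mul_one, Pi.one_apply, ENNReal.one_rpow, lintegral_const, one_mul,
    Measure.restrict_apply_univ] at h
  calc _ ≤ ((∫⁻ t in J, F t ^ (2 : ℝ)) ^ (1 / 2 : ℝ) * volume J ^ (1 / 2 : ℝ)) ^ 2 := by gcongr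
    _ = _ := by
        rw [mul_pow, ← ENNReal.rpow_natCast, ← ENNReal.rpow_natCast, ← ENNReal.rpow_mul,
          ← ENNReal.rpow_mul]
        norm_num

section Window

variable {B₁ B₂ B₃ : Finset ℤ} {m : ℤ → ℤ → ℤ → ℂ} {M : ℝ≥0∞} {N α β : ℝ}
  {f g h : ℝ → L2Torus} {a₁ b₁ a₂ b₂ a₃ b₃ : ℝ}

/-- Cauchy-Schwarz in time gains `N^{-1/2}` from the length of the interval. A second `N^{-1/2}`
comes from the bilinear bound for the transversal pair, the third factor being bounded uniformly in
time. -/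
lemma lintegral_trilin_le_of_transversal (hM : M ≠ ⊤) (hN : 0 < N)
    (hm : ∀ k₁ k₂ k₃, ‖m k₁ k₂ k₃‖ₑ ≤ M)
    (hsupp : ∀ k₁ k₂ k₃, m k₁ k₂ k₃ ≠ 0 →
      k₁ + k₂ + k₃ = 0 ∧ N / 2 ≤ |((|k₁| - |k₂| : ℤ) : ℝ)|)
    (hαβ : β - α ≤ 1 / N)
    (hf : u2Norm a₁ b₁ f ≠ ⊤) (hg : u2Norm a₂ b₂ g ≠ ⊤)
    (h₁ : Ioo α β ⊆ Ico a₁ b₁) (h₂ : Ioo α β ⊆ Ico a₂ b₂) (h₃ : Ioo α β ⊆ Ico a₃ b₃)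
    (hfm : ∀ k, AEMeasurable (fun t => coef k (f t)) (volume.restrict (Ioo α β)))
    (hgm : ∀ k, AEMeasurable (fun t => coef k (g t)) (volume.restrict (Ioo α β)))
    (hhm : ∀ k, AEMeasurable (fun t => coef k (h t)) (volume.restrict (Ioo α β))) :
    ∫⁻ t in Ioo α β, ‖trilin B₁ B₂ B₃ m t (f t) (g t) (h t)‖ₑ ≤
      ENNReal.ofReal (√(2 * sieveConst) / N) * M *
        (u2Norm a₁ b₁ f * u2Norm a₂ b₂ g * u2Norm a₃ b₃ h) := by
  have hwm : ∀ k, AEMeasurable (fun t => wave t k) (volume.restrict (Ioo α β)) := fun k =>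
    (continuous_wave k).aemeasurable
  have htm : AEMeasurable (fun t => trilin B₁ B₂ B₃ m t (f t) (g t) (h t))
      (volume.restrict (Ioo α β)) := by
    unfold trilin
    fun_prop
  have hbm : ∀ k₃, AEMeasurable (fun t => bilin B₁ B₂ m t k₃ (f t) (g t))
      (volume.restrict (Ioo α β)) := by
    intro k₃
    unfold bilin
    fun_prop
  refine (ennreal_sq_le_sq_iff _ _).mp ((lintegral_sq_le_mul_volume htm.enorm).trans ?_)
  calc (∫⁻ t in Ioo α β, ‖trilin B₁ B₂ B₃ m t (f t) (g t) (h t)‖ₑ ^ 2) * volume (Ioo α β)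
      ≤ (∫⁻ t in Ioo α β, u2Norm a₃ b₃ h ^ 2 *
          ∑ k₃ ∈ B₃, ‖bilin B₁ B₂ m t k₃ (f t) (g t)‖ₑ ^ 2) * ENNReal.ofReal (1 / N) := by
        rw [Real.volume_Ioo]
        gcongr ?_ * ?_
        · refine setLIntegral_mono' measurableSet_Ioo fun t ht => ?_
          refine (enorm_trilin_sq_le _ _ _ _ _ _ _ _).trans ?_
          gcongr
          exact enorm_le_u2Norm (h₃ ht)
        · exact ENNReal.ofReal_le_ofReal hαβ
    _ ≤ (u2Norm a₃ b₃ h ^ 2 * (ENNReal.ofReal (2 * sieveConst / N) * M ^ 2 *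
          u2Norm a₂ b₂ g ^ 2 * u2Norm a₁ b₁ f ^ 2)) * ENNReal.ofReal (1 / N) := by
        rw [lintegral_const_mul'' _ (Finset.aemeasurable_fun_sum _ fun k₃ _ =>
          (hbm k₃).enorm.pow_const 2)]
        gcongr
        exact lintegral_bilin_le_u2Norm hM hN hm hsupp hαβ hf hg h₁ h₂ hgm
    _ = (ENNReal.ofReal (2 * sieveConst / N) * ENNReal.ofReal (1 / N)) * M ^ 2 *
        (u2Norm a₁ b₁ f * u2Norm a₂ b₂ g * u2Norm a₃ b₃ h) ^ 2 := by ring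
    _ = _ := by
        rw [mul_pow (_ * M), mul_pow _ M, ← ENNReal.ofReal_pow (by positivity), div_pow,
          Real.sq_sqrt (by linarith [sieveConst_nonneg]),
          ← ENNReal.ofReal_mul (div_nonneg (by linarith [sieveConst_nonneg]) hN.le)]
        congr 3
        field_simp

/-- The symbol is cut into three disjoint pieces according to the first transversal pair in the
order 12, 13, 23. Each piece still obeys the bound `M`, whence the factor 3. -/
lemma lintegral_trilin_le (hM : M ≠ ⊤) (hN : 0 < N)
    (hm : ∀ k₁ k₂ k₃, ‖m k₁ k₂ k₃‖ₑ ≤ M)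
    (hsupp : ∀ k₁ k₂ k₃, m k₁ k₂ k₃ ≠ 0 → k₁ + k₂ + k₃ = 0 ∧
      (N / 2 ≤ |((|k₁| - |k₂| : ℤ) : ℝ)| ∨ N / 2 ≤ |((|k₁| - |k₃| : ℤ) : ℝ)| ∨
        N / 2 ≤ |((|k₂| - |k₃| : ℤ) : ℝ)|))
    (hαβ : β - α ≤ 1 / N)
    (hf : u2Norm a₁ b₁ f ≠ ⊤) (hg : u2Norm a₂ b₂ g ≠ ⊤) (hh : u2Norm a₃ b₃ h ≠ ⊤)
    (h₁ : Ioo α β ⊆ Ico a₁ b₁) (h₂ : Ioo α β ⊆ Ico a₂ b₂) (h₃ : Ioo α β ⊆ Ico a₃ b₃)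
    (hfm : ∀ k, AEMeasurable (fun t => coef k (f t)) (volume.restrict (Ioo α β)))
    (hgm : ∀ k, AEMeasurable (fun t => coef k (g t)) (volume.restrict (Ioo α β)))
    (hhm : ∀ k, AEMeasurable (fun t => coef k (h t)) (volume.restrict (Ioo α β))) :
    ∫⁻ t in Ioo α β, ‖trilin B₁ B₂ B₃ m t (f t) (g t) (h t)‖ₑ ≤
      3 * (ENNReal.ofReal (√(2 * sieveConst) / N) * M *
        (u2Norm a₁ b₁ f * u2Norm a₂ b₂ g * u2Norm a₃ b₃ h)) := by
  classical
  set p₁₂ : ℤ → ℤ → ℤ → Prop := fun k₁ k₂ _ => N / 2 ≤ |((|k₁| - |k₂| : ℤ) : ℝ)| with hp₁₂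
  set p₁₃ : ℤ → ℤ → ℤ → Prop := fun k₁ _ k₃ => N / 2 ≤ |((|k₁| - |k₃| : ℤ) : ℝ)| with hp₁₃
  set m₁ : ℤ → ℤ → ℤ → ℂ := fun k₁ k₂ k₃ => if p₁₂ k₁ k₂ k₃ then m k₁ k₂ k₃ else 0 with hm₁
  set m₂ : ℤ → ℤ → ℤ → ℂ := fun k₁ k₂ k₃ =>
    if ¬ p₁₂ k₁ k₂ k₃ ∧ p₁₃ k₁ k₂ k₃ then m k₁ k₂ k₃ else 0 with hm₂
  set m₃ : ℤ → ℤ → ℤ → ℂ := fun k₁ k₂ k₃ =>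
    if ¬ p₁₂ k₁ k₂ k₃ ∧ ¬ p₁₃ k₁ k₂ k₃ then m k₁ k₂ k₃ else 0 with hm₃
  have hite : ∀ (p : Prop) [Decidable p] (z : ℂ), ‖z‖ₑ ≤ M → ‖if p then z else 0‖ₑ ≤ M := by
    intro p _ z hz
    split_ifs
    · exact hz
    · simp
  have hsplit : ∀ t φ ψ χ, trilin B₁ B₂ B₃ m t φ ψ χ = trilin B₁ B₂ B₃ m₁ t φ ψ χ +
      trilin B₁ B₂ B₃ m₂ t φ ψ χ + trilin B₁ B₂ B₃ m₃ t φ ψ χ := by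
    intro t φ ψ χ
    unfold trilin
    simp only [← Finset.sum_add_distrib]
    refine Finset.sum_congr rfl fun k₁ _ => Finset.sum_congr rfl fun k₂ _ =>
      Finset.sum_congr rfl fun k₃ _ => ?_
    rw [← add_mul, ← add_mul]
    congr 1
    simp only [hm₁, hm₂, hm₃]
    by_cases h12 : p₁₂ k₁ k₂ k₃ <;> by_cases h13 : p₁₃ k₁ k₂ k₃ <;> simp [h12, h13]
  have hwm : ∀ k, AEMeasurable (fun t => wave t k) (volume.restrict (Ioo α β)) := fun k =>
    (continuous_wave k).aemeasurable
  have htm : ∀ m', AEMeasurable (fun t => trilin B₁ B₂ B₃ m' t (f t) (g t) (h t))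
      (volume.restrict (Ioo α β)) := by
    intro m'
    unfold trilin
    fun_prop
  have e₁ : ∫⁻ t in Ioo α β, ‖trilin B₁ B₂ B₃ m₁ t (f t) (g t) (h t)‖ₑ ≤
      ENNReal.ofReal (√(2 * sieveConst) / N) * M *
        (u2Norm a₁ b₁ f * u2Norm a₂ b₂ g * u2Norm a₃ b₃ h) := by
    refine lintegral_trilin_le_of_transversal hM hN (fun _ _ _ => hite _ _ (hm _ _ _)) ?_ hαβ hf hg
      h₁ h₂ h₃ hfm hgm hhm
    intro k₁ k₂ k₃ hne
    simp only [hm₁] at hne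
    split_ifs at hne with hp
    · exact ⟨(hsupp _ _ _ hne).1, hp⟩
    · exact absurd rfl hne
  have e₂ : ∫⁻ t in Ioo α β, ‖trilin B₁ B₂ B₃ m₂ t (f t) (g t) (h t)‖ₑ ≤
      ENNReal.ofReal (√(2 * sieveConst) / N) * M *
        (u2Norm a₁ b₁ f * u2Norm a₃ b₃ h * u2Norm a₂ b₂ g) := by
    simp_rw [trilin_swap B₁ B₂ B₃ m₂]
    refine lintegral_trilin_le_of_transversal hM hN (fun _ _ _ => hite _ _ (hm _ _ _)) ?_ hαβ hf hh
      h₁ h₃ h₂ hfm hhm hgm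
    intro k₁ k₃ k₂ hne
    simp only [hm₂] at hne
    split_ifs at hne with hp
    · have := (hsupp _ _ _ hne).1
      exact ⟨by omega, hp.2⟩
    · exact absurd rfl hne
  have e₃ : ∫⁻ t in Ioo α β, ‖trilin B₁ B₂ B₃ m₃ t (f t) (g t) (h t)‖ₑ ≤
      ENNReal.ofReal (√(2 * sieveConst) / N) * M *
        (u2Norm a₂ b₂ g * u2Norm a₃ b₃ h * u2Norm a₁ b₁ f) := by
    simp_rw [trilin_rotate B₁ B₂ B₃ m₃]
    refine lintegral_trilin_le_of_transversal hM hN (fun _ _ _ => hite _ _ (hm _ _ _)) ?_ hαβ hg hh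
      h₂ h₃ h₁ hgm hhm hfm
    intro k₂ k₃ k₁ hne
    simp only [hm₃] at hne
    split_ifs at hne with hp
    · have h' := hsupp _ _ _ hne
      refine ⟨by omega, ?_⟩
      rcases h'.2 with h'' | h'' | h''
      · exact absurd h'' hp.1
      · exact absurd h'' hp.2
      · exact h''
    · exact absurd rfl hne
  calc ∫⁻ t in Ioo α β, ‖trilin B₁ B₂ B₃ m t (f t) (g t) (h t)‖ₑ
      ≤ ∫⁻ t in Ioo α β, (‖trilin B₁ B₂ B₃ m₁ t (f t) (g t) (h t)‖ₑ +
          ‖trilin B₁ B₂ B₃ m₂ t (f t) (g t) (h t)‖ₑ +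
          ‖trilin B₁ B₂ B₃ m₃ t (f t) (g t) (h t)‖ₑ) := by
        refine lintegral_mono fun t => ?_
        rw [hsplit]
        refine (enorm_add_le _ _).trans ?_
        gcongr
        exact enorm_add_le _ _
    _ ≤ _ := by
        rw [lintegral_add_right' _ (htm m₃).enorm, lintegral_add_right' _ (htm m₂).enorm]
        refine (add_le_add (add_le_add e₁ e₂) e₃).trans (le_of_eq ?_)
        ring

end Window

/-! ### The trilinear estimate for dyadic blocks -/

lemma coef_fourierLp (k l : ℤ) : coef k (fourierLp 2 l) = if k = l then 1 else 0 :=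
  orthonormal_iff_ite.mp (orthonormal_fourier (T := 2 * π)) k l

lemma coef_profileBlock {j : ℕ} {k : ℤ} (hk : k ∈ block j) (t : ℝ) (f : Torus → ℝ) :
    coef k (profileBlock j t f) =
      Complex.exp (Complex.I * (t : ℂ) * ((k * |k| : ℤ) : ℂ)) * fhat f k := by
  simp only [profileBlock, map_sum, map_smul, coef_fourierLp, smul_eq_mul, mul_ite, mul_one,
    mul_zero]
  rw [Finset.sum_ite_eq, if_pos hk]

lemma coef_profileBlock_of_notMem {j : ℕ} {k : ℤ} (hk : k ∉ block j) (t : ℝ) (f : Torus → ℝ) :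
    coef k (profileBlock j t f) = 0 := by
  simp only [profileBlock, map_sum, map_smul, coef_fourierLp, smul_eq_mul, mul_ite, mul_one,
    mul_zero]
  rw [Finset.sum_ite_eq, if_neg hk]

lemma wave_mul_coef_profileBlock {j : ℕ} {k : ℤ} (hk : k ∈ block j) (t : ℝ) (f : Torus → ℝ) :
    wave t k * coef k (profileBlock j t f) = fhat f k := by
  rw [coef_profileBlock hk, wave, ← mul_assoc, ← Complex.exp_add, neg_add_cancel, Complex.exp_zero,
    one_mul]

lemma enorm_fhat_le_profileBlock {j : ℕ} {k : ℤ} (hk : k ∈ block j) (t : ℝ) (f : Torus → ℝ) :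
    ‖fhat f k‖ₑ ≤ ‖profileBlock j t f‖ₑ := by
  have h := sum_enorm_coef_sq_le {k} (profileBlock j t f)
  rw [Finset.sum_singleton] at h
  rw [← wave_mul_coef_profileBlock hk t f, enorm_mul, enorm_wave, one_mul]
  exact (ennreal_sq_le_sq_iff _ _).mp h

lemma mem_block_iff_log {j : ℕ} {k : ℤ} : k ∈ block j ↔ Nat.log 2 k.natAbs = j := by
  have h1 : k ∈ block j ↔ |k| < 2 ^ (j + 1) ∧ (j = 0 ∨ 2 ^ j ≤ |k|) := by
    simp only [block, Finset.mem_filter, Finset.mem_Ioo, abs_lt]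
  rw [h1, Int.abs_eq_natAbs]
  have e1 : ((k.natAbs : ℤ) < 2 ^ (j + 1)) ↔ k.natAbs < 2 ^ (j + 1) := by exact_mod_cast Iff.rfl
  have e2 : ((2 : ℤ) ^ j ≤ k.natAbs) ↔ 2 ^ j ≤ k.natAbs := by exact_mod_cast Iff.rfl
  rw [e1, e2]
  rcases Nat.eq_zero_or_pos j with rfl | hj
  · simp [Nat.log_eq_zero_iff]
  · rw [Nat.log_eq_iff (Or.inl hj.ne')]
    constructor
    · rintro ⟨h, h' | h'⟩
      · exact absurd h' hj.ne'
      · exact ⟨h', h⟩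
    · rintro ⟨h, h'⟩
      exact ⟨h', Or.inr h⟩

lemma two_pow_le_abs_of_mem_block {j : ℕ} {k : ℤ} (hk : k ∈ block j) (hk0 : k ≠ 0) :
    (2 : ℤ) ^ j ≤ |k| := by
  rw [mem_block_iff_log] at hk
  have h := Nat.pow_log_le_self 2 (Int.natAbs_ne_zero.mpr hk0)
  rw [hk] at h
  rw [Int.abs_eq_natAbs]
  exact_mod_cast h

lemma abs_lt_of_mem_block {j : ℕ} {k : ℤ} (hk : k ∈ block j) : |k| < (2 : ℤ) ^ (j + 1) := by
  simp only [block, Finset.mem_filter, Finset.mem_Ioo] at hk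
  exact abs_lt.mpr hk.1

/-- The largest modulus is the sum of the other two. Its difference with the smaller of them is
therefore the larger of them, hence at least half of the maximum. -/
lemma exists_transversal_pair {q k₁ k₂ k₃ : ℤ} (h0 : k₁ + k₂ + k₃ = 0)
    (hq : q ≤ |k₁| ∨ q ≤ |k₂| ∨ q ≤ |k₃|) :
    q ≤ 2 * |(|k₁| - |k₂|)| ∨ q ≤ 2 * |(|k₁| - |k₃|)| ∨ q ≤ 2 * |(|k₂| - |k₃|)| := by
  grind

/-- The largest `U²` norm of the block `j` of `u` over the windows of that block. -/
noncomputable def blockNorm (T : ℝ) (u : ℝ → Torus → ℝ) (j : ℕ) : ℝ≥0∞ :=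
  ⨆ (a : ℝ) (_ : 0 ≤ a) (_ : a + windowLength T j ≤ T),
    u2Norm a (a + windowLength T j) (fun t => profileBlock j t (u t))

lemma u2Norm_le_blockNorm {T a : ℝ} (u : ℝ → Torus → ℝ) (j : ℕ) (ha : 0 ≤ a)
    (ha' : a + windowLength T j ≤ T) :
    u2Norm a (a + windowLength T j) (fun t => profileBlock j t (u t)) ≤ blockNorm T u j :=
  le_iSup₂_of_le a ha (le_iSup (fun _ => u2Norm a (a + windowLength T j)
    (fun t => profileBlock j t (u t))) ha')

lemma windowLength_pos {T : ℝ} (hT : 0 < T) (j : ℕ) : 0 < windowLength T j :=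
  lt_min (by positivity) hT

lemma windowLength_anti (T : ℝ) {i j : ℕ} (hij : i ≤ j) : windowLength T j ≤ windowLength T i := by
  unfold windowLength
  refine min_le_min_right _ (inv_anti₀ (by positivity) (pow_le_pow_right₀ (by norm_num) hij))

/-- Start the window at `α`, unless it would stick out of `[0, T]`; in that case let it end at `T`.
-/
lemma exists_window {T : ℝ} (j : ℕ) {α β : ℝ} (hα : 0 ≤ α) (hβ : β ≤ T)
    (hαβ : β - α ≤ windowLength T j) :
    ∃ a, 0 ≤ a ∧ a + windowLength T j ≤ T ∧ Ioo α β ⊆ Ico a (a + windowLength T j) := by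
  have hL : windowLength T j ≤ T := min_le_right _ _
  refine ⟨min α (T - windowLength T j), le_min hα (by linarith), ?_, fun t ht => ?_⟩
  · linarith [min_le_right α (T - windowLength T j)]
  · refine ⟨(min_le_left _ _).trans ht.1.le, ?_⟩
    rcases min_choice α (T - windowLength T j) with h | h <;> rw [h] <;> linarith [ht.2]

/-- In `ℝ≥0∞` one has `0 * ⊤ = 0`, so the trilinear bound has content even if one block norm
vanishes and another is infinite. This settles that case. -/
lemma fhat_eq_zero_of_blockNorm_eq_zero {T : ℝ} {u : ℝ → Torus → ℝ} {j : ℕ}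
    (h : blockNorm T u j = 0) {t : ℝ} (ht : t ∈ Ioo 0 T) {k : ℤ} (hk : k ∈ block j) :
    fhat (u t) k = 0 := by
  have hT : 0 < T := ht.1.trans ht.2
  have hL := windowLength_pos hT j
  set δ := min (windowLength T j) (T - t) with hδ
  have hδ0 : 0 < δ := lt_min hL (by linarith [ht.2])
  obtain ⟨a, ha, ha', hsub⟩ := exists_window (T := T) j (α := max 0 (t - δ / 2)) (β := t + δ / 2)
    (le_max_left _ _) (by have := min_le_right (windowLength T j) (T - t); linarith)
    (by
      have := min_le_left (windowLength T j) (T - t)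
      have := le_max_right 0 (t - δ / 2)
      linarith)
  have hmem := hsub (show t ∈ Ioo _ _ from ⟨max_lt ht.1 (by linarith), by linarith⟩)
  have h1 := (enorm_fhat_le_profileBlock hk t (u t)).trans
    ((enorm_le_u2Norm (f := fun t => profileBlock j t (u t)) hmem).trans
      (u2Norm_le_blockNorm u j ha ha'))
  rw [h] at h1
  simpa using h1

/-- The constant of the trilinear estimate. -/
noncomputable def trilinConst : ℝ≥0∞ := ENNReal.ofReal (6 * √(2 * sieveConst))

section Blocks

variable {T : ℝ} {u₁ u₂ u₃ : ℝ → Torus → ℝ}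

lemma trilin_profileBlock (j₁ j₂ j₃ : ℕ) (m : ℤ → ℤ → ℤ → ℂ) (t : ℝ) (f₁ f₂ f₃ : Torus → ℝ) :
    trilin (block j₁) (block j₂) (block j₃) m t (profileBlock j₁ t f₁) (profileBlock j₂ t f₂)
      (profileBlock j₃ t f₃) = ∑ k₁ ∈ block j₁, ∑ k₂ ∈ block j₂, ∑ k₃ ∈ block j₃,
        m k₁ k₂ k₃ * (fhat f₁ k₁ * fhat f₂ k₂ * fhat f₃ k₃) := by
  unfold trilin
  refine Finset.sum_congr rfl fun k₁ h₁ => Finset.sum_congr rfl fun k₂ h₂ =>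
    Finset.sum_congr rfl fun k₃ h₃ => ?_
  rw [wave_mul_coef_profileBlock h₁, wave_mul_coef_profileBlock h₂, wave_mul_coef_profileBlock h₃]

lemma aemeasurable_coef_profileBlock {u : ℝ → Torus → ℝ}
    (hu : ∀ k, ContinuousOn (fun t => fhat (u t) k) (Icc 0 T)) (j : ℕ) {α β : ℝ} (hα : 0 ≤ α)
    (hβ : β ≤ T) (k : ℤ) :
    AEMeasurable (fun t => coef k (profileBlock j t (u t))) (volume.restrict (Ioo α β)) := by
  by_cases hk : k ∈ block j
  · simp_rw [coef_profileBlock hk]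
    refine ContinuousOn.aemeasurable ?_ measurableSet_Ioo
    refine ContinuousOn.mul (Continuous.continuousOn (by fun_prop)) ((hu k).mono ?_)
    exact fun t ht => ⟨hα.trans ht.1.le, ht.2.le.trans hβ⟩
  · simp_rw [coef_profileBlock_of_notMem hk]
    exact aemeasurable_const

lemma enorm_intervalIntegral_trilin_le
    (hu₁ : ∀ k, ContinuousOn (fun t => fhat (u₁ t) k) (Icc 0 T))
    (hu₂ : ∀ k, ContinuousOn (fun t => fhat (u₂ t) k) (Icc 0 T))
    (hu₃ : ∀ k, ContinuousOn (fun t => fhat (u₃ t) k) (Icc 0 T))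
    {j₁ j₂ j₃ : ℕ} {m : ℤ → ℤ → ℤ → ℂ} {M : ℝ≥0∞} (hM : M ≠ ⊤)
    (hm : ∀ k₁ k₂ k₃, ‖m k₁ k₂ k₃‖ₑ ≤ M)
    {N : ℝ} (hN : 0 < N) (hsupp : ∀ k₁ k₂ k₃, m k₁ k₂ k₃ ≠ 0 → k₁ + k₂ + k₃ = 0 ∧
      (N / 2 ≤ |((|k₁| - |k₂| : ℤ) : ℝ)| ∨ N / 2 ≤ |((|k₁| - |k₃| : ℤ) : ℝ)| ∨
        N / 2 ≤ |((|k₂| - |k₃| : ℤ) : ℝ)|))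
    (hF₁ : blockNorm T u₁ j₁ ≠ ⊤) (hF₂ : blockNorm T u₂ j₂ ≠ ⊤) (hF₃ : blockNorm T u₃ j₃ ≠ ⊤)
    {α β : ℝ} (hα : 0 ≤ α) (hαβ : α ≤ β) (hβ : β ≤ T) (hlen : β - α ≤ 1 / N)
    (h₁ : β - α ≤ windowLength T j₁) (h₂ : β - α ≤ windowLength T j₂)
    (h₃ : β - α ≤ windowLength T j₃) :
    ‖∫ t in α..β, ∑ k₁ ∈ block j₁, ∑ k₂ ∈ block j₂, ∑ k₃ ∈ block j₃,
        m k₁ k₂ k₃ * (fhat (u₁ t) k₁ * fhat (u₂ t) k₂ * fhat (u₃ t) k₃)‖ₑ ≤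
      3 * (ENNReal.ofReal (√(2 * sieveConst) / N) * M *
        (blockNorm T u₁ j₁ * blockNorm T u₂ j₂ * blockNorm T u₃ j₃)) := by
  obtain ⟨a₁, ha₁, ha₁', hs₁⟩ := exists_window j₁ hα hβ h₁
  obtain ⟨a₂, ha₂, ha₂', hs₂⟩ := exists_window j₂ hα hβ h₂
  obtain ⟨a₃, ha₃, ha₃', hs₃⟩ := exists_window j₃ hα hβ h₃
  have b₁ := u2Norm_le_blockNorm u₁ j₁ ha₁ ha₁'
  have b₂ := u2Norm_le_blockNorm u₂ j₂ ha₂ ha₂'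
  have b₃ := u2Norm_le_blockNorm u₃ j₃ ha₃ ha₃'
  rw [intervalIntegral.integral_of_le hαβ, integral_Ioc_eq_integral_Ioo]
  refine (enorm_integral_le_lintegral_enorm _).trans ?_
  simp_rw [← fun t => trilin_profileBlock j₁ j₂ j₃ m t (u₁ t) (u₂ t) (u₃ t)]
  refine (lintegral_trilin_le hM hN hm hsupp hlen (ne_top_of_le_ne_top hF₁ b₁)
    (ne_top_of_le_ne_top hF₂ b₂) (ne_top_of_le_ne_top hF₃ b₃) hs₁ hs₂ hs₃
    (aemeasurable_coef_profileBlock hu₁ j₁ hα hβ) (aemeasurable_coef_profileBlock hu₂ j₂ hα hβ)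
    (aemeasurable_coef_profileBlock hu₃ j₃ hα hβ)).trans ?_
  gcongr

/-- The trilinear estimate: an integral in time of a product of three frequency-localized
functions loses no derivative, whatever the bounded symbol. -/
theorem enorm_sum_integral_le (hT : 0 < T) (hT1 : T ≤ 1)
    (hu₁ : ∀ k, ContinuousOn (fun t => fhat (u₁ t) k) (Icc 0 T))
    (hu₂ : ∀ k, ContinuousOn (fun t => fhat (u₂ t) k) (Icc 0 T))
    (hu₃ : ∀ k, ContinuousOn (fun t => fhat (u₃ t) k) (Icc 0 T))
    {j₁ j₂ j₃ : ℕ} {m : ℤ → ℤ → ℤ → ℂ} {M : ℝ≥0∞} (hM0 : M ≠ 0) (hM : M ≠ ⊤)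
    (hm : ∀ k₁ k₂ k₃, ‖m k₁ k₂ k₃‖ₑ ≤ M)
    (hsupp : ∀ k₁ k₂ k₃, m k₁ k₂ k₃ ≠ 0 → k₁ + k₂ + k₃ = 0 ∧ (k₁ ∈ block j₁ ∧ k₁ ≠ 0) ∧
      (k₂ ∈ block j₂ ∧ k₂ ≠ 0) ∧ (k₃ ∈ block j₃ ∧ k₃ ≠ 0))
    {t₀ : ℝ} (ht₀ : t₀ ∈ Icc 0 T) :
    ‖∑ k₁ ∈ block j₁, ∑ k₂ ∈ block j₂, ∑ k₃ ∈ block j₃, m k₁ k₂ k₃ *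
        ∫ t in 0..t₀, fhat (u₁ t) k₁ * fhat (u₂ t) k₂ * fhat (u₃ t) k₃‖ₑ ≤
      (1 + trilinConst) * M * (blockNorm T u₁ j₁ * blockNorm T u₂ j₂ * blockNorm T u₃ j₃) := by
  have hzero : (∀ t ∈ Ioo 0 T, ∀ k₁ ∈ block j₁, ∀ k₂ ∈ block j₂, ∀ k₃ ∈ block j₃,
      fhat (u₁ t) k₁ * fhat (u₂ t) k₂ * fhat (u₃ t) k₃ = 0) →
      ‖∑ k₁ ∈ block j₁, ∑ k₂ ∈ block j₂, ∑ k₃ ∈ block j₃, m k₁ k₂ k₃ *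
        ∫ t in 0..t₀, fhat (u₁ t) k₁ * fhat (u₂ t) k₂ * fhat (u₃ t) k₃‖ₑ ≤
      (1 + trilinConst) * M * (blockNorm T u₁ j₁ * blockNorm T u₂ j₂ * blockNorm T u₃ j₃) := by
    intro h
    rw [Finset.sum_eq_zero]
    · simp
    intro k₁ h₁
    refine Finset.sum_eq_zero fun k₂ h₂ => Finset.sum_eq_zero fun k₃ h₃ => ?_
    rw [intervalIntegral.integral_of_le ht₀.1, integral_Ioc_eq_integral_Ioo,
      setIntegral_congr_fun measurableSet_Ioo (g := fun _ => 0), integral_zero, mul_zero]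
    exact fun t ht => h t ⟨ht.1, ht.2.trans_le ht₀.2⟩ k₁ h₁ k₂ h₂ k₃ h₃
  by_cases z₁ : blockNorm T u₁ j₁ = 0
  · refine hzero fun t ht k₁ h₁ k₂ _ k₃ _ => ?_
    rw [fhat_eq_zero_of_blockNorm_eq_zero z₁ ht h₁]; ring
  by_cases z₂ : blockNorm T u₂ j₂ = 0
  · refine hzero fun t ht k₁ _ k₂ h₂ k₃ _ => ?_
    rw [fhat_eq_zero_of_blockNorm_eq_zero z₂ ht h₂]; ring
  by_cases z₃ : blockNorm T u₃ j₃ = 0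
  · refine hzero fun t ht k₁ _ k₂ _ k₃ h₃ => ?_
    rw [fhat_eq_zero_of_blockNorm_eq_zero z₃ ht h₃]; ring
  -- The summand 1 in `1 + trilinConst` keeps the constant positive, so that an infinite product
  -- makes the right side infinite.
  by_cases hfin : blockNorm T u₁ j₁ * blockNorm T u₂ j₂ * blockNorm T u₃ j₃ = ⊤
  · rw [hfin, ENNReal.mul_top]
    · exact le_top
    · simp [hM0]
  have hF₃ : blockNorm T u₃ j₃ ≠ ⊤ := fun h => hfin (by
    rw [h, ENNReal.mul_top (mul_ne_zero z₁ z₂)])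
  have hF₂ : blockNorm T u₂ j₂ ≠ ⊤ := fun h => hfin (by
    rw [h, ENNReal.mul_top z₁, ENNReal.top_mul z₃])
  have hF₁ : blockNorm T u₁ j₁ ≠ ⊤ := fun h => hfin (by
    rw [h, ENNReal.top_mul z₂, ENNReal.top_mul z₃])
  rcases ht₀.1.eq_or_lt with rfl | ht₀pos
  · simp
  set J := max j₁ (max j₂ j₃) with hJ
  have hJ₁ : j₁ ≤ J := le_max_left _ _
  have hJ₂ : j₂ ≤ J := (le_max_left _ _).trans (le_max_right _ _)
  have hJ₃ : j₃ ≤ J := (le_max_right _ _).trans (le_max_right _ _)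
  set N : ℝ := 2 ^ J with hNdef
  have hN : 0 < N := by positivity
  have hN1 : 1 ≤ N := one_le_pow₀ (by norm_num)
  set L := windowLength T J with hL
  have hLpos : 0 < L := windowLength_pos hT J
  set n := ⌈t₀ / L⌉₊ with hn
  have hnpos : 0 < n := Nat.ceil_pos.mpr (by positivity)
  have hnpos' : (0 : ℝ) < n := by exact_mod_cast hnpos
  -- Here `T ≤ 1` enters: `N L = min 1 (N T)` is at least `t₀`, so at most `N + 1 ≤ 2 N` windows are
  -- needed.
  have hn_le : (n : ℝ) ≤ 2 * N := by
    have h1 : (n : ℝ) < t₀ / L + 1 := Nat.ceil_lt_add_one (by positivity)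
    have h2 : t₀ / L ≤ N := by
      rw [div_le_iff₀ hLpos]
      have : N * L = min 1 (N * T) := by
        rw [hL, windowLength, mul_min_of_nonneg _ _ hN.le, mul_inv_cancel₀ hN.ne']
      rw [this]
      refine le_min (ht₀.2.trans hT1) (ht₀.2.trans (le_mul_of_one_le_left hT.le hN1))
    linarith
  have hstep : t₀ / n ≤ L := by
    rw [div_le_iff₀ hnpos', mul_comm, ← div_le_iff₀ hLpos]
    exact Nat.le_ceil _
  have hLN : L ≤ 1 / N := by
    rw [one_div]; exact min_le_left _ _
  have hsupp' : ∀ k₁ k₂ k₃, m k₁ k₂ k₃ ≠ 0 → k₁ + k₂ + k₃ = 0 ∧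
      (N / 2 ≤ |((|k₁| - |k₂| : ℤ) : ℝ)| ∨ N / 2 ≤ |((|k₁| - |k₃| : ℤ) : ℝ)| ∨
        N / 2 ≤ |((|k₂| - |k₃| : ℤ) : ℝ)|) := by
    intro k₁ k₂ k₃ hne
    obtain ⟨h0, ⟨m₁, n₁⟩, ⟨m₂, n₂⟩, ⟨m₃, n₃⟩⟩ := hsupp _ _ _ hne
    refine ⟨h0, ?_⟩
    -- The frequencies must be nonzero here because block `0` also contains `k = 0`, for which the
    -- lower bound fails.
    have hq : (2 : ℤ) ^ J ≤ |k₁| ∨ (2 : ℤ) ^ J ≤ |k₂| ∨ (2 : ℤ) ^ J ≤ |k₃| := by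
      have q₁ := two_pow_le_abs_of_mem_block m₁ n₁
      have q₂ := two_pow_le_abs_of_mem_block m₂ n₂
      have q₃ := two_pow_le_abs_of_mem_block m₃ n₃
      rcases max_choice j₁ (max j₂ j₃) with h | h
      · left; rwa [hJ, h]
      · rcases max_choice j₂ j₃ with h' | h'
        · right; left; rwa [hJ, h, h']
        · right; right; rwa [hJ, h, h']
    have hcast : ∀ x y : ℤ, (2 : ℤ) ^ J ≤ 2 * |x - y| → N / 2 ≤ |((x - y : ℤ) : ℝ)| := by
      intro x y h
      have h' : (((2 : ℤ) ^ J : ℤ) : ℝ) ≤ ((2 * |x - y| : ℤ) : ℝ) := by exact_mod_cast h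
      rw [Int.cast_mul, Int.cast_abs] at h'
      push_cast at h' ⊢
      rw [hNdef]
      linarith
    exact (exists_transversal_pair h0 hq).imp (hcast _ _) (Or.imp (hcast _ _) (hcast _ _))
  set G : ℝ → ℂ := fun t => ∑ k₁ ∈ block j₁, ∑ k₂ ∈ block j₂, ∑ k₃ ∈ block j₃,
    m k₁ k₂ k₃ * (fhat (u₁ t) k₁ * fhat (u₂ t) k₂ * fhat (u₃ t) k₃) with hG
  have hcont : ∀ k₁ k₂ k₃, ContinuousOn
      (fun t => fhat (u₁ t) k₁ * fhat (u₂ t) k₂ * fhat (u₃ t) k₃) (Icc 0 T) := fun k₁ k₂ k₃ =>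
    ((hu₁ k₁).mul (hu₂ k₂)).mul (hu₃ k₃)
  have c₃ : ∀ k₁ k₂ k₃, ContinuousOn
      (fun t => m k₁ k₂ k₃ * (fhat (u₁ t) k₁ * fhat (u₂ t) k₂ * fhat (u₃ t) k₃)) (Icc 0 T) :=
    fun k₁ k₂ k₃ => continuousOn_const.mul (hcont k₁ k₂ k₃)
  have c₂ : ∀ k₁ k₂, ContinuousOn (fun t => ∑ k₃ ∈ block j₃,
      m k₁ k₂ k₃ * (fhat (u₁ t) k₁ * fhat (u₂ t) k₂ * fhat (u₃ t) k₃)) (Icc 0 T) :=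
    fun k₁ k₂ => continuousOn_finsetSum _ fun k₃ _ => c₃ k₁ k₂ k₃
  have c₁ : ∀ k₁, ContinuousOn (fun t => ∑ k₂ ∈ block j₂, ∑ k₃ ∈ block j₃,
      m k₁ k₂ k₃ * (fhat (u₁ t) k₁ * fhat (u₂ t) k₂ * fhat (u₃ t) k₃)) (Icc 0 T) :=
    fun k₁ => continuousOn_finsetSum _ fun k₂ _ => c₂ k₁ k₂
  have hGcont : ContinuousOn G (Icc 0 T) := continuousOn_finsetSum _ fun k₁ _ => c₁ k₁
  have hint : ∀ (F : ℝ → ℂ), ContinuousOn F (Icc 0 T) → ∀ x y, 0 ≤ x → x ≤ y → y ≤ T →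
      IntervalIntegrable F volume x y := by
    intro F hF x y hx hxy hy
    refine ContinuousOn.intervalIntegrable (hF.mono ?_)
    rw [uIcc_of_le hxy]
    exact Icc_subset_Icc hx hy
  have hsum : ∑ k₁ ∈ block j₁, ∑ k₂ ∈ block j₂, ∑ k₃ ∈ block j₃, m k₁ k₂ k₃ *
      (∫ t in 0..t₀, fhat (u₁ t) k₁ * fhat (u₂ t) k₂ * fhat (u₃ t) k₃) = ∫ t in 0..t₀, G t := by
    have hi := fun F hF => hint F hF 0 t₀ le_rfl ht₀.1 ht₀.2
    simp only [hG]
    rw [intervalIntegral.integral_finsetSum fun k₁ _ => hi _ (c₁ k₁)]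
    refine Finset.sum_congr rfl fun k₁ _ => ?_
    rw [intervalIntegral.integral_finsetSum fun k₂ _ => hi _ (c₂ k₁ k₂)]
    refine Finset.sum_congr rfl fun k₂ _ => ?_
    rw [intervalIntegral.integral_finsetSum fun k₃ _ => hi _ (c₃ k₁ k₂ k₃)]
    refine Finset.sum_congr rfl fun k₃ _ => ?_
    rw [intervalIntegral.integral_const_mul]
  rw [hsum]
  set p : ℕ → ℝ := fun i => i * (t₀ / n) with hp
  have hp0 : ∀ i, 0 ≤ p i := fun i => by positivity
  have hpsucc : ∀ i, p (i + 1) - p i = t₀ / n := fun i => by simp only [hp]; push_cast; ring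
  have hple : ∀ i ≤ n, p i ≤ t₀ := by
    intro i hi
    have : (i : ℝ) ≤ n := by exact_mod_cast hi
    calc p i ≤ n * (t₀ / n) := by simp only [hp]; gcongr
      _ = t₀ := by field_simp
  have hpn : p n = t₀ := by simp only [hp]; field_simp
  have hpos : 0 ≤ t₀ / n := by positivity
  have hadj := intervalIntegral.sum_integral_adjacent_intervals (μ := volume) (a := p) (n := n)
    (f := G) (fun i hi => hint G hGcont _ _ (hp0 i) (by linarith [hpsucc i])
      ((hple (i + 1) hi).trans ht₀.2))
  have hp00 : p 0 = 0 := by simp [hp]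
  rw [hpn, hp00] at hadj
  rw [← hadj]
  refine (enorm_sum_le _ _).trans ?_
  have hone : ∀ i ∈ Finset.range n, ‖∫ t in p i..p (i + 1), G t‖ₑ ≤
      3 * (ENNReal.ofReal (√(2 * sieveConst) / N) * M *
        (blockNorm T u₁ j₁ * blockNorm T u₂ j₂ * blockNorm T u₃ j₃)) := by
    intro i hi
    have hi' := Finset.mem_range.mp hi
    have hlen : p (i + 1) - p i ≤ L := by rw [hpsucc]; exact hstep
    exact enorm_intervalIntegral_trilin_le hu₁ hu₂ hu₃ hM hm hN hsupp' hF₁ hF₂ hF₃ (hp0 i)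
      (by linarith [hpsucc i]) ((hple (i + 1) hi').trans ht₀.2) (hlen.trans hLN)
      (hlen.trans (windowLength_anti T hJ₁)) (hlen.trans (windowLength_anti T hJ₂))
      (hlen.trans (windowLength_anti T hJ₃))
  refine (Finset.sum_le_sum hone).trans ?_
  rw [Finset.sum_const, Finset.card_range, nsmul_eq_mul]
  -- At most `2 N` windows, each costing three pieces of size `√(2 * sieveConst) / N`, give the 6 in
  -- `trilinConst`.
  have hconst : (n : ℝ≥0∞) * 3 * ENNReal.ofReal (√(2 * sieveConst) / N) ≤ 1 + trilinConst := by
    refine le_trans ?_ le_add_self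
    rw [← ENNReal.ofReal_natCast n, ← ENNReal.ofReal_ofNat 3, ← ENNReal.ofReal_mul (by positivity),
      ← ENNReal.ofReal_mul (by positivity)]
    refine ENNReal.ofReal_le_ofReal ?_
    calc (n : ℝ) * 3 * (√(2 * sieveConst) / N) ≤ (2 * N) * 3 * (√(2 * sieveConst) / N) := by gcongr
      _ = 6 * √(2 * sieveConst) := by field_simp; ring
  calc _ = (n : ℝ≥0∞) * 3 * ENNReal.ofReal (√(2 * sieveConst) / N) * M *
        (blockNorm T u₁ j₁ * blockNorm T u₂ j₂ * blockNorm T u₃ j₃) := by ring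
    _ ≤ _ := by gcongr

end Blocks

end BenjaminOno

namespace BenjaminOno

open AddCircle

/-! ### Fourier coefficients of functions with a smooth lift -/

lemma continuous_of_continuous_lift {f : Torus → ℝ} (hf : Continuous fun x : ℝ => f x) :
    Continuous f :=
  (QuotientAddGroup.isQuotientMap_mk (N := AddSubgroup.zmultiples (2 * π))).continuous_iff.mpr hf

lemma norm_fourier_eq_one (n : ℤ) (x : Torus) : ‖fourier n x‖ = 1 := by
  rw [fourier_apply]
  exact Circle.norm_coe _

lemma dx_coe (f : Torus → ℝ) (x : ℝ) : dx f x = deriv (fun y : ℝ => f y) x := by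
  have h := deriv_comp_const_add (f := fun y : ℝ => f y) x 0
  rw [add_zero] at h
  rw [← h, dx]
  simp only [AddCircle.coe_add]

lemma dx_of_hasDerivAt {f : Torus → ℝ} {f' x : ℝ} (h : HasDerivAt (fun y : ℝ => f y) f' x) :
    dx f x = f' := by
  rw [dx_coe, h.deriv]

lemma norm_fhat_le {f : Torus → ℝ} {D : ℝ} (hD : ∀ x, |f x| ≤ D) (k : ℤ) : ‖fhat f k‖ ≤ D := by
  rw [fhat, fourierCoeff]
  refine (norm_integral_le_of_norm_le_const (C := D) (Filter.Eventually.of_forall fun x => ?_)).trans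
    (by simp)
  rw [norm_smul, Complex.norm_real, norm_fourier_eq_one, one_mul]
  exact hD x

lemma fhat_neg (f : Torus → ℝ) (k : ℤ) : fhat f (-k) = (starRingEnd ℂ) (fhat f k) := by
  rw [fhat, fhat, fourierCoeff, fourierCoeff, ← integral_conj]
  congr 1 with x
  simp only [smul_eq_mul, map_mul, Complex.conj_ofReal]
  rw [← fourier_neg, neg_neg]

lemma fhat_sub {f g : Torus → ℝ} (hf : Continuous f) (hg : Continuous g) (k : ℤ) :
    fhat (f - g) k = fhat f k - fhat g k := by
  have hint : ∀ h : Torus → ℝ, Continuous h →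
      Integrable (fun x => fourier (-k) x • (h x : ℂ)) haarAddCircle := fun h hh =>
    (by fun_prop : Continuous fun x => fourier (-k) x • (h x : ℂ)).integrable_of_hasCompactSupport
      (HasCompactSupport.of_compactSpace _)
  simp only [fhat, fourierCoeff]
  rw [← integral_sub (hint f hf) (hint g hg)]
  congr 1 with x
  simp only [Pi.sub_apply, Complex.ofReal_sub, smul_eq_mul]
  ring

lemma fhat_dx {f : Torus → ℝ} (hf : ContDiff ℝ 1 fun x : ℝ => f x) (k : ℤ) :
    fhat (dx f) k = Complex.I * k * fhat f k := by
  have hd : ∀ x : ℝ, HasDerivAt (fun y : ℝ => ((f y : ℝ) : ℂ)) ((dx f x : ℝ) : ℂ) x := fun x => by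
    rw [dx_coe]
    exact ((hf.differentiable one_ne_zero).differentiableAt.hasDerivAt).ofReal_comp
  have hdc : Continuous fun x : ℝ => ((dx f x : ℝ) : ℂ) := by
    simp_rw [dx_coe]
    exact Complex.continuous_ofReal.comp (hf.continuous_deriv le_rfl)
  have hcd := fun x : ℝ => hasDerivAt_fourier_neg (2 * π) k x
  have h := intervalIntegral.integral_mul_deriv_eq_deriv_mul (a := 0) (b := 0 + 2 * π)
    (fun x _ => hcd x) (fun x _ => hd x)
    (Continuous.intervalIntegrable (by fun_prop) _ _) (hdc.intervalIntegrable _ _)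
  rw [fhat, fhat, fourierCoeff_eq_intervalIntegral _ k 0, fourierCoeff_eq_intervalIntegral _ k 0]
  simp only [smul_eq_mul]
  rw [h]
  have hper : ((0 + 2 * π : ℝ) : Torus) = ((0 : ℝ) : Torus) := by
    rw [AddCircle.coe_add_period]
  rw [hper, sub_self, zero_sub]
  have hπ : (π : ℂ) ≠ 0 := by exact_mod_cast Real.pi_ne_zero
  have hint : ∀ x : ℝ, -2 * π * Complex.I * k / (2 * π : ℝ) * fourier (-k) (x : Torus) * (f x : ℂ)
      = (-Complex.I * k) * (fourier (-k) (x : Torus) * (f x : ℂ)) := by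
    intro x
    push_cast
    field_simp
  simp_rw [hint]
  rw [intervalIntegral.integral_const_mul]
  simp only [Complex.real_smul]
  ring

/-- Expand the first factor in its absolutely convergent series and integrate term by term; the
second factor need only be continuous. -/
lemma hasSum_fourierCoeff_mul {c : ℤ → ℂ} (hc : Summable fun n => ‖c n‖) {g : Torus → ℂ}
    (hg : Continuous g) (k : ℤ) :
    HasSum (fun n => c n * fourierCoeff g (k - n))
      (fourierCoeff (fun x => (∑' n, c n * fourier n x) * g x) k) := by
  have hint : ∀ n, Integrable (fun x => c n * (fourier (-(k - n)) x * g x)) haarAddCircle :=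
    fun n => (by fun_prop : Continuous fun x => c n * (fourier (-(k - n)) x * g x))
      |>.integrable_of_hasCompactSupport (HasCompactSupport.of_compactSpace _)
  have hnorm : ∀ n x, ‖c n * (fourier (-(k - n)) x * g x)‖ = ‖c n‖ * ‖g x‖ := by
    intro n x
    rw [norm_mul, norm_mul, norm_fourier_eq_one, one_mul]
  have h := hasSum_integral_of_summable_integral_norm (μ := haarAddCircle)
    (F := fun n x => c n * (fourier (-(k - n)) x * g x)) hint (by
      simp_rw [hnorm, integral_const_mul]
      exact hc.mul_right _)
  have hterm : ∀ n, ∫ x, c n * (fourier (-(k - n)) x * g x) ∂haarAddCircle =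
      c n * fourierCoeff g (k - n) := fun n => integral_const_mul _ _
  have hval : ∫ x, ∑' n, c n * (fourier (-(k - n)) x * g x) ∂haarAddCircle =
      fourierCoeff (fun x => (∑' n, c n * fourier n x) * g x) k := by
    unfold fourierCoeff
    refine integral_congr_ae (Filter.Eventually.of_forall fun x => ?_)
    simp only [smul_eq_mul]
    rw [← tsum_mul_right, ← tsum_mul_left]
    refine tsum_congr fun n => ?_
    rw [show -(k - n) = -k + n by ring, fourier_add]
    ring
  rw [← hval]
  simpa only [hterm] using h

lemma fhat_expansion {f : Torus → ℝ} (hf : Continuous f) (hs : Summable fun n => ‖fhat f n‖)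
    (x : Torus) : ∑' n, fhat f n * fourier n x = f x := by
  have h := has_pointwise_sum_fourier_series_of_summable
    (f := (⟨fun x => (f x : ℂ), by fun_prop⟩ : C(Torus, ℂ))) hs.of_norm x
  exact h.tsum_eq

lemma fhat_mul {f g : Torus → ℝ} (hf : Continuous f) (hg : Continuous g)
    (hs : Summable fun n => ‖fhat f n‖) (k : ℤ) :
    HasSum (fun n => fhat f n * fhat g (k - n)) (fhat (fun x => f x * g x) k) := by
  have h := hasSum_fourierCoeff_mul hs (g := fun x => (g x : ℂ)) (by fun_prop) k
  simp_rw [fhat_expansion hf hs] at h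
  simpa only [fhat, Complex.ofReal_mul] using h

lemma fourierCoeff_hilbertTransform {f : Torus → ℝ} (hs : Summable fun n => ‖fhat f n‖) (k : ℤ) :
    fourierCoeff (hilbertTransform f) k = -Complex.I * ((Int.sign k : ℤ) : ℂ) * fhat f k := by
  have hc : Summable fun n => ‖(-Complex.I * ((Int.sign n : ℤ) : ℂ)) * fhat f n‖ := by
    refine Summable.of_nonneg_of_le (fun _ => norm_nonneg _) (fun n => ?_) hs
    rw [norm_mul, norm_mul]
    refine mul_le_of_le_one_left (norm_nonneg _) ?_
    rcases lt_trichotomy n 0 with h | h | h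
    · simp [Int.sign_eq_neg_one_of_neg h]
    · simp [h]
    · simp [Int.sign_eq_one_of_pos h]
  have h := hasSum_fourierCoeff_mul hc (g := fun _ => 1) continuous_const k
  simp only [mul_one] at h
  have h1 : ∀ n, fourierCoeff (fun _ : Torus => (1 : ℂ)) n = if n = 0 then 1 else 0 := by
    intro n
    rw [show (fun _ : Torus => (1 : ℂ)) = ⇑(fourier 0 : C(Torus, ℂ)) from
      funext fun x => fourier_zero.symm, congrFun (fourierCoeff_fourier (T := 2 * π) 0) n,
      Pi.single_apply]
  have h2 := h.unique (hasSum_single k fun n hn => by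
    rw [h1, if_neg (by omega), mul_zero])
  rw [show hilbertTransform f = fun x => ∑' n : ℤ, (-Complex.I * ((Int.sign n : ℤ) : ℂ)) *
    fhat f n * fourier n x from rfl, h2, h1, sub_self, if_pos rfl, mul_one]

/-- Two derivatives give `k² f̂(k)` bounded. This is the decay that makes all later sums over
frequencies absolutely convergent, uniformly in time. -/
lemma norm_fhat_decay {f : Torus → ℝ} (hf : ContDiff ℝ 2 fun x : ℝ => f x) {D₀ D₂ : ℝ}
    (h₀ : ∀ x, |f x| ≤ D₀) (h₂ : ∀ x, |dx (dx f) x| ≤ D₂) (k : ℤ) :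
    ‖fhat f k‖ ≤ (D₀ + D₂) * (1 / (1 + (k : ℝ) ^ 2)) := by
  have hf1 : ContDiff ℝ 1 fun x : ℝ => dx f x := by
    simp_rw [dx_coe]
    exact ((contDiff_succ_iff_deriv (n := 1)).mp hf).2.2
  have h := norm_fhat_le h₂ k
  rw [fhat_dx hf1, fhat_dx (hf.of_le (by norm_num)), ← mul_assoc, norm_mul] at h
  have hk : ‖Complex.I * k * (Complex.I * k)‖ = (k : ℝ) ^ 2 := by
    simp [sq]
  rw [hk] at h
  rw [mul_one_div, le_div_iff₀ (by positivity)]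
  linarith [norm_fhat_le h₀ k]

/-- The nonlinearity in divergence form, `u ∂ₓ u = ½ ∂ₓ(u²)`. -/
lemma fhat_mul_dx {f : Torus → ℝ} (hf : ContDiff ℝ 1 fun x : ℝ => f x) (k : ℤ) :
    fhat (fun x => f x * dx f x) k = Complex.I * k / 2 * fhat (fun x => f x * f x) k := by
  have hsq : ContDiff ℝ 1 fun x : ℝ => f x * f x := hf.mul hf
  have h := fhat_dx (f := fun x => f x * f x) hsq k
  have hdx : dx (fun x => f x * f x) = fun x => 2 * (f x * dx f x) := by
    ext x
    induction x using QuotientAddGroup.induction_on with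
    | H x =>
      have hd := ((hf.differentiable one_ne_zero).differentiableAt (x := x)).hasDerivAt
      rw [dx_of_hasDerivAt (hd.mul hd), dx_coe]
      ring
  have h2 : fhat (fun x => 2 * (f x * dx f x)) k = 2 * fhat (fun x => f x * dx f x) k := by
    simp only [fhat]
    rw [← fourierCoeff.const_mul]
    simp
  rw [hdx, h2] at h
  linear_combination h / 2

end BenjaminOno

namespace BenjaminOno

open AddCircle

/-! ### Smooth solutions on the Fourier side -/

section Slab

variable {T : ℝ}

lemma uniqueDiffOn_slab (hT : 0 < T) : UniqueDiffOn ℝ (Icc 0 T ×ˢ (univ : Set ℝ)) :=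
  (uniqueDiffOn_Icc hT).prod uniqueDiffOn_univ

lemma contDiffOn_partial (hT : 0 < T) {U : ℝ × ℝ → ℝ}
    (hU : ContDiffOn ℝ ((⊤ : ℕ∞) : WithTop ℕ∞) U (Icc 0 T ×ˢ univ)) (v : ℝ × ℝ) :
    ContDiffOn ℝ ((⊤ : ℕ∞) : WithTop ℕ∞)
      (fun p => fderivWithin ℝ U (Icc 0 T ×ˢ univ) p v) (Icc 0 T ×ˢ univ) :=
  (hU.fderivWithin (uniqueDiffOn_slab hT) (by simp)).clm_apply contDiffOn_const

lemma hasDerivAt_partial_space {U : ℝ × ℝ → ℝ}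
    (hU : ContDiffOn ℝ ((⊤ : ℕ∞) : WithTop ℕ∞) U (Icc 0 T ×ˢ univ)) {t : ℝ} (ht : t ∈ Icc 0 T)
    (x : ℝ) :
    HasDerivAt (fun y => U (t, y)) (fderivWithin ℝ U (Icc 0 T ×ˢ univ) (t, x) (0, 1)) x := by
  have h := (hU.differentiableOn (by simp) (t, x) ⟨ht, mem_univ _⟩).hasFDerivWithinAt
  have hl : HasDerivWithinAt (fun y : ℝ => (t, y)) ((0 : ℝ), (1 : ℝ)) univ x :=
    ((hasDerivAt_const x t).prodMk (hasDerivAt_id x)).hasDerivWithinAt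
  exact hasDerivWithinAt_univ.mp
    (h.comp_hasDerivWithinAt x hl fun y _ => ⟨ht, mem_univ _⟩)

lemma hasDerivAt_partial_time {U : ℝ × ℝ → ℝ}
    (hU : ContDiffOn ℝ ((⊤ : ℕ∞) : WithTop ℕ∞) U (Icc 0 T ×ˢ univ)) {t : ℝ} (ht : t ∈ Ioo 0 T)
    (x : ℝ) :
    HasDerivAt (fun τ => U (τ, x)) (fderivWithin ℝ U (Icc 0 T ×ˢ univ) (t, x) (1, 0)) t := by
  have h := (hU.differentiableOn (by simp) (t, x)
    ⟨Ioo_subset_Icc_self ht, mem_univ _⟩).hasFDerivWithinAt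
  have hl : HasDerivWithinAt (fun τ : ℝ => (τ, x)) ((1 : ℝ), (0 : ℝ)) (Icc 0 T) t :=
    ((hasDerivAt_id t).prodMk (hasDerivAt_const t x)).hasDerivWithinAt
  have hmaps : MapsTo (fun τ : ℝ => (τ, x)) (Icc 0 T) (Icc 0 T ×ˢ univ) :=
    fun _ hy => ⟨hy, mem_univ _⟩
  have h' : HasDerivWithinAt (fun τ => U (τ, x))
      (fderivWithin ℝ U (Icc 0 T ×ˢ univ) (t, x) (1, 0)) (Icc 0 T) t :=
    h.comp_hasDerivWithinAt t hl hmaps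
  exact h'.hasDerivAt (Icc_mem_nhds ht.1 ht.2)

lemma exists_bound_of_continuousOn_slab {w : ℝ → Torus → ℝ}
    (hw : ContinuousOn (fun p : ℝ × ℝ => w p.1 (p.2 : Torus)) (Icc 0 T ×ˢ univ)) :
    ∃ D, ∀ t ∈ Icc 0 T, ∀ x, |w t x| ≤ D := by
  obtain ⟨D, hD⟩ := (isCompact_Icc.prod (isCompact_Icc (a := (0 : ℝ)) (b := 2 * π))).exists_bound_of_continuousOn
    (hw.mono (prod_mono (Subset.refl (Icc 0 T)) (subset_univ _)))
  refine ⟨D, fun t ht x => ?_⟩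
  obtain ⟨y, hy, rfl⟩ : ∃ y ∈ Ico 0 (0 + 2 * π), (y : Torus) = x := by
    have := AddCircle.coe_image_Ico_eq (2 * π) 0
    have hx : x ∈ (univ : Set Torus) := mem_univ x
    rw [← this] at hx
    exact hx
  rw [zero_add] at hy
  exact hD (t, y) ⟨ht, Ico_subset_Icc_self hy⟩

end Slab

/-- Fourier coefficients of a real function with vanishing mean, with continuous dependence on
time and uniform quadratic decay. -/
structure RegularCoeffs (T : ℝ) (a : ℝ → ℤ → ℂ) : Prop where
  continuousOn : ∀ k, ContinuousOn (fun t => a t k) (Icc 0 T)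
  decay : ∃ D, 0 ≤ D ∧ ∀ t ∈ Icc 0 T, ∀ k : ℤ, ‖a t k‖ ≤ D * (1 / (1 + (k : ℝ) ^ 2))
  conj : ∀ t k, a t (-k) = (starRingEnd ℂ) (a t k)
  zero : ∀ t ∈ Icc 0 T, a t 0 = 0

namespace IsSmoothSolution

variable {T : ℝ} {u : ℝ → Torus → ℝ}

lemma contDiff_lift (hu : IsSmoothSolution T u) {t : ℝ} (ht : t ∈ Icc 0 T) :
    ContDiff ℝ ((⊤ : ℕ∞) : WithTop ℕ∞) fun x : ℝ => u t x :=
  contDiffOn_univ.mp (hu.smooth.comp (contDiff_const.prodMk contDiff_id).contDiffOn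
    fun _ _ => ⟨ht, mem_univ _⟩)

lemma continuous_slice (hu : IsSmoothSolution T u) {t : ℝ} (ht : t ∈ Icc 0 T) :
    Continuous (u t) :=
  continuous_of_continuous_lift (hu.contDiff_lift ht).continuous

lemma contDiffOn_dx (hT : 0 < T) {w : ℝ → Torus → ℝ}
    (hw : ContDiffOn ℝ ((⊤ : ℕ∞) : WithTop ℕ∞) (fun p : ℝ × ℝ => w p.1 (p.2 : Torus))
      (Icc 0 T ×ˢ univ)) :
    ContDiffOn ℝ ((⊤ : ℕ∞) : WithTop ℕ∞) (fun p : ℝ × ℝ => dx (w p.1) (p.2 : Torus))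
      (Icc 0 T ×ˢ univ) :=
  (contDiffOn_partial hT hw (0, 1)).congr fun p hp =>
    dx_of_hasDerivAt (hasDerivAt_partial_space hw hp.1 p.2)

lemma exists_decay (hT : 0 < T) (hu : IsSmoothSolution T u) :
    ∃ D, 0 ≤ D ∧ ∀ t ∈ Icc 0 T, ∀ k : ℤ, ‖fhat (u t) k‖ ≤ D * (1 / (1 + (k : ℝ) ^ 2)) := by
  obtain ⟨D₀, h₀⟩ := exists_bound_of_continuousOn_slab hu.smooth.continuousOn
  obtain ⟨D₂, h₂⟩ := exists_bound_of_continuousOn_slab (w := fun t => dx (dx (u t)))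
    (contDiffOn_dx (w := fun t => dx (u t)) hT (contDiffOn_dx hT hu.smooth)).continuousOn
  have h0 : (0 : ℝ) ∈ Icc 0 T := ⟨le_rfl, hT.le⟩
  refine ⟨D₀ + D₂, add_nonneg ((abs_nonneg _).trans (h₀ 0 h0 0))
    ((abs_nonneg _).trans (h₂ 0 h0 0)), fun t ht k => ?_⟩
  exact norm_fhat_decay (contDiff_infty.mp (hu.contDiff_lift ht) 2) (h₀ t ht) (h₂ t ht) k

lemma summable_fhat (hT : 0 < T) (hu : IsSmoothSolution T u) {t : ℝ} (ht : t ∈ Icc 0 T) :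
    Summable fun n => ‖fhat (u t) n‖ := by
  obtain ⟨D, -, hD⟩ := hu.exists_decay hT
  exact Summable.of_nonneg_of_le (fun _ => norm_nonneg _) (hD t ht)
    (summable_one_div_one_add_sq.mul_left D)

lemma continuousOn_fhat (hu : IsSmoothSolution T u) (k : ℤ) :
    ContinuousOn (fun t => fhat (u t) k) (Icc 0 T) := by
  obtain ⟨D₀, h₀⟩ := exists_bound_of_continuousOn_slab hu.smooth.continuousOn
  unfold fhat fourierCoeff
  refine continuousOn_of_dominated (bound := fun _ => D₀) (fun t ht => ?_) (fun t ht => ?_)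
    (integrable_const _) ?_
  · have := hu.continuous_slice ht
    exact Continuous.aestronglyMeasurable (by fun_prop)
  · refine Filter.Eventually.of_forall fun x => ?_
    rw [norm_smul, Complex.norm_real, norm_fourier_eq_one, one_mul]
    exact h₀ t ht x
  · refine Filter.Eventually.of_forall fun x => ?_
    induction x using QuotientAddGroup.induction_on with
    | H x =>
      have h1 : ContinuousOn (fun t => u t (x : Torus)) (Icc 0 T) :=
        hu.smooth.continuousOn.comp (f := fun t : ℝ => (t, x)) (by fun_prop)
          fun t ht => ⟨ht, mem_univ _⟩
      simp only [smul_eq_mul]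
      exact continuousOn_const.mul (Complex.continuous_ofReal.comp_continuousOn h1)

/-- Differentiation under the integral sign. The dominating constant exists because `∂ₜ u` extends
continuously to the closed slab, one period of which is compact. -/
lemma hasDerivAt_fhat_integral (hT : 0 < T) (hu : IsSmoothSolution T u) {t : ℝ} (ht : t ∈ Ioo 0 T)
    (k : ℤ) : HasDerivAt (fun τ => fhat (u τ) k)
      (fourierCoeff (fun x => ((deriv (fun τ => u τ x) t : ℝ) : ℂ)) k) t := by
  set V : ℝ × ℝ → ℝ := fun p =>
    fderivWithin ℝ (fun p : ℝ × ℝ => u p.1 (p.2 : Torus)) (Icc 0 T ×ˢ univ) p (1, 0) with hV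
  have hVc : ContinuousOn V (Icc 0 T ×ˢ univ) := (contDiffOn_partial hT hu.smooth (1, 0)).continuousOn
  have hder : ∀ τ ∈ Ioo 0 T, ∀ x : ℝ, HasDerivAt (fun τ => u τ (x : Torus)) (V (τ, x)) τ :=
    fun τ hτ x => hasDerivAt_partial_time hu.smooth hτ x
  have hderT : ∀ τ ∈ Ioo 0 T, ∀ x : Torus,
      HasDerivAt (fun τ => u τ x) (deriv (fun τ => u τ x) τ) τ := by
    intro τ hτ x
    induction x using QuotientAddGroup.induction_on with
    | H x => exact (hder τ hτ x).differentiableAt.hasDerivAt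
  have hVbound : ∃ D, ∀ τ ∈ Ioo 0 T, ∀ x : Torus, |deriv (fun τ => u τ x) τ| ≤ D := by
    obtain ⟨D, hD⟩ := (isCompact_Icc.prod
      (isCompact_Icc (a := (0 : ℝ)) (b := 2 * π))).exists_bound_of_continuousOn
      (hVc.mono (prod_mono (Subset.refl (Icc 0 T)) (subset_univ _)))
    refine ⟨D, fun τ hτ x => ?_⟩
    obtain ⟨y, hy, rfl⟩ : ∃ y ∈ Ico 0 (0 + 2 * π), (y : Torus) = x := by
      have hx : x ∈ (univ : Set Torus) := mem_univ x
      rw [← AddCircle.coe_image_Ico_eq (2 * π) 0] at hx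
      exact hx
    rw [zero_add] at hy
    rw [(hder τ hτ y).deriv]
    exact hD (τ, y) ⟨Ioo_subset_Icc_self hτ, Ico_subset_Icc_self hy⟩
  obtain ⟨D, hD⟩ := hVbound
  have hcont : Continuous fun x : Torus => deriv (fun τ => u τ x) t := by
    refine continuous_of_continuous_lift ?_
    simp_rw [fun x : ℝ => (hder t ht x).deriv]
    exact continuousOn_univ.mp (hVc.comp (f := fun x : ℝ => (t, x)) (by fun_prop)
      fun x _ => ⟨Ioo_subset_Icc_self ht, mem_univ _⟩)
  have hslice := hu.continuous_slice (Ioo_subset_Icc_self ht)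
  have h := hasDerivAt_integral_of_dominated_loc_of_deriv_le (μ := haarAddCircle (T := 2 * π))
    (F := fun τ x => fourier (-k) x • ((u τ x : ℝ) : ℂ))
    (F' := fun τ x => fourier (-k) x • ((deriv (fun τ => u τ x) τ : ℝ) : ℂ))
    (x₀ := t) (s := Ioo 0 T) (bound := fun _ => D) (Ioo_mem_nhds ht.1 ht.2)
    (Filter.eventually_of_mem (Ioo_mem_nhds ht.1 ht.2) fun τ hτ => by
      have := hu.continuous_slice (Ioo_subset_Icc_self hτ)
      exact Continuous.aestronglyMeasurable (by fun_prop))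
    ((by fun_prop : Continuous fun x => fourier (-k) x • ((u t x : ℝ) : ℂ))
      |>.integrable_of_hasCompactSupport (HasCompactSupport.of_compactSpace _))
    (Continuous.aestronglyMeasurable (by fun_prop))
    (Filter.Eventually.of_forall fun x τ hτ => by
      rw [norm_smul, Complex.norm_real, norm_fourier_eq_one, one_mul]
      exact hD τ hτ x)
    (integrable_const _)
    (Filter.Eventually.of_forall fun x τ hτ => by
      simpa only [smul_eq_mul] using ((hderT τ hτ x).ofReal_comp).const_mul _)
  exact h.2

lemma hasDerivAt_fhat (hT : 0 < T) (hu : IsSmoothSolution T u) {t : ℝ} (ht : t ∈ Ioo 0 T)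
    (k : ℤ) : HasDerivAt (fun τ => fhat (u τ) k)
      (-(Complex.I * ((k * |k| : ℤ) : ℂ)) * fhat (u t) k +
        Complex.I * k / 2 * ∑' n, fhat (u t) n * fhat (u t) (k - n)) t := by
  have ht' := Ioo_subset_Icc_self ht
  have hslice := hu.continuous_slice ht'
  have hC := hu.contDiff_lift ht'
  have hC1 : ContDiff ℝ 1 fun x : ℝ => u t x := hC.of_le (by exact_mod_cast le_top)
  have hdx : ContDiff ℝ ((⊤ : ℕ∞) : WithTop ℕ∞) fun x : ℝ => dx (u t) x := by
    simp_rw [dx_coe]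
    exact (contDiff_infty_iff_deriv.mp hC).2
  have hdx1 : ContDiff ℝ 1 fun x : ℝ => dx (u t) x := hdx.of_le (by exact_mod_cast le_top)
  have hdxdx : ContDiff ℝ ((⊤ : ℕ∞) : WithTop ℕ∞) fun x : ℝ => dx (dx (u t)) x := by
    simp_rw [dx_coe (dx (u t))]
    exact (contDiff_infty_iff_deriv.mp hdx).2
  have hdxc : Continuous (dx (u t)) := continuous_of_continuous_lift hdx.continuous
  convert hu.hasDerivAt_fhat_integral hT ht k using 1
  have hcoef2 : ∀ n, fhat (dx (dx (u t))) n = -(n : ℂ) ^ 2 * fhat (u t) n := by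
    intro n
    rw [fhat_dx hdx1, fhat_dx hC1]
    linear_combination (n : ℂ) ^ 2 * fhat (u t) n * Complex.I_sq
  -- The series defining the Hilbert transform of `∂ₓₓ u` converges absolutely because `∂ₓₓ u`
  -- itself has two bounded derivatives.
  have hsum2 : Summable fun n => ‖fhat (dx (dx (u t))) n‖ := by
    have hdd1 : ContDiff ℝ 2 fun x : ℝ => dx (dx (u t)) x :=
      contDiff_infty.mp hdxdx 2
    have hb : ∀ f : Torus → ℝ, Continuous f → ∃ D, ∀ x, |f x| ≤ D := by
      intro f hf
      obtain ⟨D, hD⟩ := (isCompact_univ (X := Torus)).exists_bound_of_continuousOn hf.continuousOn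
      exact ⟨D, fun x => hD x (mem_univ x)⟩
    obtain ⟨D₀, h₀⟩ := hb _ (continuous_of_continuous_lift hdxdx.continuous)
    have h4 : ContDiff ℝ 0 fun x : ℝ => dx (dx (dx (dx (u t)))) x := by
      have h3 : ContDiff ℝ 1 fun x : ℝ => dx (dx (dx (u t))) x := by
        simp_rw [dx_coe (dx (dx (u t)))]
        exact ((contDiff_succ_iff_deriv (n := 1)).mp hdd1).2.2
      simp_rw [dx_coe (dx (dx (dx (u t))))]
      exact ((contDiff_succ_iff_deriv (n := 0)).mp h3).2.2
    obtain ⟨D₂, h₂⟩ := hb _ (continuous_of_continuous_lift h4.continuous)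
    exact Summable.of_nonneg_of_le (fun _ => norm_nonneg _) (norm_fhat_decay hdd1 h₀ h₂)
      (summable_one_div_one_add_sq.mul_left _)
  have hH : Continuous (hilbertTransform (dx (dx (u t)))) := by
    unfold hilbertTransform
    refine continuous_tsum (u := fun n => ‖fhat (dx (dx (u t))) n‖) (fun n => by fun_prop) hsum2
      fun n x => ?_
    rw [norm_mul, norm_fourier_eq_one, mul_one, norm_mul, norm_mul]
    refine mul_le_of_le_one_left (norm_nonneg _) ?_
    rcases lt_trichotomy n 0 with h | h | h
    · simp [Int.sign_eq_neg_one_of_neg h]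
    · simp [h]
    · simp [Int.sign_eq_one_of_pos h]
  have hint : ∀ {f : Torus → ℂ}, Continuous f → Integrable f haarAddCircle := fun hf =>
    hf.integrable_of_hasCompactSupport (HasCompactSupport.of_compactSpace _)
  have hEq : (fun x => ((deriv (fun τ => u τ x) t : ℝ) : ℂ)) =
      (fun x => ((u t x * dx (u t) x : ℝ) : ℂ)) +
        fun x => (-1 : ℂ) * hilbertTransform (dx (dx (u t))) x := by
    ext x
    simp only [Pi.add_apply]
    rw [← hu.equation t ht x]
    ring
  have hsgn : ((Int.sign k : ℤ) : ℂ) * (k : ℂ) ^ 2 = ((k * |k| : ℤ) : ℂ) := by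
    have : Int.sign k * k ^ 2 = k * |k| := by
      rw [sq, ← mul_assoc, Int.sign_mul_self_eq_abs, mul_comm]
    exact_mod_cast this
  have hHi : Integrable (fun x => (-1 : ℂ) * hilbertTransform (dx (dx (u t))) x) haarAddCircle :=
    hint (continuous_const.mul hH)
  rw [hEq, fourierCoeff.add (hint (by fun_prop)) hHi, Pi.add_apply,
    fourierCoeff.const_mul, fourierCoeff_hilbertTransform hsum2, hcoef2]
  have hprod : fourierCoeff (fun x => ((u t x * dx (u t) x : ℝ) : ℂ)) k =
      fhat (fun x => u t x * dx (u t) x) k := rfl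
  rw [hprod, fhat_mul_dx hC1,
    ← (fhat_mul hslice hslice (hu.summable_fhat hT ht') k).tsum_eq, ← hsgn]
  ring

/-- Both terms of the derivative carry a factor `k`, so the mean is conserved; continuity reaches
the endpoints of `[0, T]`. -/
lemma fhat_zero (hT : 0 < T) (hu : IsSmoothSolution T u) {t : ℝ} (ht : t ∈ Icc 0 T) :
    fhat (u t) 0 = 0 := by
  have h0 : fhat (u 0) 0 = 0 := by
    rw [fhat, fourierCoeff]
    simp only [neg_zero, fourier_zero, one_smul]
    rw [integral_complex_ofReal, hu.mean_zero, Complex.ofReal_zero]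
  have h := intervalIntegral.integral_eq_sub_of_hasDerivAt_of_le ht.1
    ((hu.continuousOn_fhat 0).mono (Icc_subset_Icc le_rfl ht.2))
    (f' := fun _ => (0 : ℂ)) (fun τ hτ => by
      simpa using hu.hasDerivAt_fhat hT ⟨hτ.1, hτ.2.trans_le ht.2⟩ 0) (by simp)
  simpa [h0, eq_comm] using h

theorem regularCoeffs (hT : 0 < T) (hu : IsSmoothSolution T u) :
    RegularCoeffs T fun t => fhat (u t) where
  continuousOn := hu.continuousOn_fhat
  decay := hu.exists_decay hT
  conj _ _ := fhat_neg _ _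
  zero _ ht := hu.fhat_zero hT ht

end IsSmoothSolution

end BenjaminOno

namespace BenjaminOno

/-! ### The energy identity -/

/-- The time integral of a product of three Fourier coefficients whose frequencies sum to zero. -/
noncomputable def triInt (a b c : ℝ → ℤ → ℂ) (t₀ : ℝ) (p : ℤ × ℤ) : ℂ :=
  ∫ t in 0..t₀, a t p.1 * b t p.2 * c t (-p.1 - p.2)

section TriInt

variable {T : ℝ} {a b c d : ℝ → ℤ → ℂ} {t₀ : ℝ}

lemma RegularCoeffs.intervalIntegrable (ha : RegularCoeffs T a) (hb : RegularCoeffs T b)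
    (hc : RegularCoeffs T c) (ht₀ : t₀ ∈ Icc 0 T) (k l m : ℤ) :
    IntervalIntegrable (fun t => a t k * b t l * c t m) volume 0 t₀ := by
  refine ContinuousOn.intervalIntegrable ?_
  rw [uIcc_of_le ht₀.1]
  exact (((ha.continuousOn k).mul (hb.continuousOn l)).mul (hc.continuousOn m)).mono
    (Icc_subset_Icc le_rfl ht₀.2)

lemma RegularCoeffs.sub (ha : RegularCoeffs T a) (hb : RegularCoeffs T b) :
    RegularCoeffs T fun t k => a t k - b t k where
  continuousOn k := (ha.continuousOn k).sub (hb.continuousOn k)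
  decay := by
    obtain ⟨D, hD0, hD⟩ := ha.decay
    obtain ⟨D', hD0', hD'⟩ := hb.decay
    refine ⟨D + D', add_nonneg hD0 hD0', fun t ht k => ?_⟩
    rw [add_mul]
    exact (norm_sub_le _ _).trans (add_le_add (hD t ht k) (hD' t ht k))
  conj t k := by rw [ha.conj, hb.conj, map_sub]
  zero t ht := by rw [ha.zero t ht, hb.zero t ht, sub_zero]

lemma RegularCoeffs.add (ha : RegularCoeffs T a) (hb : RegularCoeffs T b) :
    RegularCoeffs T fun t k => a t k + b t k where
  continuousOn k := (ha.continuousOn k).add (hb.continuousOn k)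
  decay := by
    obtain ⟨D, hD0, hD⟩ := ha.decay
    obtain ⟨D', hD0', hD'⟩ := hb.decay
    refine ⟨D + D', add_nonneg hD0 hD0', fun t ht k => ?_⟩
    rw [add_mul]
    exact (norm_add_le _ _).trans (add_le_add (hD t ht k) (hD' t ht k))
  conj t k := by rw [ha.conj, hb.conj, map_add]
  zero t ht := by rw [ha.zero t ht, hb.zero t ht, add_zero]

lemma triInt_add (ha : RegularCoeffs T a) (hb : RegularCoeffs T b) (hc : RegularCoeffs T c)
    (hd : RegularCoeffs T d) (ht₀ : t₀ ∈ Icc 0 T) (p : ℤ × ℤ) :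
    triInt a b (fun t k => c t k + d t k) t₀ p = triInt a b c t₀ p + triInt a b d t₀ p := by
  unfold triInt
  rw [← intervalIntegral.integral_add (ha.intervalIntegrable hb hc ht₀ _ _ _)
    (ha.intervalIntegrable hb hd ht₀ _ _ _)]
  simp only [mul_add]

lemma triInt_swap (p : ℤ × ℤ) : triInt a a c t₀ p.swap = triInt a a c t₀ p := by
  unfold triInt
  refine intervalIntegral.integral_congr fun t _ => ?_
  simp only [Prod.fst_swap, Prod.snd_swap]
  rw [show -p.2 - p.1 = -p.1 - p.2 by ring]
  ring

/-- Exchange of the first and third frequencies, legitimate because the same function occupies both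
slots. -/
lemma triInt_reflect (p : ℤ × ℤ) : triInt a b a t₀ (-p.1 - p.2, p.2) = triInt a b a t₀ p := by
  unfold triInt
  refine intervalIntegral.integral_congr fun t _ => ?_
  simp only
  rw [show -(-p.1 - p.2) - p.2 = p.1 by ring]
  ring

lemma triInt_eq_zero (ha : RegularCoeffs T a) (hb : RegularCoeffs T b) (hc : RegularCoeffs T c)
    (ht₀ : t₀ ∈ Icc 0 T) {p : ℤ × ℤ} (hp : p.1 = 0 ∨ p.2 = 0 ∨ -p.1 - p.2 = 0) :
    triInt a b c t₀ p = 0 := by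
  unfold triInt
  rw [intervalIntegral.integral_congr (g := fun _ => 0), intervalIntegral.integral_zero]
  intro t ht
  rw [uIcc_of_le ht₀.1] at ht
  have ht' : t ∈ Icc 0 T := ⟨ht.1, ht.2.trans ht₀.2⟩
  simp only
  rcases hp with h | h | h
  · rw [h, ha.zero t ht']; ring
  · rw [h, hb.zero t ht']; ring
  · rw [h, hc.zero t ht']; ring

lemma RegularCoeffs.exists_bound (ha : RegularCoeffs T a) :
    ∃ D, 0 ≤ D ∧ ∀ t ∈ Icc 0 T, ∀ k, ‖a t k‖ ≤ D := by
  obtain ⟨D, hD0, hD⟩ := ha.decay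
  refine ⟨D, hD0, fun t ht k => (hD t ht k).trans (mul_le_of_le_one_right hD0 ?_)⟩
  rw [div_le_one (by positivity)]
  nlinarith [sq_nonneg (k : ℝ)]

/-- Only two of the three frequencies are free, so decay in two of them suffices for summability
over `ℤ × ℤ`; the third factor is merely bounded. -/
lemma exists_triInt_bound (ha : RegularCoeffs T a) (hb : RegularCoeffs T b)
    (hc : RegularCoeffs T c) : ∃ D, 0 ≤ D ∧ ∀ t ∈ Icc 0 T, ∀ k l m : ℤ,
      ‖a t k * b t l * c t m‖ ≤ D * ((1 / (1 + (k : ℝ) ^ 2)) * (1 / (1 + (l : ℝ) ^ 2))) := by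
  obtain ⟨A, hA0, hA⟩ := ha.decay
  obtain ⟨B, hB0, hB⟩ := hb.decay
  obtain ⟨C, hC0, hC⟩ := hc.exists_bound
  refine ⟨A * B * C, by positivity, fun t ht k l m => ?_⟩
  rw [norm_mul, norm_mul]
  calc ‖a t k‖ * ‖b t l‖ * ‖c t m‖
      ≤ (A * (1 / (1 + (k : ℝ) ^ 2))) * (B * (1 / (1 + (l : ℝ) ^ 2))) * C := by
        gcongr
        · exact hA t ht k
        · exact hB t ht l
        · exact hC t ht m
    _ = _ := by ring

lemma summable_decay_prod : Summable fun p : ℤ × ℤ =>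
    (1 / (1 + (p.1 : ℝ) ^ 2)) * (1 / (1 + (p.2 : ℝ) ^ 2)) :=
  summable_one_div_one_add_sq.mul_of_nonneg summable_one_div_one_add_sq
    (fun _ => by positivity) fun _ => by positivity

lemma summable_mul_triInt (ha : RegularCoeffs T a) (hb : RegularCoeffs T b)
    (hc : RegularCoeffs T c) (ht₀ : t₀ ∈ Icc 0 T) {m : ℤ × ℤ → ℂ} {P : ℝ}
    (hm : ∀ p, ‖m p‖ ≤ P) : Summable fun p => m p * triInt a b c t₀ p := by
  obtain ⟨D, hD0, hD⟩ := exists_triInt_bound ha hb hc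
  have hP : 0 ≤ P := (norm_nonneg _).trans (hm 0)
  refine Summable.of_norm_bounded (summable_decay_prod.mul_left (P * (D * T))) fun p => ?_
  have h : ‖triInt a b c t₀ p‖ ≤
      (D * ((1 / (1 + (p.1 : ℝ) ^ 2)) * (1 / (1 + (p.2 : ℝ) ^ 2)))) * |t₀ - 0| := by
    refine intervalIntegral.norm_integral_le_of_norm_le_const fun t ht => ?_
    rw [uIoc_of_le ht₀.1] at ht
    exact hD t ⟨ht.1.le, ht.2.trans ht₀.2⟩ _ _ _
  rw [sub_zero, abs_of_nonneg ht₀.1] at h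
  rw [norm_mul]
  have h0 : 0 ≤ (1 / (1 + (p.1 : ℝ) ^ 2)) * (1 / (1 + (p.2 : ℝ) ^ 2)) := by positivity
  calc ‖m p‖ * ‖triInt a b c t₀ p‖
      ≤ P * ((D * ((1 / (1 + (p.1 : ℝ) ^ 2)) * (1 / (1 + (p.2 : ℝ) ^ 2)))) * T) := by
        gcongr
        · exact hm p
        · refine h.trans ?_
          gcongr
          exact ht₀.2
    _ = _ := by ring

/-- Symmetrization in the first two frequencies. -/
lemma tsum_mul_triInt_symm (ha : RegularCoeffs T a) (hc : RegularCoeffs T c)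
    (ht₀ : t₀ ∈ Icc 0 T) {ψ : ℤ → ℝ} {P : ℝ} (hψ : ∀ k, |ψ k| ≤ P) :
    ∑' p : ℤ × ℤ, ((ψ p.1 : ℝ) : ℂ) * triInt a a c t₀ p =
      ∑' p : ℤ × ℤ, (((ψ p.1 + ψ p.2) / 2 : ℝ) : ℂ) * triInt a a c t₀ p := by
  have hs₁ := summable_mul_triInt ha ha hc ht₀ (m := fun p => ((ψ p.1 : ℝ) : ℂ)) (P := P)
    fun p => by rw [Complex.norm_real]; exact hψ _
  have hs₂ := summable_mul_triInt ha ha hc ht₀ (m := fun p => ((ψ p.2 : ℝ) : ℂ)) (P := P)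
    fun p => by rw [Complex.norm_real]; exact hψ _
  have h2 : ∑' p : ℤ × ℤ, ((ψ p.1 : ℝ) : ℂ) * triInt a a c t₀ p =
      ∑' p : ℤ × ℤ, ((ψ p.2 : ℝ) : ℂ) * triInt a a c t₀ p := by
    rw [← (Equiv.prodComm ℤ ℤ).tsum_eq]
    refine tsum_congr fun p => ?_
    rw [Equiv.prodComm_apply, triInt_swap, Prod.fst_swap]
  have h3 : ∑' p : ℤ × ℤ, (((ψ p.1 + ψ p.2) / 2 : ℝ) : ℂ) * triInt a a c t₀ p =
      (1 / 2 : ℂ) * (∑' p : ℤ × ℤ, ((ψ p.1 : ℝ) : ℂ) * triInt a a c t₀ p +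
        ∑' p : ℤ × ℤ, ((ψ p.2 : ℝ) : ℂ) * triInt a a c t₀ p) := by
    rw [← hs₁.tsum_add hs₂, ← tsum_mul_left]
    refine tsum_congr fun p => ?_
    push_cast
    ring
  rw [h3, ← h2]
  ring

/-- Symmetrization in all three frequencies. -/
lemma tsum_mul_triInt_symm₃ (ha : RegularCoeffs T a) (ht₀ : t₀ ∈ Icc 0 T) {ψ : ℤ → ℝ} {P : ℝ}
    (hψ : ∀ k, |ψ k| ≤ P) :
    ∑' p : ℤ × ℤ, ((ψ p.1 : ℝ) : ℂ) * triInt a a a t₀ p =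
      ∑' p : ℤ × ℤ, (((ψ p.1 + ψ p.2 + ψ (-p.1 - p.2)) / 3 : ℝ) : ℂ) * triInt a a a t₀ p := by
  have hs₁ := summable_mul_triInt ha ha ha ht₀ (m := fun p => ((ψ p.1 : ℝ) : ℂ)) (P := P)
    fun p => by rw [Complex.norm_real]; exact hψ _
  have hs₂ := summable_mul_triInt ha ha ha ht₀ (m := fun p => (((ψ p.1 + ψ p.2) / 2 : ℝ) : ℂ))
    (P := P) fun p => by
      rw [Complex.norm_real, Real.norm_eq_abs, abs_le]
      have h1 := abs_le.mp (hψ p.1)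
      have h2 := abs_le.mp (hψ p.2)
      constructor <;> linarith [h1.1, h1.2, h2.1, h2.2]
  have hs₃ := summable_mul_triInt ha ha ha ht₀ (m := fun p => ((ψ (-p.1 - p.2) : ℝ) : ℂ)) (P := P)
    fun p => by rw [Complex.norm_real]; exact hψ _
  set e : ℤ × ℤ ≃ ℤ × ℤ := ⟨fun p => (-p.1 - p.2, p.2), fun p => (-p.1 - p.2, p.2),
    fun p => by ext <;> simp, fun p => by ext <;> simp⟩ with he
  have h2 : ∑' p : ℤ × ℤ, ((ψ p.1 : ℝ) : ℂ) * triInt a a a t₀ p =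
      ∑' p : ℤ × ℤ, ((ψ (-p.1 - p.2) : ℝ) : ℂ) * triInt a a a t₀ p := by
    rw [← e.tsum_eq]
    refine tsum_congr fun p => ?_
    simp only [he, Equiv.coe_fn_mk]
    rw [triInt_reflect]
  have h3 : ∑' p : ℤ × ℤ, (((ψ p.1 + ψ p.2 + ψ (-p.1 - p.2)) / 3 : ℝ) : ℂ) * triInt a a a t₀ p =
      (2 / 3 : ℂ) * ∑' p : ℤ × ℤ, (((ψ p.1 + ψ p.2) / 2 : ℝ) : ℂ) * triInt a a a t₀ p +
      (1 / 3 : ℂ) * ∑' p : ℤ × ℤ, ((ψ (-p.1 - p.2) : ℝ) : ℂ) * triInt a a a t₀ p := by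
    rw [← tsum_mul_left, ← tsum_mul_left, ← (hs₂.mul_left _).tsum_add (hs₃.mul_left _)]
    refine tsum_congr fun p => ?_
    push_cast
    ring
  rw [h3, ← h2, ← tsum_mul_triInt_symm ha ha ht₀ hψ]
  ring

end TriInt

section Energy

variable {T : ℝ} {v w : ℝ → ℤ → ℂ}

lemma continuousOn_convolution (hv : RegularCoeffs T v) (hw : RegularCoeffs T w) (k : ℤ) :
    ContinuousOn (fun t => ∑' n, v t n * w t (k - n)) (Icc 0 T) := by
  obtain ⟨D, hD0, hD⟩ := hv.decay
  obtain ⟨E, hE0, hE⟩ := hw.exists_bound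
  refine continuousOn_tsum (u := fun n : ℤ => D * (1 / (1 + (n : ℝ) ^ 2)) * E)
    (fun n => (hv.continuousOn n).mul (hw.continuousOn (k - n)))
    ((summable_one_div_one_add_sq.mul_left D).mul_right E) fun n t ht => ?_
  rw [norm_mul]
  have := hD t ht n
  have := hE t ht (k - n)
  gcongr

lemma integral_mul_convolution (hv : RegularCoeffs T v) (hw : RegularCoeffs T w) {t₀ : ℝ}
    (ht₀ : t₀ ∈ Icc 0 T) (k : ℤ) :
    ∫ t in 0..t₀, v t (-k) * ∑' n, v t n * w t (k - n) = ∑' n, triInt v v w t₀ (-k, n) := by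
  obtain ⟨D, hD0, hD⟩ := exists_triInt_bound hv hv hw
  set B : ℤ → ℝ := fun n => D * ((1 / (1 + ((-k : ℤ) : ℝ) ^ 2)) * (1 / (1 + (n : ℝ) ^ 2)))
  have hB : Summable B := (summable_one_div_one_add_sq.mul_left _).mul_left D
  have hmem : ∀ t ∈ uIoc 0 t₀, t ∈ Icc 0 T := fun t ht => by
    rw [uIoc_of_le ht₀.1] at ht
    exact ⟨ht.1.le, ht.2.trans ht₀.2⟩
  have hrw : ∀ n : ℤ, -(-k) - n = k - n := fun n => by ring
  have h := intervalIntegral.hasSum_integral_of_dominated_convergence (μ := volume) (a := 0)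
    (b := t₀) (F := fun (n : ℤ) t => v t (-k) * v t n * w t (-(-k) - n))
    (f := fun t => v t (-k) * ∑' n, v t n * w t (k - n)) (fun n _ => B n)
    (fun n => (hv.intervalIntegrable hv hw ht₀ _ _ _).def'.aestronglyMeasurable)
    (fun n => Filter.Eventually.of_forall fun t ht => hD t (hmem t ht) _ _ _)
    (Filter.Eventually.of_forall fun _ _ => hB)
    (intervalIntegrable_const)
    (Filter.Eventually.of_forall fun t ht => by
      have hs : Summable fun n => v t (-k) * v t n * w t (-(-k) - n) :=
        Summable.of_norm_bounded hB fun n => hD t (hmem t ht) _ _ _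
      have heq : v t (-k) * ∑' n, v t n * w t (k - n) =
          ∑' n, v t (-k) * v t n * w t (-(-k) - n) := by
        rw [← tsum_mul_left]
        refine tsum_congr fun n => ?_
        rw [hrw]
        ring
      rw [heq]
      exact hs.hasSum)
  exact h.tsum_eq.symm

/-- The energy inequality for an even weight `φ` with finite support. -/
theorem energy_le (hv : RegularCoeffs T v) (hw : RegularCoeffs T w)
    (hd : ∀ t ∈ Ioo 0 T, ∀ k : ℤ, HasDerivAt (fun τ => v τ k)
      (-(Complex.I * ((k * |k| : ℤ) : ℂ)) * v t k +
        Complex.I * k / 2 * ∑' n, v t n * w t (k - n)) t)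
    {φ : ℤ → ℝ} (hφ : ∀ k, φ (-k) = φ k) {S : Finset ℤ} (hS : ∀ k, φ k ≠ 0 → k ∈ S)
    {P : ℝ} (hP : ∀ k : ℤ, |k * φ k| ≤ P) {t₀ : ℝ} (ht₀ : t₀ ∈ Icc 0 T) :
    ∑ k ∈ S, φ k * ‖v t₀ k‖ ^ 2 ≤ ∑ k ∈ S, φ k * ‖v 0 k‖ ^ 2 +
      ‖∑' p : ℤ × ℤ, ((p.1 * φ p.1 : ℝ) : ℂ) * triInt v v w t₀ p‖ := by
  have hcont : ∀ k, ContinuousOn (fun t => Complex.I * k * (v t (-k) * ∑' n, v t n * w t (k - n)))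
      (Icc 0 T) := fun k =>
    continuousOn_const.mul ((hv.continuousOn (-k)).mul (continuousOn_convolution hv hw k))
  have hsub : Icc 0 t₀ ⊆ Icc 0 T := Icc_subset_Icc le_rfl ht₀.2
  have hint : ∀ k, IntervalIntegrable
      (fun t => Complex.I * k * (v t (-k) * ∑' n, v t n * w t (k - n))) volume 0 t₀ := by
    intro k
    refine ContinuousOn.intervalIntegrable ?_
    rw [uIcc_of_le ht₀.1]
    exact (hcont k).mono hsub
  have hone : ∀ k : ℤ, ‖v t₀ k‖ ^ 2 - ‖v 0 k‖ ^ 2 =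
      (Complex.I * k * ∑' n, triInt v v w t₀ (-k, n)).re := by
    intro k
    have hder : ∀ t ∈ Ioo 0 t₀, HasDerivAt (fun t => ‖v t k‖ ^ 2)
        (Complex.I * k * (v t (-k) * ∑' n, v t n * w t (k - n))).re t := by
      intro t ht
      convert (hd t ⟨ht.1, ht.2.trans_le ht₀.2⟩ k).norm_sq using 1
      rw [hv.conj t k, Complex.inner]
      set z := v t k
      set q := ∑' n, v t n * w t (k - n)
      -- The linear term is an imaginary multiple of `|z|²`: the free evolution does not change the
      -- energy.
      have h1 : (z * (-(Complex.I * ((k * |k| : ℤ) : ℂ)) * (starRingEnd ℂ) z)).re = 0 := by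
        have : z * (-(Complex.I * ((k * |k| : ℤ) : ℂ)) * (starRingEnd ℂ) z) =
            ((-(((k * |k| : ℤ) : ℝ) * Complex.normSq z) : ℝ) : ℂ) * Complex.I := by
          rw [Complex.ofReal_neg, Complex.ofReal_mul, Complex.ofReal_intCast,
            ← Complex.mul_conj]
          ring
        rw [this, Complex.re_ofReal_mul, Complex.I_re, mul_zero]
      have h2 : (starRingEnd ℂ) z * (-(Complex.I * ((k * |k| : ℤ) : ℂ)) * z +
          Complex.I * k / 2 * q) =
          z * (-(Complex.I * ((k * |k| : ℤ) : ℂ)) * (starRingEnd ℂ) z) +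
          ((1 / 2 : ℝ) : ℂ) * (Complex.I * k * ((starRingEnd ℂ) z * q)) := by
        push_cast
        ring
      rw [mul_comm _ ((starRingEnd ℂ) z), h2, Complex.add_re, h1, Complex.re_ofReal_mul]
      ring
    have hftc := intervalIntegral.integral_eq_sub_of_hasDerivAt_of_le ht₀.1
      (((hv.continuousOn k).norm.pow 2).mono hsub) hder
      (ContinuousOn.intervalIntegrable (by
        rw [uIcc_of_le ht₀.1]
        exact Complex.continuous_re.comp_continuousOn ((hcont k).mono hsub)))
    rw [← integral_mul_convolution hv hw ht₀ k, ← intervalIntegral.integral_const_mul]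
    refine hftc.symm.trans ?_
    exact Complex.reCLM.intervalIntegral_comp_comm (hint k)
  have hs : Summable fun p : ℤ × ℤ => ((p.1 * φ p.1 : ℝ) : ℂ) * triInt v v w t₀ p :=
    summable_mul_triInt hv hv hw ht₀ (P := P) fun p => by
      rw [Complex.norm_real]; exact hP p.1
  -- The energy produces the frequency `-k` in the first slot. Since `φ` is even, `k φ(k)` is odd,
  -- and the substitution `k ↦ -k` costs only a sign.
  have hQ : ∑' p : ℤ × ℤ, ((p.1 * φ p.1 : ℝ) : ℂ) * triInt v v w t₀ p =
      -∑ k ∈ S, ((k * φ k : ℝ) : ℂ) * ∑' n, triInt v v w t₀ (-k, n) := by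
    rw [hs.tsum_prod, ← (Equiv.neg ℤ).tsum_eq, ← Finset.sum_neg_distrib]
    have hterm : ∀ k : ℤ, ∑' n, (((Equiv.neg ℤ k : ℤ) * φ (Equiv.neg ℤ k) : ℝ) : ℂ) *
        triInt v v w t₀ (Equiv.neg ℤ k, n) =
        -(((k * φ k : ℝ) : ℂ) * ∑' n, triInt v v w t₀ (-k, n)) := by
      intro k
      rw [tsum_mul_left, Equiv.neg_apply, hφ]
      push_cast
      ring
    simp_rw [hterm]
    refine tsum_eq_sum fun k hk => ?_
    have : φ k = 0 := by
      by_contra h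
      exact hk (hS k h)
    rw [this]
    simp
  have hdiff : ∑ k ∈ S, φ k * ‖v t₀ k‖ ^ 2 - ∑ k ∈ S, φ k * ‖v 0 k‖ ^ 2 =
      (-Complex.I * ∑' p : ℤ × ℤ, ((p.1 * φ p.1 : ℝ) : ℂ) * triInt v v w t₀ p).re := by
    rw [hQ, neg_mul_neg, Finset.mul_sum, Complex.re_sum, ← Finset.sum_sub_distrib]
    refine Finset.sum_congr rfl fun k _ => ?_
    rw [← mul_sub, hone, ← Complex.re_ofReal_mul]
    congr 1
    push_cast
    ring
  have hle := Complex.re_le_norm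
    (-Complex.I * ∑' p : ℤ × ℤ, ((p.1 * φ p.1 : ℝ) : ℂ) * triInt v v w t₀ p)
  rw [norm_mul, norm_neg, Complex.norm_I, one_mul] at hle
  linarith

end Energy

/-! ### Decomposition into dyadic blocks -/

/-- The dyadic blocks that contain three frequencies with sum zero. -/
def blockIndex (p : ℤ × ℤ) : ℕ × ℕ × ℕ :=
  (Nat.log 2 p.1.natAbs, Nat.log 2 p.2.natAbs, Nat.log 2 (-p.1 - p.2).natAbs)

section Decomposition

variable {T : ℝ} {u₁ u₂ u₃ : ℝ → Torus → ℝ}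

/-- Each fibre of `blockIndex` is finite. The conditions that the frequencies are nonzero can be
built into the symbol at no cost, since by vanishing mean the excluded integrals are zero. -/
lemma tsum_fiber_blockIndex (a b c : ℝ → ℤ → ℂ) (t₀ : ℝ) (m : ℤ × ℤ → ℂ) (i : ℕ × ℕ × ℕ)
    (hzero : ∀ p : ℤ × ℤ, p.1 = 0 ∨ p.2 = 0 ∨ -p.1 - p.2 = 0 → triInt a b c t₀ p = 0) :
    ∑' p : blockIndex ⁻¹' {i}, m p * triInt a b c t₀ p =
      ∑ k₁ ∈ block i.1, ∑ k₂ ∈ block i.2.1, ∑ k₃ ∈ block i.2.2,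
        (if k₁ + k₂ + k₃ = 0 ∧ (k₁ ∈ block i.1 ∧ k₁ ≠ 0) ∧ (k₂ ∈ block i.2.1 ∧ k₂ ≠ 0) ∧
          (k₃ ∈ block i.2.2 ∧ k₃ ≠ 0) then m (k₁, k₂) else 0) *
          ∫ t in 0..t₀, a t k₁ * b t k₂ * c t k₃ := by
  classical
  set F : Finset (ℤ × ℤ) := (block i.1 ×ˢ block i.2.1).filter fun p => -p.1 - p.2 ∈ block i.2.2
  have hF : blockIndex ⁻¹' {i} = (F : Set (ℤ × ℤ)) := by
    ext p
    simp only [mem_preimage, mem_singleton_iff, F, Finset.coe_filter, Finset.mem_product,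
      mem_ofPred_eq, mem_block_iff_log, blockIndex, Prod.ext_iff, and_assoc]
  rw [hF]
  have h1 : ∑' p : (F : Set (ℤ × ℤ)), m p * triInt a b c t₀ p =
      ∑ p ∈ F, m p * triInt a b c t₀ p :=
    Finset.tsum_subtype' F fun p => m p * triInt a b c t₀ p
  rw [h1, Finset.sum_filter, Finset.sum_product]
  refine Finset.sum_congr rfl fun k₁ h₁ => Finset.sum_congr rfl fun k₂ h₂ => ?_
  simp only
  split_ifs with h₃
  · rw [Finset.sum_eq_single_of_mem _ h₃ fun k₃ _ hk => by
      rw [if_neg (fun h => hk (by omega)), zero_mul]]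
    split_ifs with h
    · rfl
    · rw [hzero, mul_zero, zero_mul]
      by_contra hne
      push Not at hne
      exact h ⟨by ring, ⟨h₁, hne.1⟩, ⟨h₂, hne.2.1⟩, h₃, hne.2.2⟩
  · refine (Finset.sum_eq_zero fun k₃ hk₃ => ?_).symm
    rw [if_neg, zero_mul]
    rintro ⟨h, -⟩
    exact h₃ (by rwa [show -k₁ - k₂ = k₃ by omega])

/-- The trilinear estimate summed over all dyadic blocks. -/
theorem enorm_tsum_triInt_le (hT : 0 < T) (hT1 : T ≤ 1)
    (hu₁ : RegularCoeffs T fun t => fhat (u₁ t)) (hu₂ : RegularCoeffs T fun t => fhat (u₂ t))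
    (hu₃ : RegularCoeffs T fun t => fhat (u₃ t)) {m : ℤ × ℤ → ℂ} {P : ℝ} (hP : ∀ p, ‖m p‖ ≤ P)
    {M : ℕ × ℕ × ℕ → ℝ≥0∞} (hMtop : ∀ i, M i ≠ ⊤)
    (hM : ∀ p : ℤ × ℤ, p.1 ≠ 0 → p.2 ≠ 0 → -p.1 - p.2 ≠ 0 → ‖m p‖ₑ ≤ M (blockIndex p))
    {t₀ : ℝ} (ht₀ : t₀ ∈ Icc 0 T) :
    ‖∑' p, m p * triInt (fun t => fhat (u₁ t)) (fun t => fhat (u₂ t)) (fun t => fhat (u₃ t)) t₀ p‖ₑ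
      ≤ (1 + trilinConst) * ∑' i : ℕ × ℕ × ℕ, M i *
        (blockNorm T u₁ i.1 * blockNorm T u₂ i.2.1 * blockNorm T u₃ i.2.2) := by
  have hs := summable_mul_triInt hu₁ hu₂ hu₃ ht₀ hP
  have h := hs.hasSum.tsum_fiberwise blockIndex
  rw [← h.tsum_eq, ← ENNReal.tsum_mul_left]
  refine enorm_tsum_le_tsum_enorm.trans (ENNReal.tsum_le_tsum fun i => ?_)
  rw [tsum_fiber_blockIndex _ _ _ _ _ _ fun p hp => triInt_eq_zero hu₁ hu₂ hu₃ ht₀ hp]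
  have hbound : ∀ k₁ k₂ k₃ : ℤ, ‖if k₁ + k₂ + k₃ = 0 ∧ (k₁ ∈ block i.1 ∧ k₁ ≠ 0) ∧
      (k₂ ∈ block i.2.1 ∧ k₂ ≠ 0) ∧ (k₃ ∈ block i.2.2 ∧ k₃ ≠ 0) then m (k₁, k₂) else 0‖ₑ
      ≤ M i := by
    intro k₁ k₂ k₃
    split_ifs with hk
    · obtain ⟨h0, ⟨h₁, n₁⟩, ⟨h₂, n₂⟩, h₃, n₃⟩ := hk
      obtain rfl : k₃ = -k₁ - k₂ := by omega
      have hi : blockIndex (k₁, k₂) = i := by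
        simp only [blockIndex, Prod.ext_iff]
        exact ⟨mem_block_iff_log.mp h₁, mem_block_iff_log.mp h₂, mem_block_iff_log.mp h₃⟩
      rw [← hi]
      exact hM (k₁, k₂) n₁ n₂ n₃
    · simp
  -- The block estimate assumes a nonzero bound on the symbol; for `M i = 0` the symbol vanishes on
  -- the whole fibre.
  rcases eq_or_ne (M i) 0 with hM0 | hM0
  · have hz : ∀ k₁ k₂ k₃ : ℤ, (if k₁ + k₂ + k₃ = 0 ∧ (k₁ ∈ block i.1 ∧ k₁ ≠ 0) ∧
        (k₂ ∈ block i.2.1 ∧ k₂ ≠ 0) ∧ (k₃ ∈ block i.2.2 ∧ k₃ ≠ 0) then m (k₁, k₂) else 0) = 0 := by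
      intro k₁ k₂ k₃
      have := hbound k₁ k₂ k₃
      rw [hM0] at this
      exact enorm_eq_zero.mp (le_antisymm this zero_le)
    simp only [hz, zero_mul, Finset.sum_const_zero, enorm_zero, zero_le]
  · refine (enorm_sum_integral_le hT hT1 hu₁.continuousOn hu₂.continuousOn hu₃.continuousOn hM0
      (hMtop i) hbound (fun k₁ k₂ k₃ hne => ?_) ht₀).trans (le_of_eq (mul_assoc _ _ _))
    by_contra hc
    exact hne (if_neg hc)

end Decomposition

end BenjaminOno

namespace BenjaminOno

/-! ### Dyadic sums -/

/-- The weight `N ^ σ` at the dyadic frequency `N = 2 ^ j`. -/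
noncomputable def dyadicWeight (σ : ℝ) (j : ℕ) : ℝ≥0∞ := ((2 : ℝ≥0∞) ^ j) ^ σ

lemma dyadicWeight_add (σ τ : ℝ) (j : ℕ) :
    dyadicWeight (σ + τ) j = dyadicWeight σ j * dyadicWeight τ j :=
  ENNReal.rpow_add _ _ (by positivity) (by finiteness)

lemma dyadicWeight_one (j : ℕ) : dyadicWeight 1 j = 2 ^ j := ENNReal.rpow_one _

lemma dyadicWeight_zero (j : ℕ) : dyadicWeight 0 j = 1 := ENNReal.rpow_zero

lemma dyadicWeight_mono {σ : ℝ} (hσ : 0 ≤ σ) {i j : ℕ} (hij : i ≤ j) :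
    dyadicWeight σ i ≤ dyadicWeight σ j :=
  ENNReal.rpow_le_rpow (pow_le_pow_right₀ (by norm_num) hij) hσ

lemma dyadicWeight_anti {δ : ℝ} (hδ : 0 ≤ δ) {i j : ℕ} (hij : i ≤ j) :
    dyadicWeight (-δ) j ≤ dyadicWeight (-δ) i := by
  unfold dyadicWeight
  rw [ENNReal.rpow_neg, ENNReal.rpow_neg, ENNReal.inv_le_inv]
  exact dyadicWeight_mono hδ hij

lemma dyadicWeight_succ {σ : ℝ} (hσ : 0 ≤ σ) (j : ℕ) :
    dyadicWeight σ (j + 1) = 2 ^ σ * dyadicWeight σ j := by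
  unfold dyadicWeight
  rw [pow_succ', ENNReal.mul_rpow_of_nonneg _ _ hσ]

/-- The sum of the negative powers `N ^ (-δ)` of the dyadic frequencies. -/
noncomputable def dyadicSum (δ : ℝ) : ℝ≥0∞ := ∑' j, dyadicWeight (-δ) j

lemma dyadicSum_ne_top {δ : ℝ} (hδ : 0 < δ) : dyadicSum δ ≠ ⊤ := by
  have h : ∀ j, dyadicWeight (-δ) j = ((2 : ℝ≥0∞) ^ (-δ)) ^ j := fun j => by
    unfold dyadicWeight
    rw [← ENNReal.rpow_natCast, ← ENNReal.rpow_natCast, ← ENNReal.rpow_mul, ← ENNReal.rpow_mul,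
      mul_comm]
  simp_rw [dyadicSum, h]
  rw [ENNReal.tsum_geometric]
  refine ENNReal.inv_ne_top.mpr (tsub_pos_of_lt ?_).ne'
  exact ENNReal.rpow_lt_one_of_one_lt_of_neg (by norm_num) (by linarith)

/-- The `ℓ²` norm of a sequence. -/
noncomputable def ell2 (X : ℕ → ℝ≥0∞) : ℝ≥0∞ := (∑' j, X j ^ 2) ^ (1 / 2 : ℝ)

lemma ell2_sq (X : ℕ → ℝ≥0∞) : ell2 X ^ 2 = ∑' j, X j ^ 2 := by
  rw [ell2, ← ENNReal.rpow_natCast, ← ENNReal.rpow_mul]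
  norm_num

lemma le_ell2 (X : ℕ → ℝ≥0∞) (j : ℕ) : X j ≤ ell2 X := by
  rw [← ennreal_sq_le_sq_iff, ell2_sq]
  exact ENNReal.le_tsum (f := fun j => X j ^ 2) j

/-- Two dyadic indices differ by at most one. -/
abbrev Near (i j : ℕ) : Prop := i ≤ j + 1 ∧ j ≤ i + 1

lemma tsum_near_le (a : ℕ) {f : ℕ → ℝ≥0∞} {B : ℝ≥0∞} (h : ∀ j, Near j a → f j ≤ B) :
    ∑' j, (if Near j a then f j else 0) ≤ 3 * B := by
  rw [tsum_eq_sum (s := Finset.Icc (a - 1) (a + 1))]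
  · refine (Finset.sum_le_card_nsmul _ _ B fun j _ => ?_).trans ?_
    · split_ifs with hj
      · exact h j hj
      · exact zero_le
    · rw [nsmul_eq_mul, Nat.card_Icc]
      gcongr
      exact_mod_cast (by omega : a + 1 + 1 - (a - 1) ≤ 3)
  · intro j hj
    rw [if_neg]
    rintro ⟨h1, h2⟩
    exact hj (Finset.mem_Icc.mpr ⟨by omega, h1⟩)

/-- Cauchy-Schwarz over the band `|a - b| ≤ 1`, in which every row and column has at most three
entries. -/
lemma tsum_near_mul_le (X Y : ℕ → ℝ≥0∞) :
    ∑' a, ∑' b, (if Near a b then X a * Y b else 0) ≤ 3 * (ell2 X * ell2 Y) := by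
  have h := ennreal_tsum_mul_sq_le (fun p : ℕ × ℕ => if Near p.1 p.2 then X p.1 else 0)
    fun p => if Near p.1 p.2 then Y p.2 else 0
  rw [ENNReal.tsum_prod', ENNReal.tsum_prod', ENNReal.tsum_prod'] at h
  have e1 : ∀ a b, ((if Near a b then X a else 0) * if Near a b then Y b else 0) =
      if Near a b then X a * Y b else 0 := fun a b => by split_ifs <;> simp
  have e2 : ∀ a b, (if Near a b then X a else 0) ^ 2 = if Near a b then X a ^ 2 else 0 :=
    fun a b => by split_ifs <;> simp
  have e3 : ∀ a b, (if Near a b then Y b else 0) ^ 2 = if Near a b then Y b ^ 2 else 0 :=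
    fun a b => by split_ifs <;> simp
  simp only [e1, e2, e3] at h
  rw [← ennreal_sq_le_sq_iff]
  refine h.trans ?_
  have hX : ∑' a, ∑' b, (if Near a b then X a ^ 2 else 0) ≤ 3 * ell2 X ^ 2 := by
    rw [ell2_sq, ← ENNReal.tsum_mul_left]
    refine ENNReal.tsum_le_tsum fun a => ?_
    have : ∀ b, (if Near a b then X a ^ 2 else 0) = if Near b a then X a ^ 2 else 0 := fun b =>
      if_congr and_comm rfl rfl
    simp_rw [this]
    exact tsum_near_le a fun _ _ => le_rfl
  have hY : ∑' a, ∑' b, (if Near a b then Y b ^ 2 else 0) ≤ 3 * ell2 Y ^ 2 := by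
    rw [ENNReal.tsum_comm, ell2_sq, ← ENNReal.tsum_mul_left]
    exact ENNReal.tsum_le_tsum fun b => tsum_near_le b fun _ _ => le_rfl
  refine (mul_le_mul' hX hY).trans (le_of_eq ?_)
  ring

lemma tsum_near₁₂_le (X Y Z : ℕ → ℝ≥0∞) :
    ∑' i : ℕ × ℕ × ℕ, (if Near i.1 i.2.1 then X i.1 * Y i.2.1 * Z i.2.2 else 0) ≤
      3 * (ell2 X * ell2 Y) * ∑' c, Z c := by
  simp_rw [ENNReal.tsum_prod']
  refine le_trans (le_of_eq ?_) (mul_le_mul_left (tsum_near_mul_le X Y) _)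
  rw [← ENNReal.tsum_mul_right]
  refine tsum_congr fun a => ?_
  rw [← ENNReal.tsum_mul_right]
  refine tsum_congr fun b => ?_
  rw [← ENNReal.tsum_mul_left]
  refine tsum_congr fun c => ?_
  split_ifs <;> simp

lemma tsum_near₁₃_le (X Y Z : ℕ → ℝ≥0∞) :
    ∑' i : ℕ × ℕ × ℕ, (if Near i.1 i.2.2 then X i.1 * Y i.2.2 * Z i.2.1 else 0) ≤
      3 * (ell2 X * ell2 Y) * ∑' c, Z c := by
  refine le_trans (le_of_eq ?_) (tsum_near₁₂_le X Y Z)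
  simp_rw [ENNReal.tsum_prod']
  exact tsum_congr fun a => ENNReal.tsum_comm

lemma tsum_near₂₃_le (X Y Z : ℕ → ℝ≥0∞) :
    ∑' i : ℕ × ℕ × ℕ, (if Near i.2.1 i.2.2 then X i.2.1 * Y i.2.2 * Z i.1 else 0) ≤
      3 * (ell2 X * ell2 Y) * ∑' c, Z c := by
  refine le_trans (le_of_eq ?_) (tsum_near₁₃_le X Y Z)
  simp_rw [ENNReal.tsum_prod']
  exact ENNReal.tsum_comm

/-- The triples of dyadic blocks that interact. -/
abbrev Admissible (i : ℕ × ℕ × ℕ) : Prop :=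
  i.1 ≤ max i.2.1 i.2.2 + 1 ∧ i.2.1 ≤ max i.1 i.2.2 + 1 ∧ i.2.2 ≤ max i.1 i.2.1 + 1

/-- The largest of three indices. -/
abbrev top (i : ℕ × ℕ × ℕ) : ℕ := max i.1 (max i.2.1 i.2.2)

/-- The smallest of three indices. -/
abbrev bot (i : ℕ × ℕ × ℕ) : ℕ := min i.1 (min i.2.1 i.2.2)

/-- Half of the weight `2σ` goes to each of the two highest frequencies. As `J + 1 ≤ c + 2` for `c =
a, b`, each half costs two factors `2 ^ σ`. -/
lemma dyadicWeight_top_le {σ : ℝ} (hσ : 0 ≤ σ) {J a b : ℕ} (ha : J ≤ a + 1) (hb : J ≤ b + 1) :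
    dyadicWeight (2 * σ) (J + 1) ≤ (2 ^ σ) ^ 4 * (dyadicWeight σ a * dyadicWeight σ b) := by
  have h : ∀ c, J ≤ c + 1 → dyadicWeight σ (J + 1) ≤ (2 ^ σ) ^ 2 * dyadicWeight σ c := by
    intro c hc
    refine (dyadicWeight_mono hσ (show J + 1 ≤ c + 1 + 1 by omega)).trans (le_of_eq ?_)
    rw [dyadicWeight_succ hσ, dyadicWeight_succ hσ]
    ring
  rw [two_mul, dyadicWeight_add]
  refine (mul_le_mul' (h a ha) (h b hb)).trans (le_of_eq ?_)
  ring

/-- One derivative is traded for `s` derivatives and a factor `N^{-(s-1)}`, which is summable over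
the dyadic `N` when `s > 1`. -/
lemma two_pow_eq_dyadicWeight (s : ℝ) (j : ℕ) :
    (2 : ℝ≥0∞) ^ j = dyadicWeight (-(s - 1)) j * dyadicWeight s j := by
  rw [← dyadicWeight_add, ← dyadicWeight_one]
  congr 1
  ring

lemma tsum_dyadicWeight_mul_le (δ : ℝ) (X : ℕ → ℝ≥0∞) :
    ∑' j, dyadicWeight (-δ) j * X j ≤ dyadicSum δ * ell2 X := by
  rw [dyadicSum, ← ENNReal.tsum_mul_right]
  gcongr with j
  exact le_ell2 X j

/-- Summation of the trilinear estimate with a derivative on the third factor. -/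
theorem tsum_admissible_third_le {σ s : ℝ} (hσ : 0 ≤ σ) (hs : 1 < s) (A B : ℕ → ℝ≥0∞) :
    ∑' i : ℕ × ℕ × ℕ, (if Admissible i then dyadicWeight (2 * σ) (top i + 1) * 2 ^ i.2.2 *
        (A i.1 * A i.2.1 * B i.2.2) else 0) ≤
      6 * (2 ^ σ) ^ 4 * dyadicSum (s - 1) *
        (ell2 (fun j => dyadicWeight σ j * A j) ^ 2 * ell2 (fun j => dyadicWeight s j * B j) +
          ell2 A * ell2 (fun j => dyadicWeight σ j * A j) *
            ell2 (fun j => dyadicWeight (σ + s) j * B j)) := by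
  set X : ℕ → ℝ≥0∞ := fun j => dyadicWeight σ j * A j with hX
  set Y : ℕ → ℝ≥0∞ := fun j => dyadicWeight (σ + s) j * B j with hY
  set Z : ℕ → ℝ≥0∞ := fun j => dyadicWeight (-(s - 1)) j * (dyadicWeight s j * B j) with hZ
  set W : ℕ → ℝ≥0∞ := fun j => dyadicWeight (-(s - 1)) j * A j with hW
  set κ : ℝ≥0∞ := (2 ^ σ) ^ 4 with hκ
  have hpt : ∀ i : ℕ × ℕ × ℕ, (if Admissible i then dyadicWeight (2 * σ) (top i + 1) * 2 ^ i.2.2 *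
        (A i.1 * A i.2.1 * B i.2.2) else 0) ≤
      κ * (if Near i.1 i.2.1 then X i.1 * X i.2.1 * Z i.2.2 else 0) +
      κ * (if Near i.1 i.2.2 then X i.1 * Y i.2.2 * W i.2.1 else 0) +
      κ * (if Near i.2.1 i.2.2 then X i.2.1 * Y i.2.2 * W i.1 else 0) := by
    rintro ⟨a, b, c⟩
    by_cases hadm : Admissible (a, b, c)
    swap
    · rw [if_neg hadm]; exact zero_le
    rw [if_pos hadm]
    simp only [Admissible] at hadm
    dsimp only [top, bot]
    -- The differentiated factor `c` is one of the two high ones. The decay `2 ^ (-(s-1)c)` is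
    -- weakened to `2 ^ (-(s-1)d)` so that it sums the low index `d`. All `s` derivatives then fall
    -- on `B c`, on top of `σ`, while `A d` carries none.
    have hthird : ∀ d e, d ≤ c → c ≤ e + 1 → e ≤ c + 1 → max a (max b c) ≤ e + 1 →
        max a (max b c) ≤ c + 1 →
        dyadicWeight (2 * σ) (max a (max b c) + 1) * 2 ^ c * (A e * A d * B c) ≤
          κ * (X e * Y c * W d) := by
      intro d e hdc _ _ h1 h2
      calc dyadicWeight (2 * σ) (max a (max b c) + 1) * 2 ^ c * (A e * A d * B c)
          ≤ (κ * (dyadicWeight σ e * dyadicWeight σ c)) *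
            (dyadicWeight (-(s - 1)) d * dyadicWeight s c) * (A e * A d * B c) := by
            gcongr
            · exact dyadicWeight_top_le hσ h1 h2
            · rw [two_pow_eq_dyadicWeight s]
              gcongr
              exact dyadicWeight_anti (by linarith) hdc
        _ = _ := by
            simp only [hX, hY, hW, dyadicWeight_add]
            ring
    -- If the differentiated factor is the lowest, it absorbs its own derivative and is summed by
    -- its own decay; the other two share the weight.
    rcases le_total c (min a b) with h | h
    · have hn : Near a b := by omega
      refine le_trans ?_ (le_self_add.trans le_self_add)
      rw [if_pos hn]
      calc dyadicWeight (2 * σ) (max a (max b c) + 1) * 2 ^ c * (A a * A b * B c)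
          ≤ (κ * (dyadicWeight σ a * dyadicWeight σ b)) *
            (dyadicWeight (-(s - 1)) c * dyadicWeight s c) * (A a * A b * B c) := by
            gcongr
            · exact dyadicWeight_top_le hσ (by omega) (by omega)
            · exact (two_pow_eq_dyadicWeight s c).le
        _ = _ := by
            simp only [hX, hZ]
            ring
    · rcases le_total b a with hab | hab
      · have hn : Near a c := by omega
        refine le_trans ?_ (le_add_self.trans le_self_add)
        rw [if_pos hn]
        exact hthird b a (by omega) (by omega) (by omega) (by omega) (by omega)
      · have hn : Near b c := by omega
        refine le_trans ?_ le_add_self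
        rw [if_pos hn, mul_comm (A a) (A b)]
        exact hthird a b (by omega) (by omega) (by omega) (by omega) (by omega)
  refine (ENNReal.tsum_le_tsum hpt).trans ?_
  rw [ENNReal.tsum_add, ENNReal.tsum_add, ENNReal.tsum_mul_left, ENNReal.tsum_mul_left,
    ENNReal.tsum_mul_left]
  calc _ ≤ κ * (3 * (ell2 X * ell2 X) * (dyadicSum (s - 1) * ell2 fun j => dyadicWeight s j * B j)) +
        κ * (3 * (ell2 X * ell2 Y) * (dyadicSum (s - 1) * ell2 A)) +
        κ * (3 * (ell2 X * ell2 Y) * (dyadicSum (s - 1) * ell2 A)) := by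
        gcongr
        · exact (tsum_near₁₂_le X X Z).trans (mul_le_mul_right (tsum_dyadicWeight_mul_le _ _) _)
        · exact (tsum_near₁₃_le X Y W).trans (mul_le_mul_right (tsum_dyadicWeight_mul_le _ _) _)
        · exact (tsum_near₂₃_le X Y W).trans (mul_le_mul_right (tsum_dyadicWeight_mul_le _ _) _)
    _ = 3 * κ * dyadicSum (s - 1) * (ell2 X ^ 2 * ell2 fun j => dyadicWeight s j * B j) +
        6 * κ * dyadicSum (s - 1) * (ell2 A * ell2 X * ell2 Y) := by ring
    _ ≤ 6 * κ * dyadicSum (s - 1) * (ell2 X ^ 2 * ell2 fun j => dyadicWeight s j * B j) +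
        6 * κ * dyadicSum (s - 1) * (ell2 A * ell2 X * ell2 Y) := by
        gcongr
        norm_num
    _ = _ := by ring

/-- Summation of the trilinear estimate with a derivative on the factor of lowest frequency. -/
theorem tsum_admissible_bot_le {s : ℝ} (hs : 1 < s) (A : ℕ → ℝ≥0∞) :
    ∑' i : ℕ × ℕ × ℕ, (if Admissible i then dyadicWeight (2 * s) (top i + 1) * 2 ^ bot i *
        (A i.1 * A i.2.1 * A i.2.2) else 0) ≤
      9 * (2 ^ s) ^ 4 * dyadicSum (s - 1) * ell2 (fun j => dyadicWeight s j * A j) ^ 3 := by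
  have hσ : 0 ≤ s := by linarith
  set X : ℕ → ℝ≥0∞ := fun j => dyadicWeight s j * A j with hX
  set Z : ℕ → ℝ≥0∞ := fun j => dyadicWeight (-(s - 1)) j * X j with hZ
  set κ : ℝ≥0∞ := (2 ^ s) ^ 4 with hκ
  have hpt : ∀ i : ℕ × ℕ × ℕ, (if Admissible i then dyadicWeight (2 * s) (top i + 1) * 2 ^ bot i *
        (A i.1 * A i.2.1 * A i.2.2) else 0) ≤
      κ * (if Near i.1 i.2.1 then X i.1 * X i.2.1 * Z i.2.2 else 0) +
      κ * (if Near i.1 i.2.2 then X i.1 * X i.2.2 * Z i.2.1 else 0) +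
      κ * (if Near i.2.1 i.2.2 then X i.2.1 * X i.2.2 * Z i.1 else 0) := by
    rintro ⟨a, b, c⟩
    by_cases hadm : Admissible (a, b, c)
    swap
    · rw [if_neg hadm]; exact zero_le
    rw [if_pos hadm]
    simp only [Admissible] at hadm
    dsimp only [top, bot]
    have hcase : ∀ d e f, min a (min b c) = f → max a (max b c) ≤ d + 1 → max a (max b c) ≤ e + 1 →
        dyadicWeight (2 * s) (max a (max b c) + 1) * 2 ^ min a (min b c) * (A d * A e * A f) ≤
          κ * (X d * X e * Z f) := by
      intro d e f hf h1 h2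
      rw [hf]
      calc dyadicWeight (2 * s) (max a (max b c) + 1) * 2 ^ f * (A d * A e * A f)
          ≤ (κ * (dyadicWeight s d * dyadicWeight s e)) *
            (dyadicWeight (-(s - 1)) f * dyadicWeight s f) * (A d * A e * A f) := by
            gcongr
            · exact dyadicWeight_top_le hσ h1 h2
            · exact (two_pow_eq_dyadicWeight s f).le
        _ = _ := by
            simp only [hX, hZ]
            ring
    rcases le_total c (min a b) with h | h
    · have hn : Near a b := by omega
      refine le_trans ?_ (le_self_add.trans le_self_add)
      rw [if_pos hn]
      exact hcase a b c (by omega) (by omega) (by omega)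
    · rcases le_total b a with hab | hab
      · have hn : Near a c := by omega
        refine le_trans ?_ (le_add_self.trans le_self_add)
        rw [if_pos hn, mul_right_comm (A a)]
        exact hcase a c b (by omega) (by omega) (by omega)
      · have hn : Near b c := by omega
        refine le_trans ?_ le_add_self
        rw [if_pos hn, mul_assoc (A a), mul_comm (A a)]
        exact hcase b c a (by omega) (by omega) (by omega)
  refine (ENNReal.tsum_le_tsum hpt).trans ?_
  rw [ENNReal.tsum_add, ENNReal.tsum_add, ENNReal.tsum_mul_left, ENNReal.tsum_mul_left,
    ENNReal.tsum_mul_left]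
  calc _ ≤ κ * (3 * (ell2 X * ell2 X) * (dyadicSum (s - 1) * ell2 X)) +
        κ * (3 * (ell2 X * ell2 X) * (dyadicSum (s - 1) * ell2 X)) +
        κ * (3 * (ell2 X * ell2 X) * (dyadicSum (s - 1) * ell2 X)) := by
        gcongr
        · exact (tsum_near₁₂_le X X Z).trans (mul_le_mul_right (tsum_dyadicWeight_mul_le _ _) _)
        · exact (tsum_near₁₃_le X X Z).trans (mul_le_mul_right (tsum_dyadicWeight_mul_le _ _) _)
        · exact (tsum_near₂₃_le X X Z).trans (mul_le_mul_right (tsum_dyadicWeight_mul_le _ _) _)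
    _ = _ := by ring

lemma tsum_near_dyadicWeight_le {σ : ℝ} (hσ : 0 ≤ σ) (a : ℕ) :
    ∑' j, (if Near j a then dyadicWeight σ j else 0) ≤ 3 * dyadicWeight σ (a + 1) :=
  tsum_near_le a fun _ hj => dyadicWeight_mono hσ hj.1

/-- The index `j` is close to one of three indices. -/
abbrev NearAny (j : ℕ) (i : ℕ × ℕ × ℕ) : Prop := Near j i.1 ∨ Near j i.2.1 ∨ Near j i.2.2

/-- The bound for the symbol of the energy of block `j` on the triple `i` of blocks. -/
noncomputable def symbolBound (μ : ℕ × ℕ × ℕ → ℝ≥0∞) (j : ℕ) (i : ℕ × ℕ × ℕ) : ℝ≥0∞ :=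
  if NearAny j i ∧ Admissible i then 9 * μ i else 0

/-- A given triple feeds at most three energy blocks near each of its three indices. These 9 blocks,
times the 9 in `symbolBound`, give 81. -/
lemma tsum_dyadicWeight_symbolBound_le {σ : ℝ} (hσ : 0 ≤ σ) (μ : ℕ × ℕ × ℕ → ℝ≥0∞)
    (i : ℕ × ℕ × ℕ) : ∑' j, dyadicWeight (2 * σ) j * symbolBound μ j i ≤
      81 * if Admissible i then dyadicWeight (2 * σ) (top i + 1) * μ i else 0 := by
  by_cases hadm : Admissible i
  swap
  · simp [symbolBound, hadm]
  have h2σ : 0 ≤ 2 * σ := by linarith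
  have hpt : ∀ j, dyadicWeight (2 * σ) j * symbolBound μ j i ≤
      ((if Near j i.1 then dyadicWeight (2 * σ) j else 0) +
      (if Near j i.2.1 then dyadicWeight (2 * σ) j else 0) +
      (if Near j i.2.2 then dyadicWeight (2 * σ) j else 0)) * (9 * μ i) := by
    intro j
    by_cases hn : NearAny j i
    · rw [symbolBound, if_pos ⟨hn, hadm⟩]
      gcongr
      rcases hn with h | h | h
      · rw [if_pos h]; exact le_self_add.trans le_self_add
      · rw [if_pos h]; exact le_add_self.trans le_self_add
      · rw [if_pos h]; exact le_add_self
    · rw [symbolBound, if_neg (fun h => hn h.1), mul_zero]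
      exact zero_le
  refine (ENNReal.tsum_le_tsum hpt).trans ?_
  rw [ENNReal.tsum_mul_right, ENNReal.tsum_add, ENNReal.tsum_add, if_pos hadm]
  calc _ ≤ (3 * dyadicWeight (2 * σ) (top i + 1) + 3 * dyadicWeight (2 * σ) (top i + 1) +
        3 * dyadicWeight (2 * σ) (top i + 1)) * (9 * μ i) := by
        gcongr
        · exact (tsum_near_dyadicWeight_le h2σ _).trans
            (mul_le_mul_right (dyadicWeight_mono h2σ (by simp only [top]; omega)) _)
        · exact (tsum_near_dyadicWeight_le h2σ _).trans
            (mul_le_mul_right (dyadicWeight_mono h2σ (by simp only [top]; omega)) _)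
        · exact (tsum_near_dyadicWeight_le h2σ _).trans
            (mul_le_mul_right (dyadicWeight_mono h2σ (by simp only [top]; omega)) _)
    _ = _ := by ring

lemma tsum_tsum_symbolBound_le {σ : ℝ} (hσ : 0 ≤ σ) (μ Q : ℕ × ℕ × ℕ → ℝ≥0∞) :
    ∑' j, dyadicWeight (2 * σ) j * ∑' i, symbolBound μ j i * Q i ≤
      81 * ∑' i, if Admissible i then dyadicWeight (2 * σ) (top i + 1) * μ i * Q i else 0 := by
  simp_rw [← ENNReal.tsum_mul_left]
  rw [ENNReal.tsum_comm]
  refine ENNReal.tsum_le_tsum fun i => ?_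
  simp_rw [← mul_assoc]
  rw [ENNReal.tsum_mul_right]
  refine (mul_le_mul_left (tsum_dyadicWeight_symbolBound_le hσ μ i) _).trans (le_of_eq ?_)
  split_ifs <;> ring

end BenjaminOno

namespace BenjaminOno

/-! ### Symmetrized symbols -/

/-- A Lipschitz cutoff to `|k| ~ 2 ^ j` that equals one on the nonzero part of `block j`. -/
noncomputable def tent (j : ℕ) (k : ℤ) : ℝ :=
  max 0 (min 1 (min (2 * |(k : ℝ)| / 2 ^ j - 1) (2 - |(k : ℝ)| / 2 ^ (j + 1))))

lemma tent_nonneg (j : ℕ) (k : ℤ) : 0 ≤ tent j k := le_max_left _ _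

lemma tent_le_one (j : ℕ) (k : ℤ) : tent j k ≤ 1 := max_le zero_le_one (min_le_left _ _)

lemma tent_neg (j : ℕ) (k : ℤ) : tent j (-k) = tent j k := by
  simp only [tent, Int.cast_neg, abs_neg]

lemma tent_of_mem_block {j : ℕ} {k : ℤ} (hk : k ∈ block j) (hk0 : k ≠ 0) : tent j k = 1 := by
  have h1 : (2 : ℝ) ^ j ≤ |(k : ℝ)| := by exact_mod_cast two_pow_le_abs_of_mem_block hk hk0
  have h2 : |(k : ℝ)| < 2 ^ (j + 1) := by exact_mod_cast abs_lt_of_mem_block hk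
  have e1 : 1 ≤ 2 * |(k : ℝ)| / 2 ^ j - 1 := by
    rw [le_sub_iff_add_le, le_div_iff₀ (by positivity)]
    linarith
  have e2 : 1 ≤ 2 - |(k : ℝ)| / 2 ^ (j + 1) := by
    rw [le_sub_comm, div_le_iff₀ (by positivity)]
    linarith
  rw [tent, min_eq_left (le_min e1 e2), max_eq_right zero_le_one]

lemma lt_of_tent_ne_zero {j : ℕ} {k : ℤ} (h : tent j k ≠ 0) :
    (2 : ℝ) ^ j < 2 * |(k : ℝ)| ∧ |(k : ℝ)| < 2 ^ (j + 2) := by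
  have hpos := lt_of_le_of_ne (tent_nonneg j k) h.symm
  rw [tent, lt_max_iff, lt_min_iff, lt_min_iff] at hpos
  obtain ⟨-, h1, h2⟩ := hpos.resolve_left (lt_irrefl _)
  rw [lt_sub_iff_add_lt, zero_add, lt_div_iff₀ (by positivity), one_mul] at h1
  rw [lt_sub_comm, sub_zero, div_lt_iff₀ (by positivity)] at h2
  exact ⟨h1, h2.trans_eq (by ring)⟩

lemma natAbs_of_tent_ne_zero {j : ℕ} {k : ℤ} (h : tent j k ≠ 0) :
    2 ^ j < 2 * k.natAbs ∧ k.natAbs < 2 ^ (j + 2) := by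
  have h' := lt_of_tent_ne_zero h
  rw [← Int.cast_abs, Int.abs_eq_natAbs] at h'
  exact ⟨by exact_mod_cast h'.1, by exact_mod_cast h'.2⟩

lemma near_of_tent_ne_zero {j : ℕ} {k : ℤ} (h : tent j k ≠ 0) :
    k ≠ 0 ∧ Near j (Nat.log 2 k.natAbs) := by
  obtain ⟨h1, h2⟩ := natAbs_of_tent_ne_zero h
  have hk : k.natAbs ≠ 0 := by
    rintro h0
    rw [h0] at h1
    exact absurd h1 (Nat.not_lt_zero _)
  have h3 := Nat.lt_pow_succ_log_self one_lt_two k.natAbs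
  have h4 := Nat.pow_log_le_self 2 hk
  refine ⟨fun h0 => hk (by simp [h0]), ?_, ?_⟩
  · have : 2 ^ j < 2 ^ (Nat.log 2 k.natAbs + 2) := h1.trans (by rw [pow_succ]; omega)
    have := (Nat.pow_lt_pow_iff_right one_lt_two).mp this
    omega
  · have := (Nat.pow_lt_pow_iff_right one_lt_two).mp (h4.trans_lt h2)
    omega

/-- The frequencies at which `tent j` may be nonzero. -/
noncomputable def tentSupport (j : ℕ) : Finset ℤ := Finset.Ioo (-2 ^ (j + 2)) (2 ^ (j + 2))

lemma mem_tentSupport {j : ℕ} {k : ℤ} (h : tent j k ≠ 0) : k ∈ tentSupport j := by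
  have h2 : |k| < 2 ^ (j + 2) := by exact_mod_cast (lt_of_tent_ne_zero h).2
  exact Finset.mem_Ioo.mpr (abs_lt.mp h2)

lemma abs_tent_sub_le (j : ℕ) (k l : ℤ) :
    |tent j k - tent j l| ≤ 2 / 2 ^ j * |(k : ℝ) - l| := by
  have hd : |(|(k : ℝ)| - |(l : ℝ)|)| ≤ |(k : ℝ) - l| := abs_abs_sub_abs_le_abs_sub _ _
  have e1 : |2 * |(k : ℝ)| / 2 ^ j - 1 - (2 * |(l : ℝ)| / 2 ^ j - 1)| ≤
      2 / 2 ^ j * |(k : ℝ) - l| := by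
    rw [show 2 * |(k : ℝ)| / 2 ^ j - 1 - (2 * |(l : ℝ)| / 2 ^ j - 1) =
      2 / 2 ^ j * (|(k : ℝ)| - |(l : ℝ)|) by ring, abs_mul, abs_of_nonneg (by positivity)]
    gcongr
  have e2 : |2 - |(k : ℝ)| / 2 ^ (j + 1) - (2 - |(l : ℝ)| / 2 ^ (j + 1))| ≤
      2 / 2 ^ j * |(k : ℝ) - l| := by
    rw [show 2 - |(k : ℝ)| / 2 ^ (j + 1) - (2 - |(l : ℝ)| / 2 ^ (j + 1)) =
      -(1 / 2 / 2 ^ j * (|(k : ℝ)| - |(l : ℝ)|)) by rw [pow_succ]; field_simp; ring,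
      abs_neg, abs_mul, abs_of_nonneg (by positivity)]
    gcongr
    norm_num
  unfold tent
  refine (abs_max_sub_max_le_max _ _ _ _).trans (max_le (by simp) ?_)
  refine (abs_min_sub_min_le_max _ _ _ _).trans (max_le (by simp) ?_)
  exact (abs_min_sub_min_le_max _ _ _ _).trans (max_le e1 e2)

/-- The symbol `k · tent j k`. -/
noncomputable def tentSymbol (j : ℕ) (k : ℤ) : ℝ := k * tent j k

lemma tentSymbol_neg (j : ℕ) (k : ℤ) : tentSymbol j (-k) = -tentSymbol j k := by
  simp only [tentSymbol, tent_neg, Int.cast_neg, neg_mul]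

lemma abs_tentSymbol_le (j : ℕ) (k : ℤ) : |tentSymbol j k| ≤ |(k : ℝ)| := by
  rw [tentSymbol, abs_mul, abs_of_nonneg (tent_nonneg j k)]
  exact mul_le_of_le_one_right (abs_nonneg _) (tent_le_one j k)

lemma abs_tentSymbol_le_two_pow (j : ℕ) (k : ℤ) : |tentSymbol j k| ≤ 2 ^ (j + 2) := by
  by_cases h : tent j k = 0
  · rw [tentSymbol, h, mul_zero, abs_zero]; positivity
  · exact (abs_tentSymbol_le j k).trans (lt_of_tent_ne_zero h).2.le

/-- Product rule: where `tent j` lives, `|k| < 2 ^ (j + 2)` while the slope of the tent is at most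
`2 / 2 ^ j`. This gives 8, and `tent j ≤ 1` gives the remaining 1. The bound does not depend on `j`.
-/
lemma abs_tentSymbol_sub_le (j : ℕ) (k l : ℤ) :
    |tentSymbol j k - tentSymbol j l| ≤ 9 * |(k : ℝ) - l| := by
  have key : ∀ k l : ℤ, tent j k ≠ 0 → |tentSymbol j k - tentSymbol j l| ≤ 9 * |(k : ℝ) - l| := by
    intro k l hk
    have h1 := abs_tent_sub_le j k l
    have h2 := (lt_of_tent_ne_zero hk).2
    calc |tentSymbol j k - tentSymbol j l|
        = |k * (tent j k - tent j l) + (k - l) * tent j l| := by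
          congr 1
          simp only [tentSymbol]
          ring
      _ ≤ |(k : ℝ)| * |tent j k - tent j l| + |(k : ℝ) - l| * |tent j l| := by
          refine (abs_add_le _ _).trans (le_of_eq ?_)
          rw [abs_mul, abs_mul]
      _ ≤ 2 ^ (j + 2) * (2 / 2 ^ j * |(k : ℝ) - l|) + |(k : ℝ) - l| * 1 := by
          gcongr
          rw [abs_of_nonneg (tent_nonneg j l)]
          exact tent_le_one j l
      _ = _ := by
          rw [pow_add]
          field_simp
          ring
  by_cases hk : tent j k = 0
  · by_cases hl : tent j l = 0
    · simp only [tentSymbol, hk, hl, mul_zero, sub_zero, abs_zero]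
      positivity
    · rw [abs_sub_comm, abs_sub_comm (k : ℝ)]
      exact key l k hl
  · exact key k l hk

/-- The commutator cancellation: oddness turns the Lipschitz bound into smallness when `k` and `l`
nearly cancel. -/
lemma abs_tentSymbol_add_le (j : ℕ) (k l : ℤ) :
    |tentSymbol j k + tentSymbol j l| ≤ 9 * |(k : ℝ) + l| := by
  have h := abs_tentSymbol_sub_le j k (-l)
  rwa [tentSymbol_neg, sub_neg_eq_add, Int.cast_neg, sub_neg_eq_add] at h

lemma abs_tentSymbol_sum_le (j : ℕ) {k l m : ℤ} (h : k + l + m = 0) :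
    |tentSymbol j k + tentSymbol j l + tentSymbol j m| ≤ 10 * |(m : ℝ)| := by
  have e : (k : ℝ) + l = -m := by
    have : (k : ℝ) + l + m = 0 := by exact_mod_cast h
    linarith
  have h1 := abs_tentSymbol_add_le j k l
  rw [e, abs_neg] at h1
  linarith [abs_add_le (tentSymbol j k + tentSymbol j l) (tentSymbol j m), abs_tentSymbol_le j m]

/-- The triangle inequality on dyadic scales: `2 ^ log|k| ≤ |k| ≤ |l| + |m|`, and the right side is
below `2 ^ (max + 2)`. -/
lemma admissible_blockIndex {p : ℤ × ℤ} (h1 : p.1 ≠ 0) (h2 : p.2 ≠ 0) (h3 : -p.1 - p.2 ≠ 0) :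
    Admissible (blockIndex p) := by
  have key : ∀ k l m : ℤ, k + l + m = 0 → k ≠ 0 →
      Nat.log 2 k.natAbs ≤ max (Nat.log 2 l.natAbs) (Nat.log 2 m.natAbs) + 1 := by
    intro k l m hsum hk
    have hl := Nat.lt_pow_succ_log_self one_lt_two l.natAbs
    have hm := Nat.lt_pow_succ_log_self one_lt_two m.natAbs
    have hl' := hl.trans_le (Nat.pow_le_pow_right two_pos (Nat.succ_le_succ
      (le_max_left (Nat.log 2 l.natAbs) (Nat.log 2 m.natAbs))))
    have hm' := hm.trans_le (Nat.pow_le_pow_right two_pos (Nat.succ_le_succ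
      (le_max_right (Nat.log 2 l.natAbs) (Nat.log 2 m.natAbs))))
    have hk' := Nat.pow_log_le_self 2 (Int.natAbs_ne_zero.mpr hk)
    have hlt : 2 ^ Nat.log 2 k.natAbs <
        2 ^ (max (Nat.log 2 l.natAbs) (Nat.log 2 m.natAbs) + 2) := by
      rw [pow_succ _ (_ + 1)]
      simp only [Nat.succ_eq_add_one] at hl' hm'
      omega
    have := (Nat.pow_lt_pow_iff_right one_lt_two).mp hlt
    omega
  exact ⟨key _ _ _ (by ring) h1, key p.2 p.1 _ (by ring) h2, key (-p.1 - p.2) p.1 p.2 (by ring) h3⟩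

lemma abs_lt_two_pow_log (k : ℤ) : |(k : ℝ)| ≤ 2 * 2 ^ Nat.log 2 k.natAbs := by
  have h := Nat.lt_pow_succ_log_self one_lt_two k.natAbs
  rw [← Int.cast_abs, Int.abs_eq_natAbs, ← pow_succ']
  exact_mod_cast h.le

lemma enorm_ofReal_le {x : ℝ} {n : ℕ} (h : |x| ≤ 9 * 2 ^ n) : ‖(x : ℂ)‖ₑ ≤ 9 * 2 ^ n := by
  rw [← ofReal_norm, Complex.norm_real, Real.norm_eq_abs]
  refine (ENNReal.ofReal_le_ofReal h).trans (le_of_eq ?_)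
  rw [ENNReal.ofReal_mul (by norm_num), ENNReal.ofReal_pow (by norm_num)]
  norm_num

/-- The pairwise symmetrized symbol is bounded by the third frequency. -/
lemma enorm_pairSymbol_le (j : ℕ) {p : ℤ × ℤ} (h1 : p.1 ≠ 0) (h2 : p.2 ≠ 0)
    (h3 : -p.1 - p.2 ≠ 0) :
    ‖(((tentSymbol j p.1 + tentSymbol j p.2) / 2 : ℝ) : ℂ)‖ₑ ≤
      symbolBound (fun i => 2 ^ i.2.2) j (blockIndex p) := by
  by_cases hn : NearAny j (blockIndex p)
  · rw [symbolBound, if_pos ⟨hn, admissible_blockIndex h1 h2 h3⟩]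
    refine enorm_ofReal_le ?_
    have h := abs_tentSymbol_add_le j p.1 p.2
    have h' := abs_lt_two_pow_log (-p.1 - p.2)
    rw [show ((-p.1 - p.2 : ℤ) : ℝ) = -((p.1 : ℝ) + p.2) by push_cast; ring, abs_neg] at h'
    rw [abs_div, abs_two, blockIndex]
    linarith
  · have z1 : tent j p.1 = 0 := by
      by_contra h
      exact hn (Or.inl (near_of_tent_ne_zero h).2)
    have z2 : tent j p.2 = 0 := by
      by_contra h
      exact hn (Or.inr (Or.inl (near_of_tent_ne_zero h).2))
    simp [tentSymbol, z1, z2]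

/-- The fully symmetrized symbol is bounded by the lowest frequency. -/
lemma enorm_tripleSymbol_le (j : ℕ) {p : ℤ × ℤ} (h1 : p.1 ≠ 0) (h2 : p.2 ≠ 0)
    (h3 : -p.1 - p.2 ≠ 0) :
    ‖(((tentSymbol j p.1 + tentSymbol j p.2 + tentSymbol j (-p.1 - p.2)) / 3 : ℝ) : ℂ)‖ₑ ≤
      symbolBound (fun i => 2 ^ bot i) j (blockIndex p) := by
  by_cases hn : NearAny j (blockIndex p)
  · rw [symbolBound, if_pos ⟨hn, admissible_blockIndex h1 h2 h3⟩]
    have hm := abs_tentSymbol_sum_le j (show p.1 + p.2 + (-p.1 - p.2) = 0 by ring)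
    have hk := abs_tentSymbol_sum_le j (show p.2 + (-p.1 - p.2) + p.1 = 0 by ring)
    have hl := abs_tentSymbol_sum_le j (show p.1 + (-p.1 - p.2) + p.2 = 0 by ring)
    rw [add_comm, ← add_assoc] at hk
    rw [add_right_comm] at hl
    have bk := abs_lt_two_pow_log p.1
    have bl := abs_lt_two_pow_log p.2
    have bm := abs_lt_two_pow_log (-p.1 - p.2)
    refine enorm_ofReal_le ?_
    -- Dividing by 3 the bound `10 |kᵢ| ≤ 20 · 2 ^ n` at the lowest frequency gives less than `9 · 2
    -- ^ n`.
    rw [abs_div, abs_of_pos (by norm_num : (0 : ℝ) < 3)]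
    have hcase : bot (blockIndex p) = Nat.log 2 p.1.natAbs ∨
        bot (blockIndex p) = Nat.log 2 p.2.natAbs ∨
        bot (blockIndex p) = Nat.log 2 (-p.1 - p.2).natAbs := by
      simp only [bot, blockIndex]
      omega
    rcases hcase with h | h | h <;> rw [h]
    · have : (0 : ℝ) < 2 ^ Nat.log 2 p.1.natAbs := by positivity
      linarith
    · have : (0 : ℝ) < 2 ^ Nat.log 2 p.2.natAbs := by positivity
      linarith
    · have : (0 : ℝ) < 2 ^ Nat.log 2 (-p.1 - p.2).natAbs := by positivity
      linarith
  · have z1 : tent j p.1 = 0 := by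
      by_contra h
      exact hn (Or.inl (near_of_tent_ne_zero h).2)
    have z2 : tent j p.2 = 0 := by
      by_contra h
      exact hn (Or.inr (Or.inl (near_of_tent_ne_zero h).2))
    have z3 : tent j (-p.1 - p.2) = 0 := by
      by_contra h
      exact hn (Or.inr (Or.inr (near_of_tent_ne_zero h).2))
    simp [tentSymbol, z1, z2, z3]

lemma symbolBound_ne_top {μ : ℕ × ℕ × ℕ → ℝ≥0∞} (hμ : ∀ i, μ i ≠ ⊤) (j : ℕ) (i : ℕ × ℕ × ℕ) :
    symbolBound μ j i ≠ ⊤ := by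
  unfold symbolBound
  split_ifs
  · exact ENNReal.mul_ne_top (by norm_num) (hμ i)
  · exact ENNReal.zero_ne_top

end BenjaminOno

namespace BenjaminOno

/-! ### The energy norm and its relatives -/

lemma enorm_projBlock_sq (j : ℕ) (f : Torus → ℝ) :
    ‖projBlock j f‖ₑ ^ 2 = ∑ k ∈ block j, ‖fhat f k‖ₑ ^ 2 := by
  have h : ‖projBlock j f‖ ^ 2 = ∑ k ∈ block j, ‖fhat f k‖ ^ 2 := by
    have h := (orthonormal_fourier (T := 2 * π)).inner_sum (fhat f) (fhat f) (block j)
    change inner ℂ (projBlock j f) (projBlock j f) = _ at h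
    simp_rw [inner_self_eq_norm_sq_to_K, RCLike.conj_mul] at h
    exact_mod_cast h
  simp_rw [← ofReal_norm, ← ENNReal.ofReal_pow (norm_nonneg _)]
  rw [← ENNReal.ofReal_sum_of_nonneg fun _ _ => by positivity, h]

/-- The `L²` energy of the frequencies of size about `2 ^ j`. -/
noncomputable def tentEnergy (j : ℕ) (f : Torus → ℝ) : ℝ≥0∞ :=
  ∑' k, ENNReal.ofReal (tent j k) * ‖fhat f k‖ₑ ^ 2

lemma tentEnergy_eq (j : ℕ) (f : Torus → ℝ) :
    tentEnergy j f = ENNReal.ofReal (∑ k ∈ tentSupport j, tent j k * ‖fhat f k‖ ^ 2) := by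
  rw [tentEnergy, tsum_eq_sum (s := tentSupport j), ENNReal.ofReal_sum_of_nonneg
    fun k _ => mul_nonneg (tent_nonneg j k) (by positivity)]
  · refine Finset.sum_congr rfl fun k _ => ?_
    rw [ENNReal.ofReal_mul (tent_nonneg j k), ENNReal.ofReal_pow (norm_nonneg _), ofReal_norm]
  · intro k hk
    have : tent j k = 0 := by
      by_contra h
      exact hk (mem_tentSupport h)
    rw [this, ENNReal.ofReal_zero, zero_mul]

/-- Vanishing mean is needed because block `0` contains the frequency zero, where every tent
vanishes. -/
lemma enorm_projBlock_sq_le_tentEnergy (j : ℕ) {f : Torus → ℝ} (hf : fhat f 0 = 0) :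
    ‖projBlock j f‖ₑ ^ 2 ≤ tentEnergy j f := by
  rw [enorm_projBlock_sq, tentEnergy]
  refine le_trans (Finset.sum_le_sum fun k hk => ?_) (ENNReal.sum_le_tsum (block j))
  by_cases hk0 : k = 0
  · rw [hk0, hf]
    simp
  · rw [tent_of_mem_block hk hk0, ENNReal.ofReal_one, one_mul]

lemma dyadicWeight_log_le {σ : ℝ} (hσ : 0 ≤ σ) {k : ℤ} (hk : k ≠ 0) :
    dyadicWeight (2 * σ) (Nat.log 2 k.natAbs) ≤ ENNReal.ofReal ((1 + (k : ℝ) ^ 2) ^ σ) := by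
  rw [dyadicWeight, ENNReal.rpow_mul, ← ENNReal.ofReal_rpow_of_pos (by positivity)]
  refine ENNReal.rpow_le_rpow ?_ hσ
  have h : ((2 : ℝ) ^ Nat.log 2 k.natAbs) ^ 2 ≤ 1 + (k : ℝ) ^ 2 := by
    have h1 : (2 : ℝ) ^ Nat.log 2 k.natAbs ≤ |(k : ℝ)| := by
      rw [← Int.cast_abs, Int.abs_eq_natAbs]
      exact_mod_cast Nat.pow_log_le_self 2 (Int.natAbs_ne_zero.mpr hk)
    have h2 := pow_le_pow_left₀ (by positivity) h1 2
    rw [sq_abs] at h2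
    linarith
  refine le_trans (le_of_eq ?_) (ENNReal.ofReal_le_ofReal h)
  rw [ENNReal.ofReal_pow (by positivity), ENNReal.ofReal_pow (by norm_num), ENNReal.ofReal_ofNat,
    ENNReal.rpow_ofNat]

lemma sq_rpow_half (x : ℝ≥0∞) : (x ^ (1 / 2 : ℝ)) ^ 2 = x := by
  rw [← ENNReal.rpow_natCast, ← ENNReal.rpow_mul]
  norm_num

/-- Each frequency meets at most three tents, the highest of them one scale above its own block;
hence the factors 3 and `2 ^ (2σ)`. -/
lemma tsum_tentEnergy_le {σ : ℝ} (hσ : 0 ≤ σ) (f : Torus → ℝ) :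
    ∑' j, dyadicWeight (2 * σ) j * tentEnergy j f ≤ 3 * 2 ^ (2 * σ) * HNorm σ f ^ 2 := by
  have h2σ : 0 ≤ 2 * σ := by linarith
  rw [HNorm, sq_rpow_half]
  simp_rw [tentEnergy, ← ENNReal.tsum_mul_left]
  rw [ENNReal.tsum_comm]
  refine ENNReal.tsum_le_tsum fun k => ?_
  simp_rw [← mul_assoc]
  rw [ENNReal.tsum_mul_right]
  gcongr
  by_cases hk : k = 0
  · have : ∀ j, tent j k = 0 := fun j => by
      by_contra h
      exact (near_of_tent_ne_zero h).1 hk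
    simp [this]
  calc ∑' j, dyadicWeight (2 * σ) j * ENNReal.ofReal (tent j k)
      ≤ ∑' j, if Near j (Nat.log 2 k.natAbs) then dyadicWeight (2 * σ) j else 0 := by
        refine ENNReal.tsum_le_tsum fun j => ?_
        by_cases h : tent j k = 0
        · rw [h, ENNReal.ofReal_zero, mul_zero]
          exact zero_le
        · rw [if_pos (near_of_tent_ne_zero h).2]
          exact mul_le_of_le_one_right' (ENNReal.ofReal_le_one.mpr (tent_le_one j k))
    _ ≤ 3 * dyadicWeight (2 * σ) (Nat.log 2 k.natAbs + 1) := tsum_near_dyadicWeight_le h2σ _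
    _ ≤ _ := by
        rw [dyadicWeight_succ h2σ, ← mul_assoc]
        gcongr
        exact dyadicWeight_log_le hσ hk

lemma HNorm_zero_sq_le {f : Torus → ℝ} (hf : Continuous f) : HNorm 0 f ^ 2 ≤ L2Norm f ^ 2 := by
  set g : C(Torus, ℂ) := ⟨fun x => (f x : ℂ), by fun_prop⟩
  set φ : L2Torus := ContinuousMap.toLp 2 AddCircle.haarAddCircle ℂ g
  have hcoef : ∀ k, coef k φ = fhat f k := fun k => by
    have h := fourierBasis_repr φ k
    rw [fourierCoeff_toLp, HilbertBasis.repr_apply_apply, coe_fourierBasis] at h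
    exact h
  have hnorm : ‖φ‖ₑ = L2Norm f := by
    rw [Lp.enorm_def, L2Norm, eLpNorm_congr_ae (ContinuousMap.coeFn_toLp _ g)]
    exact eLpNorm_congr_norm_ae (Filter.Eventually.of_forall fun x => by simp [g])
  rw [HNorm, sq_rpow_half, ← hnorm, ENNReal.tsum_eq_iSup_sum]
  refine iSup_le fun S => le_trans (le_of_eq ?_) (sum_enorm_coef_sq_le S φ)
  exact Finset.sum_congr rfl fun k _ => by simp [hcoef]

/-- The only content is that squaring commutes with the supremum over windows. -/
lemma ell2_blockNorm_le (σ T : ℝ) (u : ℝ → Torus → ℝ) :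
    ell2 (fun j => dyadicWeight σ j * blockNorm T u j) ≤ FNorm σ T u := by
  refine ENNReal.rpow_le_rpow (ENNReal.tsum_le_tsum fun j => ?_) (by norm_num)
  rw [mul_pow, sq (dyadicWeight σ j), ← dyadicWeight_add, ← two_mul]
  change dyadicWeight (2 * σ) j * _ ≤ dyadicWeight (2 * σ) j * _
  gcongr
  rw [← sq_rpow_half (⨆ (a : ℝ), _), ennreal_sq_le_sq_iff]
  refine iSup_le fun a => iSup₂_le fun ha ha' => ?_
  rw [← ennreal_sq_le_sq_iff, sq_rpow_half]
  exact le_iSup₂_of_le a ha (le_iSup (fun _ => u2Norm a (a + windowLength T j)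
    (fun t => profileBlock j t (u t)) ^ 2) ha')

lemma ell2_blockNorm_le_FNorm_zero (T : ℝ) (u : ℝ → Torus → ℝ) :
    ell2 (blockNorm T u) ≤ FNorm 0 T u := by
  simpa only [dyadicWeight_zero, one_mul] using ell2_blockNorm_le 0 T u

section Energy

variable {T σ s : ℝ} {v z u₁ u₂ : ℝ → Torus → ℝ} {w : ℝ → ℤ → ℂ}

/-- The energy method, block by block. -/
theorem ENorm_sq_le (hσ : 0 ≤ σ) (hv : RegularCoeffs T fun t => fhat (v t))
    (hw : RegularCoeffs T w)
    (hd : ∀ t ∈ Ioo 0 T, ∀ k : ℤ, HasDerivAt (fun τ => fhat (v τ) k)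
      (-(Complex.I * ((k * |k| : ℤ) : ℂ)) * fhat (v t) k +
        Complex.I * k / 2 * ∑' n, fhat (v t) n * w t (k - n)) t) {R : ℕ → ℝ≥0∞}
    (hR : ∀ j, ∀ t₀ ∈ Icc 0 T, ‖∑' p : ℤ × ℤ, ((tentSymbol j p.1 : ℝ) : ℂ) *
      triInt (fun t => fhat (v t)) (fun t => fhat (v t)) w t₀ p‖ₑ ≤ R j) :
    ENorm σ T v ^ 2 ≤
      3 * 2 ^ (2 * σ) * HNorm σ (v 0) ^ 2 + ∑' j, dyadicWeight (2 * σ) j * R j := by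
  rw [ENorm, sq_rpow_half]
  refine le_trans ?_ (add_le_add_left (tsum_tentEnergy_le hσ (v 0)) _)
  rw [← ENNReal.tsum_add]
  refine ENNReal.tsum_le_tsum fun j => ?_
  rw [← mul_add]
  change dyadicWeight (2 * σ) j * _ ≤ _
  gcongr
  refine iSup₂_le fun t₀ ht₀ => (enorm_projBlock_sq_le_tentEnergy j (hv.zero t₀ ht₀)).trans ?_
  refine le_trans ?_ (add_le_add_right (hR j t₀ ht₀) _)
  rw [tentEnergy_eq, tentEnergy_eq, ← ofReal_norm, ← ENNReal.ofReal_add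
    (Finset.sum_nonneg fun k _ => mul_nonneg (tent_nonneg j k) (by positivity)) (norm_nonneg _)]
  exact ENNReal.ofReal_le_ofReal (energy_le hv hw hd (tent_neg j) (fun k => mem_tentSupport)
    (abs_tentSymbol_le_two_pow j) ht₀)

lemma enorm_tsum_triInt_add_le {a c d : ℝ → ℤ → ℂ} {t₀ : ℝ} (ha : RegularCoeffs T a)
    (hc : RegularCoeffs T c) (hd : RegularCoeffs T d) (ht₀ : t₀ ∈ Icc 0 T) (j : ℕ) :
    ‖∑' p : ℤ × ℤ, ((tentSymbol j p.1 : ℝ) : ℂ) * triInt a a (fun t k => c t k + d t k) t₀ p‖ₑ ≤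
      ‖∑' p : ℤ × ℤ, ((tentSymbol j p.1 : ℝ) : ℂ) * triInt a a c t₀ p‖ₑ +
        ‖∑' p : ℤ × ℤ, ((tentSymbol j p.1 : ℝ) : ℂ) * triInt a a d t₀ p‖ₑ := by
  have hm : ∀ p : ℤ × ℤ, ‖((tentSymbol j p.1 : ℝ) : ℂ)‖ ≤ 2 ^ (j + 2) := fun p => by
    rw [Complex.norm_real]
    exact abs_tentSymbol_le_two_pow j _
  simp_rw [triInt_add ha ha hc hd ht₀, mul_add]
  rw [(summable_mul_triInt ha ha hc ht₀ hm).tsum_add (summable_mul_triInt ha ha hd ht₀ hm)]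
  exact enorm_add_le _ _

/-- The energy transfer into block `j` through a coefficient `z`. -/
theorem enorm_tsum_pair_le (hT : 0 < T) (hT1 : T ≤ 1) (hv : RegularCoeffs T fun t => fhat (v t))
    (hz : RegularCoeffs T fun t => fhat (z t)) {t₀ : ℝ} (ht₀ : t₀ ∈ Icc 0 T) (j : ℕ) :
    ‖∑' p : ℤ × ℤ, ((tentSymbol j p.1 : ℝ) : ℂ) *
      triInt (fun t => fhat (v t)) (fun t => fhat (v t)) (fun t => fhat (z t)) t₀ p‖ₑ ≤
      (1 + trilinConst) * ∑' i : ℕ × ℕ × ℕ, symbolBound (fun i => 2 ^ i.2.2) j i *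
        (blockNorm T v i.1 * blockNorm T v i.2.1 * blockNorm T z i.2.2) := by
  rw [tsum_mul_triInt_symm hv hz ht₀ (abs_tentSymbol_le_two_pow j)]
  refine enorm_tsum_triInt_le hT hT1 hv hv hz (P := 2 ^ (j + 2)) (fun p => ?_)
    (symbolBound_ne_top (fun i => by finiteness) j) (fun p => enorm_pairSymbol_le j) ht₀
  have h1 := abs_tentSymbol_le_two_pow j p.1
  have h2 := abs_tentSymbol_le_two_pow j p.2
  have h3 := abs_add_le (tentSymbol j p.1) (tentSymbol j p.2)
  rw [Complex.norm_real, Real.norm_eq_abs, abs_div, abs_two]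
  linarith

/-- The self-interaction part of the energy transfer into block `j`. -/
theorem enorm_tsum_triple_le (hT : 0 < T) (hT1 : T ≤ 1) (hv : RegularCoeffs T fun t => fhat (v t))
    {t₀ : ℝ} (ht₀ : t₀ ∈ Icc 0 T) (j : ℕ) :
    ‖∑' p : ℤ × ℤ, ((tentSymbol j p.1 : ℝ) : ℂ) *
      triInt (fun t => fhat (v t)) (fun t => fhat (v t)) (fun t => fhat (v t)) t₀ p‖ₑ ≤
      (1 + trilinConst) * ∑' i : ℕ × ℕ × ℕ, symbolBound (fun i => 2 ^ bot i) j i *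
        (blockNorm T v i.1 * blockNorm T v i.2.1 * blockNorm T v i.2.2) := by
  rw [tsum_mul_triInt_symm₃ hv ht₀ (abs_tentSymbol_le_two_pow j)]
  refine enorm_tsum_triInt_le hT hT1 hv hv hv (P := 2 ^ (j + 2)) (fun p => ?_)
    (symbolBound_ne_top (fun i => by finiteness) j) (fun p => enorm_tripleSymbol_le j) ht₀
  have h1 := abs_tentSymbol_le_two_pow j p.1
  have h2 := abs_tentSymbol_le_two_pow j p.2
  have h3 := abs_tentSymbol_le_two_pow j (-p.1 - p.2)
  have h4 := abs_add_three (tentSymbol j p.1) (tentSymbol j p.2) (tentSymbol j (-p.1 - p.2))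
  rw [Complex.norm_real, Real.norm_eq_abs, abs_div, abs_of_pos (by norm_num : (0 : ℝ) < 3)]
  linarith

/-- The constant of the energy transfer through a coefficient. -/
noncomputable def pairConst (σ s : ℝ) : ℝ≥0∞ :=
  (1 + trilinConst) * (81 * (6 * (2 ^ σ) ^ 4 * dyadicSum (s - 1)))

/-- The constant of the self-interaction. -/
noncomputable def tripleConst (s : ℝ) : ℝ≥0∞ :=
  (1 + trilinConst) * (81 * (9 * (2 ^ s) ^ 4 * dyadicSum (s - 1)))

lemma pairConst_ne_top (hσ : 0 ≤ σ) (hs : 1 < s) : pairConst σ s ≠ ⊤ := by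
  have h1 := dyadicSum_ne_top (sub_pos.mpr hs)
  have h2 : trilinConst ≠ ⊤ := ENNReal.ofReal_ne_top
  have h3 : (2 : ℝ≥0∞) ^ σ ≠ ⊤ := ENNReal.rpow_ne_top_of_nonneg hσ (by norm_num)
  unfold pairConst
  finiteness

lemma tripleConst_ne_top (hs : 1 < s) : tripleConst s ≠ ⊤ := by
  have h1 := dyadicSum_ne_top (sub_pos.mpr hs)
  have h2 : trilinConst ≠ ⊤ := ENNReal.ofReal_ne_top
  have h3 : (2 : ℝ≥0∞) ^ s ≠ ⊤ := ENNReal.rpow_ne_top_of_nonneg (by linarith) (by norm_num)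
  unfold tripleConst
  finiteness

lemma tsum_pair_le (hσ : 0 ≤ σ) (hs : 1 < s) (T : ℝ) (v z : ℝ → Torus → ℝ) :
    ∑' j, dyadicWeight (2 * σ) j * ((1 + trilinConst) * ∑' i : ℕ × ℕ × ℕ,
      symbolBound (fun i => 2 ^ i.2.2) j i *
        (blockNorm T v i.1 * blockNorm T v i.2.1 * blockNorm T z i.2.2)) ≤
      pairConst σ s * (FNorm σ T v ^ 2 * FNorm s T z +
        FNorm 0 T v * FNorm σ T v * FNorm (σ + s) T z) := by
  simp_rw [mul_left_comm (dyadicWeight _ _) (1 + trilinConst)]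
  rw [ENNReal.tsum_mul_left, pairConst, mul_assoc]
  gcongr
  refine (tsum_tsum_symbolBound_le hσ _ _).trans ?_
  rw [mul_assoc]
  gcongr
  refine (tsum_admissible_third_le hσ hs _ _).trans ?_
  gcongr <;> first | exact ell2_blockNorm_le _ _ _ | exact ell2_blockNorm_le_FNorm_zero _ _

lemma tsum_triple_le (hs : 1 < s) (T : ℝ) (v : ℝ → Torus → ℝ) :
    ∑' j, dyadicWeight (2 * s) j * ((1 + trilinConst) * ∑' i : ℕ × ℕ × ℕ,
      symbolBound (fun i => 2 ^ bot i) j i *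
        (blockNorm T v i.1 * blockNorm T v i.2.1 * blockNorm T v i.2.2)) ≤
      tripleConst s * FNorm s T v ^ 3 := by
  simp_rw [mul_left_comm (dyadicWeight _ _) (1 + trilinConst)]
  rw [ENNReal.tsum_mul_left, tripleConst, mul_assoc]
  gcongr
  refine (tsum_tsum_symbolBound_le (by linarith) _ _).trans ?_
  rw [mul_assoc]
  gcongr
  refine (tsum_admissible_bot_le hs _).trans ?_
  gcongr
  exact ell2_blockNorm_le _ _ _

/-! ### Differences of solutions -/

lemma fhat_difference (hu₁ : IsSmoothSolution T u₁) (hu₂ : IsSmoothSolution T u₂) {t : ℝ}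
    (ht : t ∈ Icc 0 T) (k : ℤ) :
    fhat ((u₁ - u₂) t) k = fhat (u₁ t) k - fhat (u₂ t) k :=
  fhat_sub (hu₁.continuous_slice ht) (hu₂.continuous_slice ht) k

lemma regularCoeffs_difference (hT : 0 < T) (hu₁ : IsSmoothSolution T u₁)
    (hu₂ : IsSmoothSolution T u₂) : RegularCoeffs T fun t => fhat ((u₁ - u₂) t) where
  continuousOn k := (((hu₁.regularCoeffs hT).sub (hu₂.regularCoeffs hT)).continuousOn k).congr
    fun _ ht => fhat_difference hu₁ hu₂ ht k
  decay := by
    obtain ⟨D, hD0, hD⟩ := ((hu₁.regularCoeffs hT).sub (hu₂.regularCoeffs hT)).decay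
    refine ⟨D, hD0, fun t ht k => ?_⟩
    rw [fhat_difference hu₁ hu₂ ht]
    exact hD t ht k
  conj _ _ := fhat_neg _ _
  zero t ht := by
    rw [fhat_difference hu₁ hu₂ ht, hu₁.fhat_zero hT ht, hu₂.fhat_zero hT ht, sub_zero]

/-- This is `u₁² - u₂² = (u₁ - u₂)(u₁ + u₂)` for convolutions; the two cross terms are Fourier
coefficients of the same product and cancel. -/
lemma hasDerivAt_fhat_difference (hT : 0 < T) (hu₁ : IsSmoothSolution T u₁)
    (hu₂ : IsSmoothSolution T u₂) {t : ℝ} (ht : t ∈ Ioo 0 T) (k : ℤ) :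
    HasDerivAt (fun τ => fhat ((u₁ - u₂) τ) k)
      (-(Complex.I * ((k * |k| : ℤ) : ℂ)) * fhat ((u₁ - u₂) t) k +
        Complex.I * k / 2 * ∑' n, fhat ((u₁ - u₂) t) n *
          (fhat (u₁ t) (k - n) + fhat (u₂ t) (k - n))) t := by
  have ht' := Ioo_subset_Icc_self ht
  have h := (hu₁.hasDerivAt_fhat hT ht k).sub (hu₂.hasDerivAt_fhat hT ht k)
  refine HasDerivAt.congr_of_eventuallyEq ?_ (f := fun τ => fhat (u₁ τ) k - fhat (u₂ τ) k) ?_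
  swap
  · filter_upwards [Ioo_mem_nhds ht.1 ht.2] with τ hτ
    exact fhat_difference hu₁ hu₂ (Ioo_subset_Icc_self hτ) k
  refine h.congr_deriv ?_
  have c₁ := hu₁.continuous_slice ht'
  have c₂ := hu₂.continuous_slice ht'
  have s₁ := hu₁.summable_fhat hT ht'
  have s₂ := hu₂.summable_fhat hT ht'
  have h₁₁ := fhat_mul c₁ c₁ s₁ k
  have h₂₂ := fhat_mul c₂ c₂ s₂ k
  have h₁₂ := fhat_mul c₁ c₂ s₁ k
  have h₂₁ := fhat_mul c₂ c₁ s₂ k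
  rw [show (fun x => u₂ t x * u₁ t x) = fun x => u₁ t x * u₂ t x from
    funext fun x => mul_comm _ _] at h₂₁
  have hsum := (h₁₁.add h₁₂).sub (h₂₁.add h₂₂)
  have e : ∑' n, fhat ((u₁ - u₂) t) n * (fhat (u₁ t) (k - n) + fhat (u₂ t) (k - n)) =
      fhat (fun x => u₁ t x * u₁ t x) k - fhat (fun x => u₂ t x * u₂ t x) k := by
    rw [← add_sub_add_right_eq_sub _ _ (fhat (fun x => u₁ t x * u₂ t x) k),
      add_comm (fhat (fun x => u₂ t x * u₂ t x) k), ← hsum.tsum_eq]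
    refine tsum_congr fun n => ?_
    rw [fhat_difference hu₁ hu₂ ht']
    ring
  rw [e, h₁₁.tsum_eq, h₂₂.tsum_eq, fhat_difference hu₁ hu₂ ht']
  ring

/-- At regularity zero the coefficient `u₁ + u₂` is kept whole and only the pair symmetrization is
used. -/
theorem ENorm_zero_difference_le (hs : 1 < s) (hT : 0 < T) (hT1 : T ≤ 1)
    (hu₁ : IsSmoothSolution T u₁) (hu₂ : IsSmoothSolution T u₂) :
    ENorm 0 T (u₁ - u₂) ^ 2 ≤ 3 * L2Norm ((u₁ - u₂) 0) ^ 2 + 2 * pairConst 0 s *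
      (FNorm 0 T (u₁ - u₂) ^ 2 * (FNorm s T u₁ + FNorm s T u₂)) := by
  have hv := regularCoeffs_difference hT hu₁ hu₂
  have r₁ := hu₁.regularCoeffs hT
  have r₂ := hu₂.regularCoeffs hT
  have h0 : (0 : ℝ) ∈ Icc 0 T := ⟨le_rfl, hT.le⟩
  have h := ENorm_sq_le le_rfl hv (r₁.add r₂)
    (fun t ht k => hasDerivAt_fhat_difference hT hu₁ hu₂ ht k)
    (fun j t₀ ht₀ => (enorm_tsum_triInt_add_le hv r₁ r₂ ht₀ j).trans
      (add_le_add (enorm_tsum_pair_le hT hT1 hv r₁ ht₀ j)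
        (enorm_tsum_pair_le hT hT1 hv r₂ ht₀ j)))
  simp_rw [mul_add (dyadicWeight _ _)] at h
  rw [ENNReal.tsum_add] at h
  refine h.trans ((add_le_add (mul_le_mul_right (HNorm_zero_sq_le
    ((hu₁.continuous_slice h0).sub (hu₂.continuous_slice h0))) _)
    (add_le_add (tsum_pair_le le_rfl hs T _ _) (tsum_pair_le le_rfl hs T _ _))).trans
    (le_of_eq ?_))
  -- For `σ = 0` the two terms of `tsum_pair_le` coincide, whence the factor 2.
  rw [zero_add, mul_zero, ENNReal.rpow_zero, Pi.sub_apply]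
  ring

/-- The coefficient is rewritten as `v + u₂ + u₂`. The self-interaction of `v` allows full
symmetrization and stays in `F^s`, so that only `u₂` is measured in `F^{2s}`. -/
theorem ENorm_difference_le (hs : 1 < s) (hT : 0 < T) (hT1 : T ≤ 1)
    (hu₁ : IsSmoothSolution T u₁) (hu₂ : IsSmoothSolution T u₂) :
    ENorm s T (u₁ - u₂) ^ 2 ≤ 3 * 2 ^ (2 * s) * HNorm s ((u₁ - u₂) 0) ^ 2 +
      (tripleConst s * FNorm s T (u₁ - u₂) ^ 3 + 2 * pairConst s s *
        (FNorm s T (u₁ - u₂) ^ 2 * FNorm s T u₂ +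
          FNorm 0 T (u₁ - u₂) * FNorm s T (u₁ - u₂) * FNorm (2 * s) T u₂)) := by
  have hs0 : 0 ≤ s := by linarith
  have hv := regularCoeffs_difference hT hu₁ hu₂
  have r₂ := hu₂.regularCoeffs hT
  have hd : ∀ t ∈ Ioo 0 T, ∀ k : ℤ, HasDerivAt (fun τ => fhat ((u₁ - u₂) τ) k)
      (-(Complex.I * ((k * |k| : ℤ) : ℂ)) * fhat ((u₁ - u₂) t) k +
        Complex.I * k / 2 * ∑' n, fhat ((u₁ - u₂) t) n *
          (fhat ((u₁ - u₂) t) (k - n) + fhat (u₂ t) (k - n) + fhat (u₂ t) (k - n))) t := by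
    intro t ht k
    have h := hasDerivAt_fhat_difference hT hu₁ hu₂ ht k
    refine h.congr_deriv ?_
    congr 2
    refine tsum_congr fun n => ?_
    rw [fhat_difference hu₁ hu₂ (Ioo_subset_Icc_self ht) (k - n)]
    ring
  have h := ENorm_sq_le hs0 hv ((hv.add r₂).add r₂) hd
    (fun j t₀ ht₀ => (enorm_tsum_triInt_add_le hv (hv.add r₂) r₂ ht₀ j).trans
      (add_le_add ((enorm_tsum_triInt_add_le hv hv r₂ ht₀ j).trans
        (add_le_add (enorm_tsum_triple_le hT hT1 hv ht₀ j)
          (enorm_tsum_pair_le hT hT1 hv r₂ ht₀ j)))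
        (enorm_tsum_pair_le hT hT1 hv r₂ ht₀ j)))
  simp_rw [mul_add (dyadicWeight _ _)] at h
  rw [ENNReal.tsum_add, ENNReal.tsum_add] at h
  refine h.trans (add_le_add_right ((add_le_add (add_le_add (tsum_triple_le hs T _)
    (tsum_pair_le hs0 hs T _ _)) (tsum_pair_le hs0 hs T _ _)).trans (le_of_eq ?_)) _)
  rw [← two_mul s]
  ring

end Energy

/-! ### The zero solution -/

lemma fhat_zero_fun (k : ℤ) : fhat 0 k = 0 := by
  simp [fhat, fourierCoeff]

lemma isSmoothSolution_zero (T : ℝ) : IsSmoothSolution T 0 where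
  smooth := contDiffOn_const
  equation t _ x := by
    have hdx : dx ((0 : ℝ → Torus → ℝ) t) = 0 := funext fun x => by simp [dx]
    have hdx' : dx (0 : Torus → ℝ) = 0 := funext fun x => by simp [dx]
    rw [hdx, hdx']
    simp [hilbertTransform, fhat_zero_fun]
  mean_zero := by simp

/-- Atoms have unit size, so zero is represented by vanishing coefficients times an actual atom;
such an atom exists because the interval is nonempty. -/
lemma u2Norm_zero {a b : ℝ} (hab : a < b) : u2Norm a b (fun _ => (0 : L2Torus)) = 0 := by
  have hatom : IsU2Atom a b ((Ico a b).indicator fun _ => (fourierLp 2 0 : L2Torus)) := by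
    refine ⟨1, ![a, b], fun _ => fourierLp 2 0, ?_, rfl, rfl, ?_, fun t => by simp⟩
    · intro i j hij
      fin_cases i <;> fin_cases j <;> simp_all
    · simp [(orthonormal_fourier (T := 2 * π)).1 0]
  refine le_antisymm ?_ zero_le
  refine (iInf₂_le (fun _ => 0) fun _ => (Ico a b).indicator fun _ => fourierLp 2 0).trans ?_
  refine (iInf₂_le (fun _ => hatom) fun t _ => by simp).trans ?_
  simp

lemma FNorm_zero_fun {T : ℝ} (hT : 0 < T) (σ : ℝ) : FNorm σ T 0 = 0 := by
  have h : ∀ (j : ℕ) (a : ℝ), u2Norm a (a + windowLength T j)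
      (fun t => profileBlock j t ((0 : ℝ → Torus → ℝ) t)) = 0 := fun j a => by
    rw [← u2Norm_zero (show a < a + windowLength T j by linarith [windowLength_pos hT j])]
    congr 1
    funext t
    simp [profileBlock, fhat_zero_fun]
  simp only [FNorm, h]
  simp

end BenjaminOno

/-! ### Collecting the constants -/

theorem mainTheorem7 (s : ℝ) (hs : 1 < s) :
    ∃ C : ℝ≥0, ∀ T : ℝ, 0 < T → T ≤ 1 →
      (∀ u : ℝ → BenjaminOno.Torus → ℝ, BenjaminOno.IsSmoothSolution T u →
        BenjaminOno.ENorm s T u ^ 2 ≤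
          C * (BenjaminOno.HNorm s (u 0) ^ 2 + BenjaminOno.FNorm s T u ^ 3)) ∧
      (∀ u₁ u₂ v : ℝ → BenjaminOno.Torus → ℝ,
        BenjaminOno.IsSmoothSolution T u₁ → BenjaminOno.IsSmoothSolution T u₂ → v = u₁ - u₂ →
          BenjaminOno.ENorm 0 T v ^ 2 ≤
            C * (BenjaminOno.L2Norm (v 0) ^ 2 +
              BenjaminOno.FNorm 0 T v ^ 2 *
                (BenjaminOno.FNorm s T u₁ + BenjaminOno.FNorm s T u₂)) ∧
          BenjaminOno.ENorm s T v ^ 2 ≤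
            C * (BenjaminOno.HNorm s (v 0) ^ 2 + BenjaminOno.FNorm s T v ^ 3 +
              BenjaminOno.FNorm s T v ^ 2 * BenjaminOno.FNorm s T u₂ +
              BenjaminOno.FNorm 0 T v * BenjaminOno.FNorm s T v *
                BenjaminOno.FNorm (2 * s) T u₂)) := by
  have hs0 : 0 ≤ s := by linarith
  set K : ℝ≥0∞ := 3 * 2 ^ (2 * s) + 3 + 2 * BenjaminOno.pairConst 0 s +
    2 * BenjaminOno.pairConst s s + BenjaminOno.tripleConst s with hK
  have hKtop : K ≠ ⊤ := by
    have h1 := BenjaminOno.pairConst_ne_top le_rfl hs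
    have h2 := BenjaminOno.pairConst_ne_top hs0 hs
    have h3 := BenjaminOno.tripleConst_ne_top hs
    have h4 : (2 : ℝ≥0∞) ^ (2 * s) ≠ ⊤ :=
      ENNReal.rpow_ne_top_of_nonneg (by linarith) (by norm_num)
    rw [hK]
    finiteness
  have k₁ : 3 * 2 ^ (2 * s) ≤ K :=
    (le_self_add.trans le_self_add).trans (le_self_add.trans le_self_add)
  have k₂ : 3 ≤ K := (le_add_self.trans le_self_add).trans (le_self_add.trans le_self_add)
  have k₃ : 2 * BenjaminOno.pairConst 0 s ≤ K :=
    le_add_self.trans (le_self_add.trans le_self_add)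
  have k₄ : 2 * BenjaminOno.pairConst s s ≤ K := le_add_self.trans le_self_add
  have k₅ : BenjaminOno.tripleConst s ≤ K := le_add_self
  have hdiff : ∀ T : ℝ, 0 < T → T ≤ 1 → ∀ u₁ u₂ : ℝ → BenjaminOno.Torus → ℝ,
      BenjaminOno.IsSmoothSolution T u₁ → BenjaminOno.IsSmoothSolution T u₂ →
      BenjaminOno.ENorm s T (u₁ - u₂) ^ 2 ≤
        K * (BenjaminOno.HNorm s ((u₁ - u₂) 0) ^ 2 + BenjaminOno.FNorm s T (u₁ - u₂) ^ 3 +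
          BenjaminOno.FNorm s T (u₁ - u₂) ^ 2 * BenjaminOno.FNorm s T u₂ +
          BenjaminOno.FNorm 0 T (u₁ - u₂) * BenjaminOno.FNorm s T (u₁ - u₂) *
            BenjaminOno.FNorm (2 * s) T u₂) := by
    intro T hT hT1 u₁ u₂ hu₁ hu₂
    refine (BenjaminOno.ENorm_difference_le hs hT hT1 hu₁ hu₂).trans ((add_le_add
      (mul_le_mul_left k₁ _) (add_le_add (mul_le_mul_left k₅ _) (mul_le_mul_left k₄ _))).trans
      (le_of_eq ?_))
    ring
  refine ⟨K.toNNReal, fun T hT hT1 => ?_⟩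
  rw [ENNReal.coe_toNNReal hKtop]
  refine ⟨fun u hu => ?_, fun u₁ u₂ v hu₁ hu₂ hv => ?_⟩
  -- A single solution is the difference with the zero solution, for which every term containing
  -- `u₂` vanishes.
  · have h := hdiff T hT hT1 u 0 hu (BenjaminOno.isSmoothSolution_zero T)
    simpa only [sub_zero, BenjaminOno.FNorm_zero_fun hT, mul_zero, add_zero] using h
  · subst hv
    refine ⟨?_, hdiff T hT hT1 u₁ u₂ hu₁ hu₂⟩
    refine (BenjaminOno.ENorm_zero_difference_le hs hT hT1 hu₁ hu₂).trans ((add_le_add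
      (mul_le_mul_left k₂ _) (mul_le_mul_left k₃ _)).trans (le_of_eq ?_))
    ring
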